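/- Consider two cases. Radial: $\mathbf D=\mathbb D$ (unit disk), $\mathfrak z=1$, $\mathfrak w=0$, $d_{\mathbf D}(z,w)=|z-w|$. Chordal: $\mathbf D=\mathbb H$ (upper half-plane), $\mathfrak z=0$, $\mathfrak w=\infty$, $d_{\mathbf D}(z,w)=|\Phi(z)-\Phi(w)|$ with $\Phi(z)=\frac{2\mathrm i-z}{2\mathrm i+z}$. Throughout, $\overline{\mathbf D}\subset\mathbb C$ is the Euclidean closure. A hull is a compact set $K\subset\overline{\mathbf D}$ with $\mathfrak z\in K$, $\mathfrak w\notin K$ and $\mathbf D\smallsetminus K$ simply connected. Its mapping-out function is the conformal bijection $g_K:\mathbf D\smallsetminus K\to\mathbf D$ with $g_K(0)=0$, $g_K'(0)>0$ (radial), respectively $g_K(z)-z\to0$ as $|z|\to\infty$ (chordal). The hull $K$ has capacity $t\ge 0$ if $g_K'(0)^{-1}=e^{-t}$ (radial), respectively $\lim_{|z|\to\infty}z(g_K(z)-z)=2t$ (chordal). For $0\le T<\infty$, let $\mathcal X_T$ be the set of injective continuous curves $\gamma:[0,T]\to\overline{\mathbf D}$ with $\gamma(0)=\mathfrak z$ and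 $\gamma(0,T]\subset\mathbf D$ such that $\gamma[0,t]$ is a hull of capacity $t$ for every $t\in[0,T]$. For curves $\gamma:[0,T]\to\overline{\mathbf D}$ and $\tilde\gamma:[0,\tilde T]\to\overline{\mathbf D}$ set $$d_{\mathcal X}(\gamma,\tilde\gamma)=\sup_{t\ge0}d_{\mathbf D}\big(\gamma(t\wedge T),\tilde\gamma(t\wedge\tilde T)\big),\qquad d^E(\gamma,\tilde\gamma)=\sup_{t\ge0}\big|\gamma(t\wedge T)-\tilde\gamma(t\wedge\tilde T)\big|,$$ $$d^\circ(\gamma,\tilde\gamma)=\inf_\sigma\sup_{s\in[0,1]}d_{\mathbf D}\big(\gamma(sT),\tilde\gamma(\sigma(s)\tilde T)\big),$$ where $\sigma$ runs over the increasing homeomorphisms of $[0,1]$. Let $\overline{\mathcal X}_T$ be the closure of $\mathcal X_T$ under $d_{\mathcal X}$ in the space of continuous curves $[0,T]\to\overline{\mathbf D}$, and put $\mathcal X_{<\infty}=\bigcup_{T<\infty}\mathcal X_T$, $\overline{\mathcal X}_{<\infty}=\bigcup_{T<\infty}\overline{\mathcal X}_T$. For $\gamma\in\mathcal X_T$ with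 mapping-out function $g_T$ of $\gamma[0,T]$, let $W_T=\lim_{z\to\gamma(T)}g_T(z)$ be the image of the tip, let $\hat g_T=W_T^{-1}g_T$ (radial), respectively $\hat g_T=g_T-W_T$ (chordal), be the centered map, and let $\hat f_T:\overline{\mathbf D}\to\overline{\mathbf D}$ be the continuous extension of $\hat g_T^{-1}$. The conformal concatenation of $\gamma\in\mathcal X_T$ and $\eta\in\overline{\mathcal X}_S$ is the curve $\gamma*\eta$ on $[0,T+S]$ equal to $\gamma(t)$ for $t\in[0,T]$ and to $\hat f_T(\eta(t-T))$ for $t\in(T,T+S]$. Then, in both cases, $(\gamma,\eta)\mapsto\gamma*\eta$ is a well-defined map $\mathcal X_{<\infty}\times\overline{\mathcal X}_{<\infty}\to\overline{\mathcal X}_{<\infty}$ (in particular, $W_T$ and $\hat f_T$ exist), and it is continuous when all spaces carry the topology induced by $d_{\mathcal X}$, when they all carry that induced by $d^E$, and when they all carry that induced by $d^\circ$. -/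

import Mathlib

open Set Filter Topology
open scoped NNReal ENNReal

/-- The two reference set-ups: `radial` (unit disk, from `1` to the interior point `0`) and
`chordal` (upper half-plane, from `0` to `∞`). -/
inductive LoewnerCase where
  | radial
  | chordal

namespace LoewnerCase

/-- The reference domain: the open unit disk or the open upper half-plane. -/
def domain : LoewnerCase → Set ℂ
  | radial => {z | ‖z‖ < 1}
  | chordal => {z | 0 < z.im}

/-- The starting point of the curves. -/
def start : LoewnerCase → ℂ
  | radial => 1
  | chordal => 0

/-- The conformal map onto the unit disk fixing the metric of the domain: the identity of the disk,
or the Möbius map of the half-plane onto the disk with `0 ↦ 1` and `2i ↦ 0`. Its denominator does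
not vanish on the closed half-plane. -/
noncomputable def toDisk : LoewnerCase → ℂ → ℂ
  | radial, z => z
  | chordal, z => (2 * Complex.I - z) / (2 * Complex.I + z)

/-- The target point (`0`, resp. `∞`) is not in `K`. In the chordal case this is the boundedness
of `K`. -/
def AvoidsTarget : LoewnerCase → Set ℂ → Prop
  | radial, K => (0 : ℂ) ∉ K
  | chordal, K => Bornology.IsBounded K

/-- Hulls containing the starting point and not the target point. -/
structure IsHull (G : LoewnerCase) (K : Set ℂ) : Prop where
  isCompact : IsCompact K
  subset : K ⊆ closure G.domain
  simplyConnected : IsSimplyConnected (G.domain \ K)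
  start_mem : G.start ∈ K
  avoidsTarget : G.AvoidsTarget K

/-- The normalization of mapping-out functions: `g 0 = 0` and `g' 0 > 0` in the radial case,
`g z - z → 0` as `|z| → ∞` in the chordal case. -/
def Normalized : LoewnerCase → Set ℂ → (ℂ → ℂ) → Prop
  | radial, _, g => g 0 = 0 ∧ ∃ r : ℝ, 0 < r ∧ deriv g 0 = (r : ℂ)
  | chordal, K, g =>
      Tendsto (fun z : ℂ => g z - z) (Bornology.cobounded ℂ ⊓ 𝓟 (chordal.domain \ K)) (𝓝 0)

/-- `g` (restricted to `G.domain \ K`) is the mapping-out function of `K`: the normalized conformal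
map of `G.domain \ K` onto `G.domain`. -/
structure IsMappingOut (G : LoewnerCase) (K : Set ℂ) (g : ℂ → ℂ) : Prop where
  differentiableOn : DifferentiableOn ℂ g (G.domain \ K)
  bijOn : BijOn g (G.domain \ K) G.domain
  normalized : G.Normalized K g

/-- The expansion of the mapping-out function `g` of `K` that says that `K` has capacity `t`:
conformal radius `1 / g' 0 = exp (-t)` seen from `0` in the radial case, half-plane capacity
`lim z (g z - z) = 2 t` in the chordal case. -/
def CapacityExpansion : LoewnerCase → Set ℂ → (ℂ → ℂ) → ℝ → Prop
  | radial, _, g, t => (deriv g 0)⁻¹ = (Real.exp (-t) : ℂ)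
  | chordal, K, g, t =>
      Tendsto (fun z : ℂ => z * (g z - z)) (Bornology.cobounded ℂ ⊓ 𝓟 (chordal.domain \ K))
        (𝓝 ((2 * t : ℝ) : ℂ))

/-- `K` is a hull of capacity `t`. -/
def IsHullOfCapacity (G : LoewnerCase) (K : Set ℂ) (t : ℝ) : Prop :=
  G.IsHull K ∧ ∃ g, G.IsMappingOut K g ∧ G.CapacityExpansion K g t

/-- Centering a value `u` of a mapping-out function, where `w` is the image of the tip:
`exp (-iω) u` with `w = exp (iω)` in the radial case, `u - w` in the chordal case. -/
noncomputable def center : LoewnerCase → ℂ → ℂ → ℂ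
  | radial, w, u => w⁻¹ * u
  | chordal, w, u => u - w

end LoewnerCase

/-- Continuous curves `[0, T] → closure G.domain` with `T` finite; a curve is stored together with
its extension to `[0, ∞)` by the constant value `γ T`, that is, as the map `t ↦ γ (min t T)`. -/
structure StoppedCurve (G : LoewnerCase) where
  lifetime : ℝ≥0
  toFun : ℝ≥0 → ℂ
  continuous_toFun : Continuous toFun
  mem_closure : ∀ t, toFun t ∈ closure G.domain
  stopped : ∀ t, lifetime ≤ t → toFun t = toFun lifetime

/-- The three metrics on curves: the capacity-parameterized one, the Euclidean one, and the
unparameterized one. -/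
inductive CurveMetric where
  | capacity
  | euclidean
  | unparameterized

namespace StoppedCurve

variable {G : LoewnerCase}

/-- The curve reparameterized proportionally by the unit interval and mapped to the closed disk. -/
noncomputable def unitPath (γ : StoppedCurve G) (s : unitInterval) : ℂ :=
  G.toDisk (γ.toFun (⟨s, s.2.1⟩ * γ.lifetime))

/-- The distances between curves. Increasing homeomorphisms of `[0, 1]` are its order
automorphisms; curves of lifetime `0` are regarded as constant maps on `[0, 1]`. -/
noncomputable def distance : CurveMetric → StoppedCurve G → StoppedCurve G → ℝ≥0∞
  | .capacity, γ, η => ⨆ t : ℝ≥0, edist (G.toDisk (γ.toFun t)) (G.toDisk (η.toFun t))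
  | .euclidean, γ, η => ⨆ t : ℝ≥0, edist (γ.toFun t) (η.toFun t)
  | .unparameterized, γ, η =>
      ⨅ σ : unitInterval ≃o unitInterval, ⨆ s, edist (γ.unitPath s) (η.unitPath (σ s))

theorem distance_self (m : CurveMetric) (γ : StoppedCurve G) : distance m γ γ = 0 := by
  cases m
  · simp [distance]
  · simp [distance]
  · refine le_antisymm (iInf_le_of_le (OrderIso.refl _) ?_) zero_le
    simp

theorem distance_comm (m : CurveMetric) (γ η : StoppedCurve G) :
    distance m γ η = distance m η γ := by
  cases m
  · simp only [distance, edist_comm]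
  · simp only [distance, edist_comm]
  · have key : ∀ γ η : StoppedCurve G,
        distance .unparameterized γ η ≤ distance .unparameterized η γ := by
      intro γ η
      refine le_iInf fun σ => iInf_le_of_le σ.symm (iSup_le fun s => ?_)
      refine le_iSup_of_le (σ.symm s) ?_
      rw [edist_comm, σ.apply_symm_apply]
    exact le_antisymm (key _ _) (key _ _)

theorem distance_triangle (m : CurveMetric) (γ η ζ : StoppedCurve G) :
    distance m γ ζ ≤ distance m γ η + distance m η ζ := by
  cases m
  · refine iSup_le fun t => (edist_triangle _ (G.toDisk (η.toFun t)) _).trans ?_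
    exact add_le_add (le_iSup (fun t => edist (G.toDisk (γ.toFun t)) (G.toDisk (η.toFun t))) t)
      (le_iSup (fun t => edist (G.toDisk (η.toFun t)) (G.toDisk (ζ.toFun t))) t)
  · refine iSup_le fun t => (edist_triangle _ (η.toFun t) _).trans ?_
    exact add_le_add (le_iSup (fun t => edist (γ.toFun t) (η.toFun t)) t)
      (le_iSup (fun t => edist (η.toFun t) (ζ.toFun t)) t)
  · simp only [distance]
    refine ENNReal.le_iInf_add_iInf fun σ τ => ?_
    refine iInf_le_of_le (σ.trans τ) (iSup_le fun s => ?_)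
    refine (edist_triangle _ (η.unitPath (σ s)) _).trans ?_
    exact add_le_add (le_iSup (fun s => edist (γ.unitPath s) (η.unitPath (σ s))) s)
      (le_iSup (fun s => edist (η.unitPath s) (ζ.unitPath (τ s))) (σ s))

/-- The (extended, pseudo-)metric structure given by one of the three distances. -/
@[reducible] noncomputable def metricStructure (G : LoewnerCase) (m : CurveMetric) :
    PseudoEMetricSpace (StoppedCurve G) where
  edist := distance m
  edist_self := distance_self m
  edist_comm := distance_comm m
  edist_triangle := distance_triangle m

/-- The topology induced by one of the three distances. -/
@[reducible] noncomputable def topology (G : LoewnerCase) (m : CurveMetric) :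
    TopologicalSpace (StoppedCurve G) :=
  (metricStructure G m).toUniformSpace.toTopologicalSpace

/-- The initial segment `γ[0, t]`. -/
def segment (γ : StoppedCurve G) (t : ℝ≥0) : Set ℂ := γ.toFun '' Icc 0 t

/-- The whole curve `γ[0, T]`. -/
def trace (γ : StoppedCurve G) : Set ℂ := γ.segment γ.lifetime

/-- The tip `γ T`. -/
def tip (γ : StoppedCurve G) : ℂ := γ.toFun γ.lifetime

/-- Simple curves of finite capacity parameterized by capacity. The tip of such a curve is in the
open domain, since a crosscut disconnects the domain and hence is not a hull. -/
structure IsSimple (γ : StoppedCurve G) : Prop where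
  start_eq : γ.toFun 0 = G.start
  injOn : InjOn γ.toFun (Icc 0 γ.lifetime)
  mem_domain : ∀ t, 0 < t → t ≤ γ.lifetime → γ.toFun t ∈ G.domain
  capacity_eq : ∀ t, t ≤ γ.lifetime → G.IsHullOfCapacity (γ.segment t) t

/-- `f` (restricted to `closure G.domain`) is the continuous extension to the closed domain of the
inverse of the centered mapping-out function of the curve `γ`. Here `g` is the mapping-out function
of `γ[0, T]` and `w` is the image of the tip `γ T` under `g`. -/
def IsCenteredInverse (γ : StoppedCurve G) (f : ℂ → ℂ) : Prop :=
  ∃ (g : ℂ → ℂ) (w : ℂ), G.IsMappingOut γ.trace g ∧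
    Tendsto g (𝓝[G.domain \ γ.trace] γ.tip) (𝓝 w) ∧
    ContinuousOn f (closure G.domain) ∧
    ∀ z ∈ G.domain, f z ∈ G.domain \ γ.trace ∧ G.center w (g (f z)) = z

/-- `ζ` is the conformal concatenation of `γ` and `η`: it follows `γ` on `[0, T]` and the image of
`η` under the inverse of the centered mapping-out function of `γ` afterwards. -/
def IsConcatenation (γ η ζ : StoppedCurve G) : Prop :=
  ∃ f : ℂ → ℂ, γ.IsCenteredInverse f ∧ ζ.lifetime = γ.lifetime + η.lifetime ∧
    (∀ t, t ≤ γ.lifetime → ζ.toFun t = γ.toFun t) ∧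
    (∀ t, γ.lifetime < t → t ≤ γ.lifetime + η.lifetime →
      ζ.toFun t = f (η.toFun (t - γ.lifetime)))

/-- Simple capacity-parameterized curves of capacity `T`. -/
def simpleOfCapacity (G : LoewnerCase) (T : ℝ≥0) : Set (StoppedCurve G) :=
  {γ | γ.IsSimple ∧ γ.lifetime = T}

/-- The closure, under the capacity-parameterized metric, of the simple curves of capacity `T` in
the space of curves `[0, T] → closure G.domain`. -/
def closureOfCapacity (G : LoewnerCase) (T : ℝ≥0) : Set (StoppedCurve G) :=
  {γ | γ.lifetime = T ∧ γ ∈ @closure _ (topology G .capacity) (simpleOfCapacity G T)}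

end StoppedCurve

/-- Simple curves of finite capacity. -/
def SimpleFinite (G : LoewnerCase) : Type :=
  ↥(⋃ T : ℝ≥0, StoppedCurve.simpleOfCapacity G T)

/-- The union over finite `T` of the closures of the sets of simple curves of capacity `T`. -/
def ClosureFinite (G : LoewnerCase) : Type :=
  ↥(⋃ T : ℝ≥0, StoppedCurve.closureOfCapacity G T)

/-- The underlying curve. -/
def SimpleFinite.curve {G : LoewnerCase} (γ : SimpleFinite G) : StoppedCurve G := γ.val

/-- The underlying curve. -/
def ClosureFinite.curve {G : LoewnerCase} (γ : ClosureFinite G) : StoppedCurve G := γ.val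

/-- The topology on simple finite-capacity curves induced by one of the three distances. -/
@[reducible] noncomputable def SimpleFinite.topology (G : LoewnerCase) (m : CurveMetric) :
    TopologicalSpace (SimpleFinite G) :=
  (StoppedCurve.topology G m).induced SimpleFinite.curve

/-- The topology on the closure of finite-capacity curves induced by one of the three distances. -/
@[reducible] noncomputable def ClosureFinite.topology (G : LoewnerCase) (m : CurveMetric) :
    TopologicalSpace (ClosureFinite G) :=
  (StoppedCurve.topology G m).induced ClosureFinite.curve

/-!
The proof is carried out in disk coordinates: a curve `γ` is replaced by `c = Φ ∘ γ`, and the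
inverse of a mapping-out function by `F = Φ ∘ g⁻¹ ∘ Φ⁻¹`, a conformal map of the unit disk onto the
complement of a simple arc in it. In the radial case `Φ` is the identity; in the chordal case the
target `∞` becomes the boundary point `-1`.

*Boundary extension.* By the length–area method (`exists_short_crosscut`), each boundary point of the
disk has a short crosscut with a short image. If the end points of a short image crosscut are joined
inside the boundary of the slit disk by a small connected set, then by Janiszewski's theorem
(`ConnectedOff.union`) the small side of the crosscut has a small image. The connecting sets are
subarcs, and they are small because the arc is simple. Hence `F` extends continuously to the closed
disk, with a modulus of continuity that is common to all arcs near a given simple arc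
(`exists_modulus_of_smallConnections`, `IsDiskArc.exists_uniform_modulus`).

*Convergence.* If simple arcs converge to a simple arc, equicontinuity and Hurwitz's theorem give
limits of the maps `F` that are again conformal maps onto the slit disk
(`IsDiskArc.exists_tendstoUniformlyOn`). The limit is normalized, and a normalized map is unique
(`IsMappingOut.comp_eq`). In the chordal case the normalization at `∞` survives the limit because of
the estimate `‖f z - z‖ ≤ R ^ 2 / Im z` for hulls of radius `R` (`IsDiskModel.norm_sub_le`). So `F`
depends continuously on the arc, uniformly on the closed disk (`StoppedCurve.IsSimple.tendstoUniformlyOn`).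
Only closeness of the arcs up to reparameterization is needed here, which covers all three metrics.

*The tip.* The tip has exactly one preimage under `F` (`IsUniformizer.eq_of_map_eq_tip`). Therefore
its image `W` exists as a limit (`IsTipModel.tendsto_tip`), and `W` depends continuously on the curve
(`IsTipModel.tendsto_image_tip`). Thus the centered inverses converge uniformly as well.

*Concatenation.* Composing mapping-out functions shows that capacities add up
(`IsTipModel.isHullOfCapacity_union`), so that the concatenation of simple curves is simple. In disk
coordinates the concatenation is
`Φ (γ t) + F̂ (Φ (η (t - T))) - Φ (γ T)` (`IsTipModel.diskCurve_concat`), where both curves are stopped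
at the ends of their lifetimes. All terms converge uniformly: for the capacity parameterization this
uses that the lifetimes converge, capacities being continuous in the uniformizer
(`IsDiskModel.tendsto_capacity`); up to reparameterization the two time changes are glued
(`exists_orderIso_of_monotone`). The Euclidean distance gives the same convergence as the distance in
disk coordinates, because the limiting trace is compact. Concatenations with a curve in the closure
are limits of concatenations of simple curves, hence belong to the closure.
-/


/-! ### Continuous logarithms and separation of the plane -/

/-- Continuous functions with the same exponential differ by a constant on a preconnected set. -/
theorem sub_eq_sub_of_exp_eq_exp {X : Type*} [TopologicalSpace X] {S : Set X}
    (hS : IsPreconnected S) {l₁ l₂ : X → ℂ} (h₁ : ContinuousOn l₁ S) (h₂ : ContinuousOn l₂ S)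
    (h : ∀ x ∈ S, Complex.exp (l₁ x) = Complex.exp (l₂ x)) {x y : X} (hx : x ∈ S) (hy : y ∈ S) :
    l₁ x - l₂ x = l₁ y - l₂ y := by
  refine Complex.isCoveringMap_exp.constOn_of_comp (g := fun x => l₁ x - l₂ x) hS (h₁.sub h₂)
    (fun a ha b hb => ?_) hx hy
  simp [Complex.exp_sub, h a ha, h b hb]

/-- Two nonvanishing functions on a compact space joined by a homotopy of nonvanishing functions
differ by a factor with a continuous logarithm. The homotopy parameter may range over any
preconnected space. -/
theorem exists_log_of_homotopy {P X : Type*} [TopologicalSpace P] [PreconnectedSpace P]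
    [TopologicalSpace X] [CompactSpace X] (H : P → X → ℂ)
    (hH : Continuous fun q : P × X => H q.1 q.2) (h0 : ∀ s x, H s x ≠ 0) (s s' : P) :
    ∃ l : C(X, ℂ), ∀ x, Complex.exp (l x) * H s' x = H s x := by
  refine (isPreconnected_univ (α := P)).induction₂
    (fun s s' => ∃ l : C(X, ℂ), ∀ x, Complex.exp (l x) * H s' x = H s x) ?_ ?_ ?_
    (mem_univ s) (mem_univ s')
  · intro a _
    rw [nhdsWithin_univ]
    have hev : ∀ᶠ b in 𝓝 a, ∀ x ∈ (univ : Set X), ‖H a x / H b x - 1‖ < 1 := by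
      refine isCompact_univ.eventually_forall_of_forall_eventually fun x _ => ?_
      have hc : ContinuousAt (fun q : P × X => ‖H a q.2 / H q.1 q.2 - 1‖) (a, x) := by
        have h1 : Continuous fun q : P × X => H a q.2 :=
          hH.comp (continuous_const.prodMk continuous_snd)
        exact ((h1.div hH fun q => h0 _ _).sub continuous_const).norm.continuousAt
      refine hc.eventually (gt_mem_nhds ?_)
      simp [div_self (h0 a x)]
    filter_upwards [hev] with b hb
    have hslit : ∀ x, H a x / H b x ∈ Complex.slitPlane := fun x => by
      refine Complex.ball_one_subset_slitPlane ?_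
      simpa [dist_eq_norm] using hb x (mem_univ x)
    have ha : Continuous fun x : X => H a x := hH.comp (continuous_const.prodMk continuous_id)
    have hb' : Continuous fun x : X => H b x := hH.comp (continuous_const.prodMk continuous_id)
    refine ⟨⟨fun x => Complex.log (H a x / H b x), ?_⟩, fun x => ?_⟩
    · exact continuous_iff_continuousAt.2 fun x =>
        ((ha.div hb' (h0 b)).continuousAt).clog (hslit x)
    · simp only [ContinuousMap.coe_mk]
      rw [Complex.exp_log (div_ne_zero (h0 _ _) (h0 _ _)), div_mul_cancel₀ _ (h0 _ _)]
  · rintro a b d _ _ _ ⟨l, hl⟩ ⟨k, hk⟩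
    exact ⟨l + k, fun x => by
      rw [ContinuousMap.add_apply, Complex.exp_add, mul_assoc, hk, hl]⟩
  · rintro a b _ _ ⟨l, hl⟩
    exact ⟨-l, fun x => by
      rw [ContinuousMap.neg_apply, ← hl x, ← mul_assoc, ← Complex.exp_add]; simp⟩

/-- The identity of the unit circle has no continuous logarithm. -/
theorem not_exists_log_circle : ¬ ∃ l : C(Circle, ℂ), ∀ u : Circle, Complex.exp (l u) = u := by
  rintro ⟨l, hl⟩
  have h := sub_eq_sub_of_exp_eq_exp (S := (univ : Set ℝ)) isPreconnected_univ
    (l₁ := fun θ => l (Circle.exp θ)) (l₂ := fun θ : ℝ => θ * Complex.I)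
    (by fun_prop) (by fun_prop) (fun θ _ => by simp [hl]) (mem_univ 0) (mem_univ (2 * Real.pi))
  have h2 : (2 : ℂ) * Real.pi * Complex.I = 0 := by
    have h3 : l 1 = l 1 - 2 * Real.pi * Complex.I := by simpa using h
    linear_combination h3
  exact Complex.two_pi_I_ne_zero h2

/-- `p` and `q` are not separated by `E`: some connected set off `E` contains both. -/
def ConnectedOff (E : Set ℂ) (p q : ℂ) : Prop :=
  ∃ S : Set ℂ, S ⊆ Eᶜ ∧ IsPreconnected S ∧ p ∈ S ∧ q ∈ S

/-- `(z - p) / (z - q)` has a continuous logarithm on `E`. The logarithm is defined on the whole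
plane, which is no restriction for closed `E`. -/
def HasLogOn (E : Set ℂ) (p q : ℂ) : Prop :=
  ∃ l : C(ℂ, ℂ), ∀ z ∈ E, Complex.exp (l z) * (z - q) = z - p

theorem HasLogOn.symm {E : Set ℂ} {p q : ℂ} (h : HasLogOn E p q) : HasLogOn E q p := by
  obtain ⟨l, hl⟩ := h
  exact ⟨-l, fun z hz => by
    rw [ContinuousMap.neg_apply, ← hl z hz, ← mul_assoc, ← Complex.exp_add]; simp⟩

theorem HasLogOn.of_subtype {E : Set ℂ} (hE : IsClosed E) {p q : ℂ}
    (h : ∃ l : C(E, ℂ), ∀ z : E, Complex.exp (l z) * (z - q) = z - p) : HasLogOn E p q := by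
  obtain ⟨l, hl⟩ := h
  obtain ⟨g, hg⟩ := l.exists_restrict_eq hE
  refine ⟨g, fun z hz => ?_⟩
  rw [← hl ⟨z, hz⟩, ← hg]
  rfl

theorem ConnectedOff.hasLogOn {E : Set ℂ} (hE : IsCompact E) {p q : ℂ} (h : ConnectedOff E p q) :
    HasLogOn E p q := by
  obtain ⟨S, hSE, hS, hp, hq⟩ := h
  have := isPreconnected_iff_preconnectedSpace.1 hS
  have := isCompact_iff_compactSpace.1 hE
  refine HasLogOn.of_subtype hE.isClosed ?_
  exact exists_log_of_homotopy (fun (s : S) (x : E) => (x : ℂ) - s) (by fun_prop)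
    (fun s x hx => hSE s.2 (by rw [← sub_eq_zero.1 hx]; exact x.2)) ⟨p, hp⟩ ⟨q, hq⟩

/-- A bounded component of the complement of `E` is recognized by the lack of a logarithm: the
circle would inherit one by extending `z - p` from outside the component. -/
theorem HasLogOn.not_isBounded {E : Set ℂ} (hE : IsCompact E) {p q : ℂ}
    (hp : p ∉ E) (hq : q ∉ E) (h : HasLogOn E p q)
    (hqp : q ∉ connectedComponentIn Eᶜ p) :
    ¬ Bornology.IsBounded (connectedComponentIn Eᶜ p) := by
  intro hbd
  obtain ⟨l, hl⟩ := h
  set V := connectedComponentIn Eᶜ p with hV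
  have hVo : IsOpen V := hE.isClosed.isOpen_compl.connectedComponentIn
  have hpV : p ∈ V := mem_connectedComponentIn hp
  have hfr : frontier V ⊆ E := by
    intro z hz
    by_contra hzE
    have hzc : z ∈ closure V := frontier_subset_closure hz
    have hopen : IsOpen (connectedComponentIn Eᶜ z) :=
      hE.isClosed.isOpen_compl.connectedComponentIn
    obtain ⟨w, hw1, hw2⟩ := mem_closure_iff.1 hzc _ hopen (mem_connectedComponentIn hzE)
    have e1 := connectedComponentIn_eq hw1
    have e2 := connectedComponentIn_eq hw2
    have : z ∈ V := by
      rw [hV, e2, ← e1]; exact mem_connectedComponentIn hzE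
    rw [hVo.frontier_eq] at hz
    exact hz.2 this
  classical
  let G : ℂ → ℂ := fun z => if z ∈ V then Complex.exp (l z) * (z - q) else z - p
  have hG : Continuous G := by
    refine Continuous.if (fun z hz => hl z (hfr hz)) (by fun_prop) (by fun_prop)
  have hG0 : ∀ z, G z ≠ 0 := by
    intro z
    by_cases hz : z ∈ V
    · simp only [G, hz, if_true]
      refine mul_ne_zero (Complex.exp_ne_zero _) (sub_ne_zero.2 ?_)
      rintro rfl; exact hqp hz
    · simp only [G, hz, if_false]
      refine sub_ne_zero.2 ?_
      rintro rfl; exact hz hpV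
  obtain ⟨R, hR⟩ := hbd.subset_ball p
  have hR0 : 0 < R := by
    have := hR hpV
    simpa using this
  obtain ⟨k, hk⟩ := exists_log_of_homotopy (fun (r : ℝ) (u : Circle) => G (p + r * u))
    (by fun_prop) (fun _ _ => hG0 _) R 0
  refine not_exists_log_circle ⟨⟨fun u => k u + Complex.log (G p / R), by fun_prop⟩, fun u => ?_⟩
  have hRC : (R : ℂ) ≠ 0 := by exact_mod_cast hR0.ne'
  have hu := hk u
  have hnot : p + R * u ∉ V := fun h => by
    have := hR h
    simp [abs_of_pos hR0, Circle.norm_coe] at this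
  simp only [Complex.ofReal_zero, zero_mul, add_zero] at hu
  have hu' : G (p + R * u) = R * u := by simp [G, hnot]
  rw [hu'] at hu
  simp only [ContinuousMap.coe_mk]
  rw [Complex.exp_add, Complex.exp_log (div_ne_zero (hG0 p) hRC), ← mul_div_assoc, hu]
  field_simp

theorem isPreconnected_compl_closedBall_complex (c : ℂ) {R : ℝ} (hR : 0 ≤ R) :
    IsPreconnected (Metric.closedBall c R)ᶜ := by
  have h : (Metric.closedBall c R)ᶜ =
      (fun q : ℝ × Circle => c + q.1 * (q.2 : ℂ)) '' (Ioi R ×ˢ univ) := by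
    ext z
    simp only [mem_compl_iff, Metric.mem_closedBall, not_le, mem_image, mem_prod, mem_Ioi, mem_univ,
      and_true, Prod.exists]
    constructor
    · intro hz
      have hz0 : z - c ≠ 0 := by
        rw [← norm_pos_iff, ← dist_eq_norm]; exact hR.trans_lt hz
      have hn : (‖z - c‖ : ℂ) ≠ 0 := by exact_mod_cast (norm_pos_iff.2 hz0).ne'
      refine ⟨‖z - c‖, ⟨(z - c) / ‖z - c‖, ?_⟩, by rwa [← dist_eq_norm], ?_⟩
      · simp [Submonoid.unitSphere, hz0]
      · simp only
        rw [mul_div_cancel₀ _ hn]; ring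
    · rintro ⟨r, u, hr, rfl⟩
      simpa [dist_eq_norm, abs_of_pos (hR.trans_lt hr), Circle.norm_coe] using hr
  rw [h]
  exact (isPreconnected_Ioi.prod isPreconnected_univ).image _ (by fun_prop)

theorem IsPreconnected.subset_ball_of_disjoint_sphere {S : Set ℂ} (hS : IsPreconnected S) {p : ℂ}
    {r : ℝ} (hdisj : ∀ z ∈ S, z ∉ Metric.sphere p r) {z : ℂ} (hz : z ∈ S)
    (hzr : z ∈ Metric.ball p r) : S ⊆ Metric.ball p r := by
  refine hS.subset_left_of_subset_union Metric.isOpen_ball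
    (v := (Metric.closedBall p r)ᶜ) Metric.isClosed_closedBall.isOpen_compl
    (disjoint_compl_right.mono_left Metric.ball_subset_closedBall) (fun u hu => ?_) ⟨z, hz, hzr⟩
  by_cases h2 : u ∈ Metric.closedBall p r
  · exact Or.inl (lt_of_le_of_ne h2 (hdisj u hu))
  · exact Or.inr h2

/-- **Eilenberg's criterion**: points off a compact set `E` are separated by `E` unless
`(z - p) / (z - q)` has a continuous logarithm on `E`. -/
theorem HasLogOn.connectedOff {E : Set ℂ} (hE : IsCompact E) {p q : ℂ}
    (hp : p ∉ E) (hq : q ∉ E) (h : HasLogOn E p q) : ConnectedOff E p q := by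
  by_contra hcon
  have hqp : q ∉ connectedComponentIn Eᶜ p := fun hmem =>
    hcon ⟨_, connectedComponentIn_subset _ _, isPreconnected_connectedComponentIn,
      mem_connectedComponentIn hp, hmem⟩
  have hpq : p ∉ connectedComponentIn Eᶜ q := fun hmem =>
    hcon ⟨_, connectedComponentIn_subset _ _, isPreconnected_connectedComponentIn, hmem,
      mem_connectedComponentIn hq⟩
  have h1 := h.not_isBounded hE hp hq hqp
  have h2 := h.symm.not_isBounded hE hq hp hpq
  obtain ⟨R, hR0, hR⟩ := hE.isBounded.subset_closedBall_lt 0 (0 : ℂ)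
  have hcompl : ∀ A : Set ℂ, ¬ Bornology.IsBounded A → ∃ z ∈ A, z ∈ (Metric.closedBall (0 : ℂ) R)ᶜ := by
    intro A hA
    by_contra! hcon
    exact hA (Metric.isBounded_closedBall.subset fun z hz => not_not.1 (hcon z hz))
  obtain ⟨z, hz, hzR⟩ := hcompl _ h1
  obtain ⟨w, hw, hwR⟩ := hcompl _ h2
  have hzw := (isPreconnected_compl_closedBall_complex 0 hR0.le).subset_connectedComponentIn hzR
    (compl_subset_compl.2 hR) hwR
  rw [← connectedComponentIn_eq hz] at hzw
  rw [connectedComponentIn_eq hzw, ← connectedComponentIn_eq hw] at hqp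
  exact hqp (mem_connectedComponentIn hq)

/-- **Janiszewski's theorem**: two compact sets with connected intersection, neither of which
separates `p` from `q`, do not separate `p` from `q` together. -/
theorem ConnectedOff.union {E₁ E₂ : Set ℂ} (h₁ : IsCompact E₁) (h₂ : IsCompact E₂)
    (hE : IsPreconnected (E₁ ∩ E₂)) {p q : ℂ}
    (hc₁ : ConnectedOff E₁ p q) (hc₂ : ConnectedOff E₂ p q) : ConnectedOff (E₁ ∪ E₂) p q := by
  have mem : ∀ {E}, ConnectedOff E p q → p ∉ E ∧ q ∉ E := fun ⟨S, hS, _, hp, hq⟩ =>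
    ⟨hS hp, hS hq⟩
  obtain ⟨hp₁, hq₁⟩ := mem hc₁
  obtain ⟨hp₂, hq₂⟩ := mem hc₂
  obtain ⟨l, hl⟩ := hc₁.hasLogOn h₁
  obtain ⟨k, hk⟩ := hc₂.hasLogOn h₂
  refine HasLogOn.connectedOff (h₁.union h₂) (by simp [hp₁, hp₂]) (by simp [hq₁, hq₂]) ?_
  -- the two logarithms differ by a constant on the intersection
  obtain ⟨c, hcexp, hc⟩ : ∃ c : ℂ, Complex.exp c = 1 ∧ ∀ z ∈ E₁ ∩ E₂, l z = k z + c := by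
    rcases (E₁ ∩ E₂).eq_empty_or_nonempty with he | ⟨z₀, hz₀⟩
    · exact ⟨0, by simp, by simp [he]⟩
    · have hexp : ∀ z ∈ E₁ ∩ E₂, Complex.exp (l z) = Complex.exp (k z) := fun z hz => by
        have hzq : z - q ≠ 0 := sub_ne_zero.2 (by rintro rfl; exact hq₁ hz.1)
        exact mul_right_cancel₀ hzq ((hl z hz.1).trans (hk z hz.2).symm)
      refine ⟨l z₀ - k z₀, by simp [Complex.exp_sub, hexp z₀ hz₀], fun z hz => ?_⟩
      have := sub_eq_sub_of_exp_eq_exp hE l.continuous.continuousOn k.continuous.continuousOn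
        hexp hz hz₀
      rw [← this]; ring
  classical
  let m : ℂ → ℂ := fun z => if z ∈ E₁ then l z else k z + c
  have hm₁ : EqOn m l E₁ := fun z hz => by simp [m, hz]
  have hm₂ : EqOn m (fun z => k z + c) E₂ := fun z hz => by
    by_cases hz1 : z ∈ E₁
    · simp [m, hz1, hc z ⟨hz1, hz⟩]
    · simp [m, hz1]
  have hmc : ContinuousOn m (E₁ ∪ E₂) :=
    (l.continuous.continuousOn.congr hm₁).union_of_isClosed
      ((k.continuous.add continuous_const).continuousOn.congr hm₂) h₁.isClosed h₂.isClosed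
  refine HasLogOn.of_subtype (h₁.union h₂).isClosed
    ⟨⟨_, continuousOn_iff_continuous_domRestrict.1 hmc⟩, ?_⟩
  rintro ⟨z, hz | hz⟩
  · simpa [hm₁ hz] using hl z hz
  · simpa [hm₂ hz, Complex.exp_add, hcexp] using hk z hz

/-- On an injective arc every nonvanishing function `z - p` has a continuous logarithm. -/
theorem exists_log_arc {a b : ℝ} {c : ℝ → ℂ} (hab : a ≤ b) (hc : ContinuousOn c (Icc a b))
    (hinj : InjOn c (Icc a b)) {p : ℂ} (hp : p ∉ c '' Icc a b) :
    ∃ l : C(ℂ, ℂ), ∀ z ∈ c '' Icc a b, Complex.exp (l z) = z - p := by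
  set E := c '' Icc a b
  have hE : IsCompact E := isCompact_Icc.image_of_continuousOn hc
  -- contract the arc to its starting point along itself
  let c' : Icc a b → E := fun t => ⟨c t, mem_image_of_mem _ t.2⟩
  have hc' : Continuous c' := (continuousOn_iff_continuous_domRestrict.1 hc).subtype_mk _
  have hbij : Function.Bijective c' := by
    refine ⟨fun s t h => Subtype.ext (hinj s.2 t.2 (congrArg Subtype.val h)), ?_⟩
    rintro ⟨_, t, ht, rfl⟩
    exact ⟨⟨t, ht⟩, rfl⟩
  let e : Icc a b ≃ₜ E := Continuous.homeoOfEquivCompactToT2 (f := Equiv.ofBijective c' hbij) hc'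
  have hmem : ∀ (s : Icc (0 : ℝ) 1) (t : Icc a b), a + s * (t - a) ∈ Icc a b := by
    rintro ⟨s, hs0, hs1⟩ ⟨t, ht0, ht1⟩
    constructor <;> simp only <;> nlinarith
  have hcont : Continuous fun q : Icc (0 : ℝ) 1 × E =>
      (c' ⟨a + q.1 * ((e.symm q.2 : ℝ) - a), hmem _ _⟩ : ℂ) := by
    refine continuous_subtype_val.comp (hc'.comp (Continuous.subtype_mk ?_ _))
    have : Continuous fun q : Icc (0 : ℝ) 1 × E => ((e.symm q.2 : Icc a b) : ℝ) :=
      continuous_subtype_val.comp (e.symm.continuous.comp continuous_snd)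
    fun_prop
  have hne : ∀ z : E, (z : ℂ) - p ≠ 0 := fun z h => hp (by rw [← sub_eq_zero.1 h]; exact z.2)
  have : CompactSpace E := isCompact_iff_compactSpace.1 hE
  obtain ⟨k, hk⟩ := exists_log_of_homotopy (fun (s : Icc (0 : ℝ) 1) (z : E) =>
    (c' ⟨a + s * ((e.symm z : ℝ) - a), hmem _ _⟩ : ℂ) - p) (hcont.sub continuous_const)
    (fun _ _ => hne _) ⟨1, by simp⟩ ⟨0, by simp⟩
  have hca : c a - p ≠ 0 := hne ⟨c a, mem_image_of_mem _ ⟨le_rfl, hab⟩⟩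
  obtain ⟨g, hg⟩ := ContinuousMap.exists_restrict_eq hE.isClosed
    (k + ContinuousMap.const _ (Complex.log (c a - p)))
  refine ⟨g, fun z hz => ?_⟩
  have h1 : g z = k ⟨z, hz⟩ + Complex.log (c a - p) := by
    have := congrArg (fun f : C(E, ℂ) => f ⟨z, hz⟩) hg
    simpa using this
  have h2 := hk ⟨z, hz⟩
  have h3 : c (e.symm ⟨z, hz⟩) = z := congrArg Subtype.val (e.apply_symm_apply ⟨z, hz⟩)
  rw [h1, Complex.exp_add, Complex.exp_log hca]
  simpa [c', h3] using h2

/-- An arc does not separate the plane. -/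
theorem connectedOff_arc {a b : ℝ} {c : ℝ → ℂ} (hab : a ≤ b) (hc : ContinuousOn c (Icc a b))
    (hinj : InjOn c (Icc a b)) {p q : ℂ} (hp : p ∉ c '' Icc a b) (hq : q ∉ c '' Icc a b) :
    ConnectedOff (c '' Icc a b) p q := by
  refine HasLogOn.connectedOff (isCompact_Icc.image_of_continuousOn hc) hp hq ?_
  obtain ⟨l, hl⟩ := exists_log_arc hab hc hinj hp
  obtain ⟨k, hk⟩ := exists_log_arc hab hc hinj hq
  exact ⟨l - k, fun z hz => by
    rw [ContinuousMap.sub_apply, Complex.exp_sub, hl z hz, ← hk z hz,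
      div_mul_cancel₀ _ (Complex.exp_ne_zero _)]⟩

/-- No arc off `p` contains a circle around `p`. -/
theorem not_sphere_subset_arc {a b : ℝ} {c : ℝ → ℂ} (hab : a ≤ b) (hc : ContinuousOn c (Icc a b))
    (hinj : InjOn c (Icc a b)) {p : ℂ} (hp : p ∉ c '' Icc a b) {r : ℝ} (hr : 0 < r) :
    ¬ Metric.sphere p r ⊆ c '' Icc a b := by
  intro hsub
  obtain ⟨l, hl⟩ := exists_log_arc hab hc hinj hp
  have hrC : (r : ℂ) ≠ 0 := by exact_mod_cast hr.ne'
  refine not_exists_log_circle ⟨⟨fun u => l (p + r * u) - Complex.log r, by fun_prop⟩, fun u => ?_⟩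
  have hu := hl (p + r * u) (hsub (by simp [abs_of_pos hr, Circle.norm_coe]))
  simp only [ContinuousMap.coe_mk]
  rw [Complex.exp_sub, hu, Complex.exp_log hrC]
  field_simp
  ring

/-! ### Injective holomorphic functions, the maximum principle and limits -/

theorem nhds_le_map_nhds_of_injOn {U : Set ℂ} (hU : IsOpen U) {f : ℂ → ℂ}
    (hf : DifferentiableOn ℂ f U) (hinj : InjOn f U) {z : ℂ} (hz : z ∈ U) :
    𝓝 (f z) ≤ map f (𝓝 z) := by
  have han : AnalyticAt ℂ f z := hf.analyticAt (hU.mem_nhds hz)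
  rcases han.eventually_constant_or_nhds_le_map_nhds with h | h
  · exfalso
    have h2 : ∀ᶠ w in 𝓝 z, w = z := by
      filter_upwards [h, hU.mem_nhds hz] with w hw hwU using hinj hwU hz hw
    exact (NormedField.nhdsNE_neBot z).ne (by
      have : {z} ∈ 𝓝 z := h2
      rw [nhdsWithin, inf_principal_eq_bot]; simpa using this)
  · exact h

theorem isOpen_image_of_injOn {U : Set ℂ} (hU : IsOpen U) {f : ℂ → ℂ}
    (hf : DifferentiableOn ℂ f U) (hinj : InjOn f U) : IsOpen (f '' U) := by
  rw [isOpen_iff_mem_nhds]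
  rintro _ ⟨z, hz, rfl⟩
  exact nhds_le_map_nhds_of_injOn hU hf hinj hz (image_mem_map (hU.mem_nhds hz))

theorem continuousAt_leftInverse_of_injOn {U : Set ℂ} (hU : IsOpen U) {f g : ℂ → ℂ}
    (hf : DifferentiableOn ℂ f U) (hinj : InjOn f U) (hg : ∀ z ∈ U, g (f z) = z) {z : ℂ}
    (hz : z ∈ U) : ContinuousAt g (f z) := by
  rw [ContinuousAt, hg z hz]
  refine (tendsto_map' (f := g) (x := 𝓝 z) ?_).mono_left (nhds_le_map_nhds_of_injOn hU hf hinj hz)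
  refine tendsto_id.congr' ?_
  filter_upwards [hU.mem_nhds hz] with w hw using (hg w hw).symm

/-- The inverse of an injective holomorphic function is holomorphic: it is continuous, and
differentiable off the image of the isolated critical points, which are removable. -/
theorem differentiableOn_leftInverse_of_injOn {U : Set ℂ} (hU : IsOpen U) {f g : ℂ → ℂ}
    (hf : DifferentiableOn ℂ f U) (hinj : InjOn f U) (hg : ∀ z ∈ U, g (f z) = z) :
    DifferentiableOn ℂ g (f '' U) := by
  rintro _ ⟨z, hz, rfl⟩
  refine AnalyticAt.differentiableAt ?_ |>.differentiableWithinAt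
  have hcont := continuousAt_leftInverse_of_injOn hU hf hinj hg hz
  refine Complex.analyticAt_of_differentiable_on_punctured_nhds_of_continuousAt ?_ hcont
  have han : AnalyticAt ℂ f z := hf.analyticAt (hU.mem_nhds hz)
  have himg : f '' U ∈ 𝓝 (f z) := (isOpen_image_of_injOn hU hf hinj).mem_nhds ⟨z, hz, rfl⟩
  rcases han.deriv.eventually_eq_zero_or_eventually_ne_zero with h | h
  · -- a vanishing derivative would make `f` locally constant
    exfalso
    obtain ⟨r, hr, hball⟩ := Metric.eventually_nhds_iff_ball.1 (h.and (hU.mem_nhds hz))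
    have hconst : ∀ w ∈ Metric.ball z r, f w = f z := fun w hw =>
      (convex_ball z r).is_const_of_fderivWithin_eq_zero (𝕜 := ℂ)
        (hf.mono fun x hx => (hball x hx).2)
        (fun x hx => by
          rw [fderivWithin_of_isOpen Metric.isOpen_ball hx]
          ext
          simpa using (hball x hx).1) hw (Metric.mem_ball_self hr)
    have hw : z + (r / 2 : ℝ) ∈ Metric.ball z r := by
      simp [abs_of_pos hr, hr]
    have h1 := hinj (hball _ hw).2 hz (hconst _ hw)
    have h2 : ((r / 2 : ℝ) : ℂ) = 0 := by linear_combination h1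
    have h3 : r / 2 = 0 := by exact_mod_cast h2
    linarith
  · have hgne : Tendsto g (𝓝[≠] f z) (𝓝[≠] z) := by
      refine tendsto_nhdsWithin_iff.2 ⟨?_, ?_⟩
      · have := hcont.tendsto
        rw [hg z hz] at this
        exact this.mono_left nhdsWithin_le_nhds
      · filter_upwards [self_mem_nhdsWithin, mem_nhdsWithin_of_mem_nhds himg]
        rintro _ hne ⟨w, hw, rfl⟩
        rw [hg w hw]
        rintro rfl
        exact hne rfl
    filter_upwards [hgne.eventually h, mem_nhdsWithin_of_mem_nhds himg]
    rintro _ hd ⟨w, hw, rfl⟩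
    have hcw := continuousAt_leftInverse_of_injOn hU hf hinj hg hw
    rw [hg w hw] at hd
    refine (HasDerivAt.of_local_left_inverse (f := f) (f' := deriv f w) hcw ?_ hd
      ?_).differentiableAt
    · rw [hg w hw]
      exact (hf.differentiableAt (hU.mem_nhds hw)).hasDerivAt
    · filter_upwards [(isOpen_image_of_injOn hU hf hinj).mem_nhds ⟨w, hw, rfl⟩]
      rintro _ ⟨x, hx, rfl⟩
      rw [hg x hx]

/-- Maximum principle for the imaginary part of a holomorphic function, the boundary condition
(including the one at infinity) being expressed by compact sets. -/
theorem im_nonpos_of_forall_compact {U : Set ℂ} (hU : IsOpen U) (hpre : IsPreconnected U)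
    (hnc : ¬ IsCompact U) {q : ℂ → ℂ} (hq : DifferentiableOn ℂ q U)
    (h : ∀ ε > 0, ∃ S ⊆ U, IsCompact S ∧ ∀ z ∈ U, z ∉ S → (q z).im < ε) {z : ℂ} (hz : z ∈ U) :
    (q z).im ≤ 0 := by
  by_contra! hpos
  obtain ⟨S, hSU, hS, hlt⟩ := h _ (half_pos hpos)
  have hzS : z ∈ S := by
    by_contra hzS
    have := hlt z hz hzS
    linarith
  have hqc : ContinuousOn (fun z => (q z).im) S :=
    Complex.continuous_im.comp_continuousOn (hq.continuousOn.mono hSU)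
  obtain ⟨m, hm, hmax⟩ := hS.exists_isMaxOn ⟨z, hzS⟩ hqc
  have hzm : (q z).im ≤ (q m).im := hmax hzS
  have hmaxU : ∀ w ∈ U, (q w).im ≤ (q m).im := fun w hw => by
    by_cases hwS : w ∈ S
    · exact hmax hwS
    · have := hlt w hw hwS
      linarith
  have hE : DifferentiableOn ℂ (fun w => Complex.exp (-Complex.I * q w)) U :=
    ((differentiableOn_const _).mul hq).cexp
  have hnorm : ∀ w, ‖Complex.exp (-Complex.I * q w)‖ = Real.exp (q w).im := fun w => by
    rw [Complex.norm_exp]; simp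
  have hconst := Complex.norm_eqOn_of_isPreconnected_of_isMaxOn hpre hU hE (hSU hm)
    (fun w hw => by
      simp only [mem_ofPred_eq, Function.comp, hnorm]
      exact Real.exp_le_exp.2 (hmaxU w hw))
  refine hnc ?_
  have : U = S := by
    refine Subset.antisymm (fun w hw => ?_) hSU
    by_contra hwS
    have h1 := hlt w hw hwS
    have h2 := hconst hw
    simp only [Function.comp, hnorm, Function.const, Real.exp_eq_exp] at h2
    linarith
  rwa [this]

/-- Half of Hurwitz's theorem: a uniform limit of functions omitting values `c i → c` omits `c`
or is constant. -/
theorem ne_or_eq_of_tendstoUniformlyOn {ι : Type*} {l : Filter ι} [l.NeBot] {U : Set ℂ}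
    (hU : IsOpen U) (hpre : IsPreconnected U) {F : ι → ℂ → ℂ} {f : ℂ → ℂ} {c : ι → ℂ} {c₀ : ℂ}
    (hF : TendstoUniformlyOn F f l U) (hd : ∀ᶠ i in l, DifferentiableOn ℂ (F i) U)
    (hfd : DifferentiableOn ℂ f U) (hc : Tendsto c l (𝓝 c₀))
    (hne : ∀ᶠ i in l, ∀ z ∈ U, F i z ≠ c i) :
    (∀ z ∈ U, f z ≠ c₀) ∨ ∀ z ∈ U, f z = c₀ := by
  by_contra! hcon
  obtain ⟨⟨z, hz, hfz⟩, ⟨w, hw, hfw⟩⟩ := hcon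
  have han : AnalyticOnNhd ℂ (fun x => f x - c₀) U := (hfd.sub_const c₀).analyticOnNhd hU
  have hev : ∀ᶠ x in 𝓝[≠] z, f x - c₀ ≠ 0 := by
    rcases (han z hz).eventually_eq_zero_or_eventually_ne_zero with h | h
    · exact absurd (sub_eq_zero.1 (han.eqOn_zero_of_preconnected_of_eventuallyEq_zero hpre hz h hw))
        hfw
    · exact h
  rw [eventually_nhdsWithin_iff] at hev
  obtain ⟨r, hr, hball⟩ := Metric.eventually_nhds_iff_ball.1 (hev.and (hU.mem_nhds hz))
  -- on a small circle around the zero, `f - c₀` is bounded below by `3 m`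
  have hsub : Metric.closedBall z (r / 2) ⊆ U := fun x hx =>
    (hball x (Metric.closedBall_subset_ball (half_lt_self hr) hx)).2
  have hsph : Metric.sphere z (r / 2) ⊆ Metric.closedBall z (r / 2) := Metric.sphere_subset_closedBall
  have hfs : ContinuousOn (fun x => ‖f x - c₀‖) (Metric.sphere z (r / 2)) :=
    ((hfd.continuousOn.mono (hsph.trans hsub)).sub continuousOn_const).norm
  obtain ⟨m, hm, hmle⟩ : ∃ m > 0, ∀ x ∈ Metric.sphere z (r / 2), 3 * m ≤ ‖f x - c₀‖ := by
    obtain ⟨x, hx, hmin⟩ := (isCompact_sphere z (r / 2)).exists_isMinOn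
      (NormedSpace.sphere_nonempty.2 (half_pos hr).le) hfs
    have hx0 : f x - c₀ ≠ 0 := by
      refine (hball x (Metric.closedBall_subset_ball (half_lt_self hr) (hsph hx))).1 ?_
      rintro rfl
      simp at hx
      linarith
    refine ⟨‖f x - c₀‖ / 3, by positivity, fun y hy => ?_⟩
    have : ‖f x - c₀‖ ≤ ‖f y - c₀‖ := hmin hy
    linarith
  have h1 := Metric.tendstoUniformlyOn_iff.1 hF (m / 2) (half_pos hm)
  have h2 := Metric.tendsto_nhds.1 hc (m / 2) (half_pos hm)
  obtain ⟨i, hi1, hi2, hi3, hi4⟩ := (h1.and (h2.and (hd.and hne))).exists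
  have hclose : ∀ x ∈ U, ‖(F i x - c i) - (f x - c₀)‖ < m := fun x hx => by
    have a1 := hi1 x hx
    rw [dist_comm, dist_eq_norm] at a1
    rw [dist_eq_norm] at hi2
    calc ‖(F i x - c i) - (f x - c₀)‖ = ‖(F i x - f x) - (c i - c₀)‖ := by ring_nf
      _ ≤ ‖F i x - f x‖ + ‖c i - c₀‖ := norm_sub_le _ _
      _ < m := by linarith
  -- the maximum principle for the reciprocal contradicts smallness at the centre
  have hinv : DiffContOnCl ℂ (fun x => (F i x - c i)⁻¹) (Metric.ball z (r / 2)) := by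
    refine DifferentiableOn.diffContOnCl ?_
    rw [closure_ball _ (half_pos hr).ne']
    exact ((hi3.mono hsub).sub_const _).inv fun x hx => sub_ne_zero.2 (hi4 x (hsub hx))
  have hbound := Complex.norm_le_of_forall_mem_frontier_norm_le Metric.isBounded_ball hinv
    (C := (2 * m)⁻¹) (fun x hx => by
      rw [frontier_ball _ (half_pos hr).ne'] at hx
      rw [norm_inv]
      refine inv_anti₀ (by positivity) ?_
      have := hclose x (hsub (hsph hx))
      have := hmle x hx
      have := norm_sub_norm_le (f x - c₀) (F i x - c i)
      rw [norm_sub_rev (f x - c₀)] at this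
      linarith) (subset_closure (Metric.mem_ball_self (half_pos hr)))
  rw [norm_inv] at hbound
  have hz0 : ‖F i z - c i‖ < m := by simpa [hfz] using hclose z hz
  have hzpos : 0 < ‖F i z - c i‖ := norm_pos_iff.2 (sub_ne_zero.2 (hi4 z hz))
  have := (inv_le_inv₀ hzpos (by positivity)).1 hbound
  linarith

/-- A nonconstant uniform limit of injective holomorphic functions is injective. -/
theorem injOn_of_tendstoUniformlyOn {ι : Type*} {l : Filter ι} [l.NeBot] {U : Set ℂ}
    (hU : IsOpen U) (hpre : IsPreconnected U) {F : ι → ℂ → ℂ} {f : ℂ → ℂ}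
    (hF : TendstoUniformlyOn F f l U) (hd : ∀ᶠ i in l, DifferentiableOn ℂ (F i) U)
    (hfd : DifferentiableOn ℂ f U) (hinj : ∀ᶠ i in l, InjOn (F i) U)
    (hnc : ¬ ∃ c, ∀ z ∈ U, f z = c) : InjOn f U := by
  intro a ha b hb hab
  by_contra hne
  obtain ⟨r, hr, hball⟩ := Metric.isOpen_iff.1 (hU.inter isOpen_compl_singleton) b
    ⟨hb, fun h => hne h.symm⟩
  have hsub : Metric.ball b r ⊆ U := fun x hx => (hball hx).1
  have hFa : Tendsto (fun i => F i a) l (𝓝 (f a)) := hF.tendsto_at ha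
  rcases ne_or_eq_of_tendstoUniformlyOn Metric.isOpen_ball (convex_ball b r).isPreconnected
    (hF.mono hsub) (hd.mono fun i hi => hi.mono hsub) (hfd.mono hsub) hFa
    (hinj.mono fun i hi z hz h => (hball hz).2 (hi (hsub hz) ha h)) with h | h
  · exact h b (Metric.mem_ball_self hr) hab.symm
  · refine hnc ⟨f a, fun z hz => ?_⟩
    have han : AnalyticOnNhd ℂ f U := hfd.analyticOnNhd hU
    exact han.eqOn_of_preconnected_of_eventuallyEq analyticOnNhd_const hpre hb
      (by filter_upwards [Metric.ball_mem_nhds b hr] with x hx using h x hx) hz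

/-- The **Schwarz–Pick lemma** for holomorphic maps of the upper half-plane into its closure. -/
theorem schwarz_pick_upperHalfPlane {q : ℂ → ℂ} (hq : DifferentiableOn ℂ q {z | 0 < z.im})
    (hmap : ∀ z, 0 < z.im → 0 ≤ (q z).im) {z w : ℂ} (hz : 0 < z.im) (hw : 0 < w.im) :
    ‖q z - q w‖ ^ 2 * (z.im * w.im) ≤ (q z).im * (q w).im * ‖z - w‖ ^ 2 := by
  have hnsq : ∀ x y : ℂ, ‖x - (starRingEnd ℂ) y‖ ^ 2 = ‖x - y‖ ^ 2 + 4 * x.im * y.im := fun x y => by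
    rw [Complex.sq_norm, Complex.sq_norm, Complex.normSq_apply, Complex.normSq_apply]
    simp; ring
  have hden : ∀ x y : ℂ, 0 < x.im → 0 < y.im → x - (starRingEnd ℂ) y ≠ 0 := fun x y hx hy h => by
    have := hnsq x y
    rw [h] at this
    have h3 : 0 < x.im * y.im := mul_pos hx hy
    simp only [norm_zero] at this
    nlinarith [sq_nonneg ‖x - y‖]
  -- the version for maps into the open half-plane
  have strict : ∀ p : ℂ → ℂ, DifferentiableOn ℂ p {z | 0 < z.im} → (∀ z, 0 < z.im → 0 < (p z).im) →
      ‖p z - p w‖ ^ 2 * (z.im * w.im) ≤ (p z).im * (p w).im * ‖z - w‖ ^ 2 := by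
    intro p hp hpm
    let inv : ℂ → ℂ := fun u => (w - (starRingEnd ℂ) w * u) / (1 - u)
    have hu1 : ∀ u ∈ Metric.ball (0 : ℂ) 1, 1 - u ≠ 0 := fun u hu h => by
      rw [← sub_eq_zero.1 h] at hu; simp at hu
    have hinv : ∀ u ∈ Metric.ball (0 : ℂ) 1, 0 < (inv u).im := by
      intro u hu
      have hns : Complex.normSq u < 1 := by
        rw [← Complex.sq_norm]
        have : ‖u‖ < 1 := by simpa using hu
        nlinarith [norm_nonneg u]
      have h0 : 0 < Complex.normSq (1 - u) := Complex.normSq_pos.2 (hu1 u hu)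
      have : (inv u).im = w.im * (1 - Complex.normSq u) / Complex.normSq (1 - u) := by
        simp only [inv, Complex.div_im, Complex.normSq_apply]
        simp
        field_simp
        ring
      rw [this]
      have : 0 < 1 - Complex.normSq u := by linarith
      positivity
    let g : ℂ → ℂ := fun u => (p (inv u) - p w) / (p (inv u) - (starRingEnd ℂ) (p w))
    have hinvd : DifferentiableOn ℂ inv (Metric.ball 0 1) :=
      DifferentiableOn.div (by fun_prop) (by fun_prop) hu1
    have hpi : DifferentiableOn ℂ (fun u => p (inv u)) (Metric.ball 0 1) :=
      hp.comp hinvd fun u hu => hinv u hu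
    have hgd : DifferentiableOn ℂ g (Metric.ball 0 1) :=
      (hpi.sub_const _).div (hpi.sub_const _) fun u hu => hden _ _ (hpm _ (hinv u hu)) (hpm w hw)
    have hcay : ∀ x y : ℂ, 0 < x.im → 0 < y.im → ‖(x - y) / (x - (starRingEnd ℂ) y)‖ < 1 := by
      intro x y hx hy
      have hpos := norm_pos_iff.2 (hden x y hx hy)
      rw [norm_div, div_lt_one hpos]
      have h3 : 0 < x.im * y.im := mul_pos hx hy
      nlinarith [hnsq x y, norm_nonneg (x - y)]
    have hg0 : g 0 = 0 := by simp [g, inv]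
    have hgm : MapsTo g (Metric.ball 0 1) (Metric.closedBall 0 1) := fun u hu =>
      mem_closedBall_zero_iff.2 (hcay _ _ (hpm _ (hinv u hu)) (hpm w hw)).le
    have hzu : ‖(z - w) / (z - (starRingEnd ℂ) w)‖ < 1 := hcay z w hz hw
    have hle := Complex.norm_le_norm_of_mapsTo_ball hgd hgm hg0 hzu
    have hzw := hden z w hz hw
    have hback : inv ((z - w) / (z - (starRingEnd ℂ) w)) = z := by
      have h1 : w - (starRingEnd ℂ) w ≠ 0 := hden w w hw hw
      have h2 : 1 - (z - w) / (z - (starRingEnd ℂ) w) =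
          (w - (starRingEnd ℂ) w) / (z - (starRingEnd ℂ) w) := by field_simp; ring
      simp only [inv]
      rw [h2]
      field_simp
      ring
    simp only [g, hback] at hle
    have hA := norm_pos_iff.2 (hden (p z) (p w) (hpm z hz) (hpm w hw))
    have hB := norm_pos_iff.2 hzw
    rw [norm_div, norm_div, div_le_div_iff₀ hA hB] at hle
    have hsq := pow_le_pow_left₀ (by positivity) hle 2
    rw [mul_pow, mul_pow, hnsq, hnsq] at hsq
    nlinarith
  -- perturb by `ε i` to land in the open half-plane
  have key : ∀ ε : ℝ, 0 < ε →
      ‖q z - q w‖ ^ 2 * (z.im * w.im) ≤ ((q z).im + ε) * ((q w).im + ε) * ‖z - w‖ ^ 2 := by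
    intro ε hε
    have := strict (fun z => q z + ε * Complex.I) (hq.add_const _) (fun x hx => by
      simpa using add_pos_of_nonneg_of_pos (hmap x hx) hε)
    simpa using this
  have hlim : Tendsto (fun ε : ℝ => ((q z).im + ε) * ((q w).im + ε) * ‖z - w‖ ^ 2) (𝓝[>] 0)
      (𝓝 (((q z).im + 0) * ((q w).im + 0) * ‖z - w‖ ^ 2)) := by
    refine Tendsto.mono_left (Continuous.tendsto ?_ 0) nhdsWithin_le_nhds
    fun_prop
  rw [add_zero, add_zero] at hlim
  exact ge_of_tendsto hlim (by filter_upwards [self_mem_nhdsWithin] with ε hε using key ε hε)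

/-! ### The length–area estimate -/

/-- The map `w ↦ ζ (1 - exp w)` takes vertical segments to circular arcs around the boundary point
`ζ`; this is the set of those `w` in the strip `|Im w| < π / 2` that it takes to the unit disk. -/
def crosscutStrip : Set ℂ := {w | |w.im| < Real.pi / 2 ∧ Real.exp w.re < 2 * Real.cos w.im}

theorem norm_mul_one_sub_exp_lt_one_iff {ζ w : ℂ} (hζ : ‖ζ‖ = 1) :
    ‖ζ * (1 - Complex.exp w)‖ < 1 ↔ Real.exp w.re < 2 * Real.cos w.im := by
  have hsq : ‖ζ * (1 - Complex.exp w)‖ ^ 2 =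
      1 - Real.exp w.re * (2 * Real.cos w.im - Real.exp w.re) := by
    rw [norm_mul, hζ, one_mul, Complex.sq_norm, Complex.normSq_apply]
    simp only [Complex.sub_re, Complex.one_re, Complex.exp_re, Complex.sub_im, Complex.one_im,
      Complex.exp_im]
    linear_combination (Real.exp w.re) ^ 2 * Real.sin_sq_add_cos_sq w.im
  have hpos := Real.exp_pos w.re
  constructor
  · intro h
    have h1 : ‖ζ * (1 - Complex.exp w)‖ ^ 2 < 1 := by nlinarith [norm_nonneg (ζ * (1 - Complex.exp w))]
    rw [hsq] at h1
    by_contra! hcon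
    nlinarith
  · intro h
    have h1 : ‖ζ * (1 - Complex.exp w)‖ ^ 2 < 1 := by
      rw [hsq]; nlinarith [mul_pos hpos (sub_pos.2 h)]
    by_contra! hcon
    nlinarith

theorem isOpen_crosscutStrip : IsOpen crosscutStrip := by
  have h1 : IsOpen {w : ℂ | |w.im| < Real.pi / 2} :=
    isOpen_lt Complex.continuous_im.abs continuous_const
  have h2 : IsOpen {w : ℂ | Real.exp w.re < 2 * Real.cos w.im} :=
    isOpen_lt (by fun_prop) (by fun_prop)
  exact h1.inter h2

theorem injOn_mul_one_sub_exp {ζ : ℂ} (hζ : ‖ζ‖ = 1) :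
    InjOn (fun w => ζ * (1 - Complex.exp w)) crosscutStrip := by
  intro w hw w' hw' h
  have hζ0 : ζ ≠ 0 := by rintro rfl; simp at hζ
  have h1 : Complex.exp w = Complex.exp w' := by
    have := mul_left_cancel₀ hζ0 h
    linear_combination -this
  have a1 := abs_lt.1 hw.1
  have a2 := abs_lt.1 hw'.1
  refine Complex.exp_inj_of_neg_pi_lt_of_le_pi ?_ ?_ ?_ ?_ h1 <;> linarith [Real.pi_pos]

theorem crosscutStrip_convex_im {x y₁ y₂ y : ℝ} (h₁ : (⟨x, y₁⟩ : ℂ) ∈ crosscutStrip)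
    (h₂ : (⟨x, y₂⟩ : ℂ) ∈ crosscutStrip) (hy : y ∈ Icc y₁ y₂) : (⟨x, y⟩ : ℂ) ∈ crosscutStrip := by
  obtain ⟨a1, b1⟩ := h₁
  obtain ⟨a2, b2⟩ := h₂
  simp only at a1 b1 a2 b2
  have habs : |y| ≤ |y₁| ∨ |y| ≤ |y₂| := by
    rcases le_total 0 y with h | h
    · right; rw [abs_of_nonneg h]; exact hy.2.trans (le_abs_self _)
    · left; rw [abs_of_nonpos h]; exact (neg_le_neg hy.1).trans (neg_le_abs _)
  have key : ∀ y', |y'| < Real.pi / 2 → Real.exp x < 2 * Real.cos y' → |y| ≤ |y'| →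
      (⟨x, y⟩ : ℂ) ∈ crosscutStrip := by
    intro y' ha hb hle
    refine ⟨hle.trans_lt ha, hb.trans_le ?_⟩
    have := Real.cos_le_cos_of_nonneg_of_le_pi (abs_nonneg y) (by linarith [Real.pi_pos]) hle
    rw [Real.cos_abs, Real.cos_abs] at this
    simp only
    linarith
  rcases habs with h | h
  · exact key y₁ a1 b1 h
  · exact key y₂ a2 b2 h

/-- The area of the image of an injective holomorphic function. -/
theorem lintegral_norm_deriv_sq_eq_volume_image {V : Set ℂ} (hV : IsOpen V) {F : ℂ → ℂ}
    (hF : DifferentiableOn ℂ F V) (hinj : InjOn F V) :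
    ∫⁻ w in V, ENNReal.ofReal (‖deriv F w‖ ^ 2) = MeasureTheory.volume (F '' V) := by
  rw [← MeasureTheory.lintegral_abs_det_fderiv_eq_addHaar_image MeasureTheory.volume
    hV.measurableSet (f' := fun w => (fderiv ℂ F w).restrictScalars ℝ)
    (fun w hw => ((hF.differentiableAt (hV.mem_nhds hw)).hasFDerivAt.restrictScalars
      ℝ).hasFDerivWithinAt) hinj]
  refine MeasureTheory.lintegral_congr fun w => ?_
  congr 1
  have h1 : ((fderiv ℂ F w).restrictScalars ℝ).det = ‖deriv F w‖ ^ 2 := by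
    have h2 : ((fderiv ℂ F w : ℂ →L[ℂ] ℂ) : ℂ →ₗ[ℂ] ℂ).det = deriv F w :=
      (LinearMap.det_ring _).trans (by simp)
    rw [ContinuousLinearMap.det, ContinuousLinearMap.coe_restrictScalars,
      LinearMap.det_restrictScalars, h2, Algebra.norm_complex_apply, Complex.normSq_eq_norm_sq]
  rw [h1, abs_of_nonneg (sq_nonneg _)]

/-- Cauchy–Schwarz for the length of a curve. -/
theorem norm_sub_sq_le_mul_integral_norm_deriv_sq {c c' : ℝ → ℂ} {a b : ℝ} (hab : a ≤ b)
    (hc : ∀ y ∈ Icc a b, HasDerivAt c (c' y) y) (hc' : ContinuousOn c' (Icc a b)) :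
    ‖c b - c a‖ ^ 2 ≤ (b - a) * ∫ y in a..b, ‖c' y‖ ^ 2 := by
  rcases hab.eq_or_lt with rfl | hlt
  · simp
  rw [← uIcc_of_le hab] at hc hc'
  have hint := intervalIntegral.integral_eq_sub_of_hasDerivAt hc hc'.intervalIntegrable
  have hn : ContinuousOn (fun y => ‖c' y‖) (uIcc a b) := hc'.norm
  have hn2 : ContinuousOn (fun y => ‖c' y‖ ^ 2) (uIcc a b) := hn.pow 2
  have hle : ‖c b - c a‖ ≤ ∫ y in a..b, ‖c' y‖ := by
    rw [← hint]; exact intervalIntegral.norm_integral_le_integral_norm hab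
  set L := ∫ y in a..b, ‖c' y‖ with hL
  set Q := ∫ y in a..b, ‖c' y‖ ^ 2 with hQ
  set m := L / (b - a) with hm
  have hpos : 0 < b - a := sub_pos.2 hlt
  have h0 : 0 ≤ ∫ y in a..b, (‖c' y‖ - m) ^ 2 :=
    intervalIntegral.integral_nonneg hab fun y _ => sq_nonneg _
  have h1 : ∫ y in a..b, (‖c' y‖ - m) ^ 2 = Q - 2 * m * L + (b - a) * m ^ 2 := by
    have : ∀ y, (‖c' y‖ - m) ^ 2 = ‖c' y‖ ^ 2 - (2 * m) * ‖c' y‖ + m ^ 2 := fun y => by ring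
    simp_rw [this]
    rw [intervalIntegral.integral_add, intervalIntegral.integral_sub,
      intervalIntegral.integral_const_mul, intervalIntegral.integral_const, smul_eq_mul]
    · exact hn2.intervalIntegrable
    · exact (hn.const_mul _).intervalIntegrable
    · exact (hn2.sub (hn.const_mul _)).intervalIntegrable
    · exact intervalIntegrable_const
  have h2 : m * (b - a) = L := by rw [hm]; field_simp
  have hLQ : L ^ 2 ≤ (b - a) * Q := by
    rw [h1] at h0
    have := mul_nonneg hpos.le h0
    have e : (b - a) * (Q - 2 * m * L + (b - a) * m ^ 2) = (b - a) * Q - L ^ 2 := by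
      rw [← h2]; ring
    linarith
  calc ‖c b - c a‖ ^ 2 ≤ L ^ 2 := by gcongr
    _ ≤ _ := hLQ

/-- **Wolff's lemma**: among the circular arcs around a boundary point whose radii have logarithm
between `a` and `b`, some arc has a short image, since the image has bounded area. -/
theorem exists_short_crosscut {f : ℂ → ℂ} (hf : DifferentiableOn ℂ f (Metric.ball 0 1))
    (hinj : InjOn f (Metric.ball 0 1)) (hmaps : MapsTo f (Metric.ball 0 1) (Metric.ball 0 1))
    {ζ : ℂ} (hζ : ‖ζ‖ = 1) {a b : ℝ} (hab : a < b) :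
    ∃ x ∈ Ioo a b, ∀ y₁ y₂ : ℝ, (⟨x, y₁⟩ : ℂ) ∈ crosscutStrip → (⟨x, y₂⟩ : ℂ) ∈ crosscutStrip →
      ‖f (ζ * (1 - Complex.exp ⟨x, y₁⟩)) - f (ζ * (1 - Complex.exp ⟨x, y₂⟩))‖ ^ 2 ≤
        4 / (b - a) * |y₁ - y₂| := by
  set V := crosscutStrip
  have hV : IsOpen V := isOpen_crosscutStrip
  set F : ℂ → ℂ := fun w => f (ζ * (1 - Complex.exp w)) with hFdef
  have hE : MapsTo (fun w => ζ * (1 - Complex.exp w)) V (Metric.ball 0 1) := fun w hw => by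
    rw [mem_ball_zero_iff]; exact (norm_mul_one_sub_exp_lt_one_iff hζ).2 hw.2
  have hFd : DifferentiableOn ℂ F V := hf.comp (by fun_prop) hE
  have hFinj : InjOn F V := hinj.comp (injOn_mul_one_sub_exp hζ) hE
  have harea : ∫⁻ w in V, ENNReal.ofReal (‖deriv F w‖ ^ 2) ≤ NNReal.pi := by
    rw [lintegral_norm_deriv_sq_eq_volume_image hV hFd hFinj]
    calc _ ≤ MeasureTheory.volume (Metric.ball (0 : ℂ) 1) := by
          refine MeasureTheory.measure_mono ?_
          rintro _ ⟨w, hw, rfl⟩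
          exact hmaps (hE hw)
      _ = _ := by rw [Complex.volume_ball]; simp
  let h : ℂ → ℝ≥0∞ := V.indicator fun w => ENNReal.ofReal (‖deriv F w‖ ^ 2)
  have hh : Measurable h :=
    (((measurable_deriv F).norm.pow_const 2).ennreal_ofReal).indicator hV.measurableSet
  have hfub : ∫⁻ x : ℝ, ∫⁻ y : ℝ, h ⟨x, y⟩ ≤ NNReal.pi := by
    refine le_of_eq_of_le ?_ harea
    rw [← MeasureTheory.lintegral_indicator hV.measurableSet,
      ← Complex.volume_preserving_equiv_real_prod.symm.lintegral_comp hh,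
      MeasureTheory.Measure.volume_eq_prod, MeasureTheory.lintegral_prod]
    · rfl
    · exact (hh.comp Complex.measurableEquivRealProd.symm.measurable).aemeasurable
  have hba : 0 < b - a := sub_pos.2 hab
  obtain ⟨x, hx, hxle⟩ : ∃ x ∈ Ioo a b, ∫⁻ y : ℝ, h ⟨x, y⟩ ≤ ENNReal.ofReal (4 / (b - a)) := by
    by_contra! hcon
    have h1 : ∫⁻ _ in Ioo a b, ENNReal.ofReal (4 / (b - a)) ≤ ∫⁻ x in Ioo a b, ∫⁻ y : ℝ, h ⟨x, y⟩ :=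
      MeasureTheory.setLIntegral_mono' measurableSet_Ioo fun x hx => (hcon x hx).le
    rw [MeasureTheory.setLIntegral_const, Real.volume_Ioo, ← ENNReal.ofReal_mul (by positivity),
      div_mul_cancel₀ _ hba.ne'] at h1
    have h2 := h1.trans ((MeasureTheory.setLIntegral_le_lintegral _ _).trans hfub)
    have h3 : (NNReal.pi : ℝ≥0∞) = ENNReal.ofReal Real.pi := by
      rw [← NNReal.coe_real_pi, ENNReal.ofReal_coe_nnreal]
    rw [h3, ENNReal.ofReal_le_ofReal_iff Real.pi_pos.le] at h2
    linarith [Real.pi_lt_four]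
  refine ⟨x, hx, ?_⟩
  have main : ∀ y₁ y₂ : ℝ, y₁ ≤ y₂ → (⟨x, y₁⟩ : ℂ) ∈ V → (⟨x, y₂⟩ : ℂ) ∈ V →
      ‖F ⟨x, y₂⟩ - F ⟨x, y₁⟩‖ ^ 2 ≤ 4 / (b - a) * (y₂ - y₁) := by
    intro y₁ y₂ hle h₁ h₂
    have hseg : ∀ y ∈ Icc y₁ y₂, (⟨x, y⟩ : ℂ) ∈ V := fun y hy => crosscutStrip_convex_im h₁ h₂ hy
    have hline : ∀ y : ℝ, (⟨x, y⟩ : ℂ) = x + y * Complex.I := fun y => by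
      apply Complex.ext <;> simp
    have hlc : Continuous fun y : ℝ => (⟨x, y⟩ : ℂ) := by simp_rw [hline]; fun_prop
    have hder : ∀ y ∈ Icc y₁ y₂, HasDerivAt (fun y : ℝ => F ⟨x, y⟩) (deriv F ⟨x, y⟩ * Complex.I) y := by
      intro y hy
      have hd := (hFd.differentiableAt (hV.mem_nhds (hseg y hy))).hasDerivAt
      have hl : HasDerivAt (fun y : ℝ => (⟨x, y⟩ : ℂ)) Complex.I y := by
        simp_rw [hline]
        simpa using ((Complex.ofRealCLM.hasDerivAt (x := y)).mul_const Complex.I).const_add (x : ℂ)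
      exact hd.comp y hl
    have hdc : ContinuousOn (fun y : ℝ => deriv F ⟨x, y⟩ * Complex.I) (Icc y₁ y₂) := by
      refine ContinuousOn.mul ?_ continuousOn_const
      exact (hFd.deriv hV).continuousOn.comp hlc.continuousOn hseg
    have hcs := norm_sub_sq_le_mul_integral_norm_deriv_sq hle hder hdc
    have hM : ∫ y in y₁..y₂, ‖deriv F ⟨x, y⟩ * Complex.I‖ ^ 2 ≤ 4 / (b - a) := by
      rw [intervalIntegral.integral_of_le hle,
        ← MeasureTheory.integral_Icc_eq_integral_Ioc]
      refine (ENNReal.ofReal_le_ofReal_iff (by positivity)).1 ?_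
      have hdc2 : ContinuousOn (fun y : ℝ => ‖deriv F ⟨x, y⟩ * Complex.I‖ ^ 2) (Icc y₁ y₂) :=
        hdc.norm.pow 2
      rw [MeasureTheory.ofReal_integral_eq_lintegral_ofReal hdc2.integrableOn_Icc
        (.of_forall fun _ => sq_nonneg _)]
      refine le_trans ?_ hxle
      rw [← MeasureTheory.lintegral_indicator measurableSet_Icc]
      refine MeasureTheory.lintegral_mono fun y => ?_
      by_cases hy : y ∈ Icc y₁ y₂
      · simp [h, hy, hseg y hy]
      · simp [hy]
    calc _ ≤ _ := hcs
      _ ≤ (y₂ - y₁) * (4 / (b - a)) := by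
        have := sub_nonneg.2 hle
        gcongr
      _ = _ := by ring
  intro y₁ y₂ h₁ h₂
  rcases le_total y₁ y₂ with hle | hle
  · have := main y₁ y₂ hle h₁ h₂
    rwa [norm_sub_rev, abs_sub_comm, abs_of_nonneg (sub_nonneg.2 hle)]
  · have := main y₂ y₁ hle h₂ h₁
    rwa [abs_of_nonneg (sub_nonneg.2 hle)]

/-! ### Boundary continuity of conformal maps onto slit disks -/

/-- `F` maps the open unit disk conformally onto its part off `c`. -/
structure IsUniformizer (c : Set ℂ) (F : ℂ → ℂ) : Prop where
  differentiableOn : DifferentiableOn ℂ F (Metric.ball 0 1)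
  bijOn : BijOn F (Metric.ball 0 1) (Metric.ball 0 1 \ c)

/-- Points of `E` at distance at most `δ` are joined by a compact connected subset of `E` of
radius at most `ε`. -/
def SmallConnections (E : Set ℂ) (δ ε : ℝ) : Prop :=
  ∀ a ∈ E, ∀ b ∈ E, dist a b ≤ δ →
    ∃ B ⊆ E, IsCompact B ∧ IsPreconnected B ∧ a ∈ B ∧ b ∈ B ∧ B ⊆ Metric.closedBall a ε

theorem UniformContinuousOn.exists_tendsto {X : Type*} [UniformSpace X] {f : X → ℂ} {S : Set X}
    (hf : UniformContinuousOn f S) {p : X} {l : Filter X} [l.NeBot] (hl : l ≤ 𝓝[S] p) :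
    ∃ a, Tendsto f l (𝓝 a) := by
  refine cauchy_map_iff_exists_tendsto.1 (cauchy_map_iff.2 ⟨inferInstance, ?_⟩)
  refine Tendsto.mono_left hf ?_
  refine le_inf ?_ ?_
  · exact (Filter.prod_mono hl hl).trans ((Filter.prod_mono nhdsWithin_le_nhds
      nhdsWithin_le_nhds).trans (by rw [← nhds_prod_eq]; exact nhds_le_uniformity p))
  · rw [← prod_principal_principal]
    have : l ≤ 𝓟 S := hl.trans inf_le_right
    exact Filter.prod_mono this this

namespace IsUniformizer

variable {c : Set ℂ} {F : ℂ → ℂ}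

theorem mapsTo_ball (hF : IsUniformizer c F) : MapsTo F (Metric.ball 0 1) (Metric.ball 0 1) :=
  fun _ hz => (hF.bijOn.mapsTo hz).1

theorem isPreconnected (hF : IsUniformizer c F) : IsPreconnected (Metric.ball 0 1 \ c) := by
  rw [← hF.bijOn.image_eq]
  exact (convex_ball (0 : ℂ) 1).isPreconnected.image _ hF.differentiableOn.continuousOn

theorem exists_inverse (hF : IsUniformizer c F) : ∃ g : ℂ → ℂ,
    BijOn g (Metric.ball 0 1 \ c) (Metric.ball 0 1) ∧
    (∀ z ∈ Metric.ball (0 : ℂ) 1, g (F z) = z) ∧ (∀ w ∈ Metric.ball (0 : ℂ) 1 \ c, F (g w) = w) ∧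
    DifferentiableOn ℂ g (Metric.ball 0 1 \ c) := by
  have hinv := hF.bijOn.invOn_invFunOn
  refine ⟨Function.invFunOn F (Metric.ball 0 1), hF.bijOn.symm hinv.symm, hinv.1, hinv.2, ?_⟩
  have := differentiableOn_leftInverse_of_injOn Metric.isOpen_ball hF.differentiableOn
    hF.bijOn.injOn hinv.1
  rwa [hF.bijOn.image_eq] at this

/-- The boundary goes to the boundary. -/
theorem mem_of_tendsto (hF : IsUniformizer c F) {ι : Type*} {l : Filter ι} [l.NeBot] {z : ι → ℂ}
    {p a : ℂ} (hz : ∀ᶠ i in l, z i ∈ Metric.ball (0 : ℂ) 1) (hp : ‖p‖ = 1)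
    (hzp : Tendsto z l (𝓝 p)) (ha : Tendsto (fun i => F (z i)) l (𝓝 a)) :
    a ∈ Metric.sphere (0 : ℂ) 1 ∪ c := by
  obtain ⟨g, hg, hgF, hFg, hgd⟩ := hF.exists_inverse
  by_contra hcon
  rw [mem_union, not_or] at hcon
  have hacl : a ∈ Metric.closedBall (0 : ℂ) 1 :=
    Metric.isClosed_closedBall.mem_of_tendsto ha
      (hz.mono fun i hi => Metric.ball_subset_closedBall (hF.mapsTo_ball hi))
  have haU : a ∈ Metric.ball (0 : ℂ) 1 \ c := by
    refine ⟨?_, hcon.2⟩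
    have h1 : ‖a‖ ≤ 1 := by simpa using hacl
    have h2 : ‖a‖ ≠ 1 := by simpa using hcon.1
    simpa using lt_of_le_of_ne h1 h2
  have hcont : ContinuousAt g (F (g a)) := continuousAt_leftInverse_of_injOn Metric.isOpen_ball
    hF.differentiableOn hF.bijOn.injOn hgF (hg.mapsTo haU)
  rw [hFg a haU] at hcont
  have h3 : Tendsto z l (𝓝 (g a)) :=
    (hcont.tendsto.comp ha).congr' (hz.mono fun i hi => hgF _ hi)
  have h4 := tendsto_nhds_unique hzp h3
  have h5 := hg.mapsTo haU
  rw [← h4] at h5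
  simp [hp] at h5

theorem exists_eq_mul_one_sub_exp {ζ t : ℂ} (hζ : ‖ζ‖ = 1) (ht : ‖t‖ < 1) :
    ∃ y : ℝ, (⟨Real.log ‖t - ζ‖, y⟩ : ℂ) ∈ crosscutStrip ∧
      t = ζ * (1 - Complex.exp ⟨Real.log ‖t - ζ‖, y⟩) := by
  have hζ0 : ζ ≠ 0 := by rintro rfl; simp at hζ
  set v := 1 - t / ζ with hv
  have hnv : ‖v‖ = ‖t - ζ‖ := by
    have : v = -((t - ζ) / ζ) := by rw [hv]; field_simp; ring
    rw [this, norm_neg, norm_div, hζ, div_one]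
  have hre : 0 < v.re := by
    have h1 : (t / ζ).re ≤ ‖t / ζ‖ := Complex.re_le_norm _
    rw [norm_div, hζ, div_one] at h1
    rw [hv, Complex.sub_re, Complex.one_re]
    linarith
  have hv0 : v ≠ 0 := by rintro h; simp [h] at hre
  have hlog : (⟨Real.log ‖t - ζ‖, v.arg⟩ : ℂ) = Complex.log v := by
    rw [Complex.log, hnv]
    apply Complex.ext <;> simp
  have hexp : t = ζ * (1 - Complex.exp ⟨Real.log ‖t - ζ‖, v.arg⟩) := by
    rw [hlog, Complex.exp_log hv0, hv]
    field_simp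
    ring
  refine ⟨v.arg, ⟨?_, ?_⟩, hexp⟩
  · exact Complex.abs_arg_lt_pi_div_two_iff.2 (Or.inl hre)
  · refine (norm_mul_one_sub_exp_lt_one_iff hζ).1 ?_
    rw [← hexp]
    exact ht

set_option maxHeartbeats 1000000 in
/-- The part of the disk cut off by a circular arc with short image has small image: otherwise, by
Janiszewski's theorem, its image could be connected to `F z₀` around the closure of the image arc
and a small connected piece of the boundary between the ends of that arc. -/
theorem exists_image_subset_closedBall (hF : IsUniformizer c F) (hc : IsCompact c)
    {δ ε : ℝ} (hδ : 0 < δ) (hδε : δ ≤ ε) (hconn : SmallConnections (Metric.sphere 0 1 ∪ c) δ ε)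
    {z₀ ζ : ℂ} (hz₀ : z₀ ∈ Metric.ball (0 : ℂ) 1) (hζ : ‖ζ‖ = 1)
    (hbase : ∀ a ∈ Metric.sphere (0 : ℂ) 1 ∪ c, ε < ‖F z₀ - a‖)
    {x M : ℝ} (hx2 : Real.exp x < 2) (hxz : Real.exp x < ‖z₀ - ζ‖) (hM : 2 * Real.pi * M ≤ δ ^ 2)
    (hM0 : 0 ≤ M)
    (hshort : ∀ y₁ y₂ : ℝ, (⟨x, y₁⟩ : ℂ) ∈ crosscutStrip → (⟨x, y₂⟩ : ℂ) ∈ crosscutStrip →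
      ‖F (ζ * (1 - Complex.exp ⟨x, y₁⟩)) - F (ζ * (1 - Complex.exp ⟨x, y₂⟩))‖ ^ 2 ≤ M * |y₁ - y₂|) :
    ∃ a, ∀ z ∈ Metric.ball (0 : ℂ) 1, ‖z - ζ‖ < Real.exp x → F z ∈ Metric.closedBall a ε := by
  set y₀ := Real.arccos (Real.exp x / 2) with hy₀
  have hcosy₀ : Real.cos y₀ = Real.exp x / 2 :=
    Real.cos_arccos (by linarith [Real.exp_pos x]) (by linarith)
  have hy₀pos : 0 < y₀ := Real.arccos_pos.2 (by linarith)
  have hy₀lt : y₀ < Real.pi / 2 := Real.arccos_lt_pi_div_two.2 (by positivity)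
  have hstrip : ∀ y : ℝ, (⟨x, y⟩ : ℂ) ∈ crosscutStrip ↔ y ∈ Ioo (-y₀) y₀ := by
    intro y
    rw [mem_Ioo, ← abs_lt]
    constructor
    · rintro ⟨h1, h2⟩
      simp only at h1 h2
      by_contra! hle
      have := Real.cos_le_cos_of_nonneg_of_le_pi hy₀pos.le (by linarith [Real.pi_pos]) hle
      rw [Real.cos_abs] at this
      linarith
    · intro h
      refine ⟨h.trans hy₀lt, ?_⟩
      have := Real.cos_lt_cos_of_nonneg_of_le_pi (abs_nonneg y) (by linarith [Real.pi_pos]) h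
      rw [Real.cos_abs] at this
      simp only
      linarith
  let e : ℝ → ℂ := fun y => ζ * (1 - Complex.exp ⟨x, y⟩)
  let φ : ℝ → ℂ := fun y => F (e y)
  have he : Continuous e := by
    have hline : ∀ y : ℝ, (⟨x, y⟩ : ℂ) = x + y * Complex.I := fun y => by
      apply Complex.ext <;> simp
    simp only [e, hline]
    fun_prop
  have heU : ∀ y ∈ Ioo (-y₀) y₀, e y ∈ Metric.ball (0 : ℂ) 1 := fun y hy => by
    rw [mem_ball_zero_iff]
    exact (norm_mul_one_sub_exp_lt_one_iff hζ).2 ((hstrip y).2 hy).2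
  have hφsq : ∀ y₁ ∈ Ioo (-y₀) y₀, ∀ y₂ ∈ Ioo (-y₀) y₀, ‖φ y₁ - φ y₂‖ ^ 2 ≤ M * |y₁ - y₂| :=
    fun y₁ h₁ y₂ h₂ => hshort y₁ y₂ ((hstrip _).2 h₁) ((hstrip _).2 h₂)
  have huc : UniformContinuousOn φ (Ioo (-y₀) y₀) := by
    rw [Metric.uniformContinuousOn_iff]
    intro η hη
    refine ⟨η ^ 2 / (M + 1), by positivity, fun y₁ h₁ y₂ h₂ h => ?_⟩
    have h3 := hφsq y₁ h₁ y₂ h₂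
    rw [Real.dist_eq, lt_div_iff₀ (by positivity)] at h
    rw [dist_eq_norm]
    refine lt_of_pow_lt_pow_left₀ 2 hη.le (h3.trans_lt ?_)
    have : 0 < η ^ 2 := by positivity
    nlinarith [abs_nonneg (y₁ - y₂)]
  have hlt : -y₀ < y₀ := by linarith
  have hleft : 𝓝[>] (-y₀) = 𝓝[Ioo (-y₀) y₀] (-y₀) := (nhdsWithin_Ioo_eq_nhdsGT hlt).symm
  have hright : 𝓝[<] y₀ = 𝓝[Ioo (-y₀) y₀] y₀ := (nhdsWithin_Ioo_eq_nhdsLT hlt).symm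
  obtain ⟨a, ha⟩ := huc.exists_tendsto hleft.le
  obtain ⟨b, hb⟩ := huc.exists_tendsto hright.le
  have hend : ∀ y : ℝ, |y| = y₀ → ‖e y‖ = 1 := by
    intro y hy
    have hsq : ‖e y‖ ^ 2 = 1 := by
      have hc2 : Real.cos y = Real.exp x / 2 := by rw [← Real.cos_abs, hy, hcosy₀]
      simp only [e]
      rw [norm_mul, hζ, one_mul, Complex.sq_norm, Complex.normSq_apply]
      simp only [Complex.sub_re, Complex.one_re, Complex.exp_re, Complex.sub_im, Complex.one_im,
        Complex.exp_im, hc2]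
      have := Real.sin_sq_add_cos_sq y
      rw [hc2] at this
      linear_combination (Real.exp x) ^ 2 * this
    exact (pow_eq_one_iff_of_nonneg (norm_nonneg _) two_ne_zero).1 hsq
  have haE : a ∈ Metric.sphere (0 : ℂ) 1 ∪ c := by
    refine hF.mem_of_tendsto (l := 𝓝[>] (-y₀)) (z := e) ?_ (hend (-y₀) ?_)
      (he.continuousAt.tendsto.mono_left nhdsWithin_le_nhds) ha
    · rw [hleft]; filter_upwards [self_mem_nhdsWithin] with y hy using heU y hy
    · rw [abs_neg, abs_of_pos hy₀pos]
  have hbE : b ∈ Metric.sphere (0 : ℂ) 1 ∪ c := by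
    refine hF.mem_of_tendsto (l := 𝓝[<] y₀) (z := e) ?_ (hend y₀ (abs_of_pos hy₀pos))
      (he.continuousAt.tendsto.mono_left nhdsWithin_le_nhds) hb
    rw [hright]; filter_upwards [self_mem_nhdsWithin] with y hy using heU y hy
  -- the closure `C` of the image arc
  set ψ := extendFrom (Ioo (-y₀) y₀) φ with hψ
  have hψc : ContinuousOn ψ (Icc (-y₀) y₀) :=
    continuousOn_Icc_extendFrom_Ioo huc.continuousOn ha hb
  have hψeq : ∀ y ∈ Ioo (-y₀) y₀, ψ y = φ y := fun y hy =>
    extendFrom_extends huc.continuousOn y hy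
  have hψa : ψ (-y₀) = a := eq_lim_at_left_extendFrom_Ioo hlt ha
  have hψb : ψ y₀ = b := eq_lim_at_right_extendFrom_Ioo hlt hb
  set C := ψ '' Icc (-y₀) y₀ with hC
  have hCcomp : IsCompact C := isCompact_Icc.image_of_continuousOn hψc
  have hCpre : IsPreconnected C := isPreconnected_Icc.image _ hψc
  have h0mem : (0 : ℝ) ∈ Ioo (-y₀) y₀ := ⟨by linarith, hy₀pos⟩
  have hφ0 : ∀ y ∈ Ioo (-y₀) y₀, φ y ∈ Metric.closedBall (φ 0) (δ / 2) := by
    intro y hy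
    rw [mem_closedBall_iff_norm]
    refine le_of_sq_le_sq ?_ (by positivity)
    refine (hφsq y hy 0 h0mem).trans ?_
    have h1 : |y - 0| ≤ Real.pi / 2 := by
      rw [sub_zero]; exact ((abs_lt.2 hy).trans hy₀lt).le
    calc M * |y - 0| ≤ M * (Real.pi / 2) := by gcongr
      _ ≤ (δ / 2) ^ 2 := by linarith
  have hCball : C ⊆ Metric.closedBall (φ 0) (δ / 2) := by
    rintro _ ⟨y, hy, rfl⟩
    rcases eq_endpoints_or_mem_Ioo_of_mem_Icc hy with rfl | rfl | hy
    · rw [hψa]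
      refine Metric.isClosed_closedBall.mem_of_tendsto ha ?_
      rw [hleft]; filter_upwards [self_mem_nhdsWithin] with y hy using hφ0 y hy
    · rw [hψb]
      refine Metric.isClosed_closedBall.mem_of_tendsto hb ?_
      rw [hright]; filter_upwards [self_mem_nhdsWithin] with y hy using hφ0 y hy
    · rw [hψeq y hy]; exact hφ0 y hy
  have haC : a ∈ C := ⟨-y₀, ⟨le_rfl, hlt.le⟩, hψa⟩
  have hbC : b ∈ C := ⟨y₀, ⟨hlt.le, le_rfl⟩, hψb⟩
  have hdist : ∀ u ∈ C, dist u a ≤ δ := fun u hu => by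
    have h1 := hCball hu
    have h2 := hCball haC
    rw [Metric.mem_closedBall] at h1 h2
    have := dist_triangle_right u a (φ 0)
    linarith
  obtain ⟨B, hBE, hBc, hBpre, haB, hbB, hBball⟩ := hconn a haE b hbE (by
    rw [dist_comm]; exact hdist b hbC)
  refine ⟨a, fun z hz hzζ => ?_⟩
  by_contra hzfar
  -- `E₁` and `E₂ = B ∪ C` do not separate `F z` from `F z₀`, but their union does
  let E₁ : Set ℂ := (Metric.closedBall 0 2 \ Metric.ball 0 1) ∪ c
  have hE₁ : IsCompact E₁ := ((isCompact_closedBall 0 2).diff Metric.isOpen_ball).union hc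
  have hsphE₁ : Metric.sphere (0 : ℂ) 1 ∪ c ⊆ E₁ := by
    refine union_subset_union_left _ fun u hu => ?_
    have : ‖u‖ = 1 := by simpa using hu
    simp [this]
  have hinter : E₁ ∩ (B ∪ C) = B := by
    refine Subset.antisymm ?_ fun u hu => ⟨hsphE₁ (hBE hu), Or.inl hu⟩
    rintro u ⟨hu1, hu | ⟨y, hy, rfl⟩⟩
    · exact hu
    · rcases eq_endpoints_or_mem_Ioo_of_mem_Icc hy with rfl | rfl | hy
      · rwa [hψa]
      · rwa [hψb]
      · exfalso
        rw [hψeq y hy] at hu1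
        have h1 := hF.bijOn.mapsTo (heU y hy)
        rcases hu1 with hu1 | hu1
        · exact hu1.2 h1.1
        · exact h1.2 hu1
  have hc₁ : ConnectedOff E₁ (F z) (F z₀) := by
    refine ⟨Metric.ball 0 1 \ c, fun u hu hu1 => ?_, hF.isPreconnected, hF.bijOn.mapsTo hz,
      hF.bijOn.mapsTo hz₀⟩
    rcases hu1 with hu1 | hu1
    · exact hu1.2 hu.1
    · exact hu.2 hu1
  have hBC : B ∪ C ⊆ Metric.closedBall a ε :=
    union_subset hBball fun u hu => (hdist u hu).trans hδε
  have hc₂ : ConnectedOff (B ∪ C) (F z) (F z₀) := by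
    refine ⟨(Metric.closedBall a ε)ᶜ, compl_subset_compl.2 hBC,
      isPreconnected_compl_closedBall_complex a (hδ.le.trans hδε), hzfar, ?_⟩
    rw [mem_compl_iff, mem_closedBall_iff_norm, not_le]
    exact hbase a haE
  obtain ⟨S, hSE, hSpre, hzS, hz₀S⟩ := hc₁.union hE₁ (hBc.union hCcomp) (by rwa [hinter]) hc₂
  have hSball : S ⊆ Metric.ball 0 1 := hSpre.subset_ball_of_disjoint_sphere
    (fun u hu h => hSE hu (Or.inl (hsphE₁ (Or.inl h)))) hz₀S (hF.mapsTo_ball hz₀)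
  have hSc : S ⊆ Metric.ball 0 1 \ c := fun u hu =>
    ⟨hSball hu, fun h => hSE hu (Or.inl (Or.inr h))⟩
  obtain ⟨g, hg, hgF, hFg, hgd⟩ := hF.exists_inverse
  have hTpre : IsPreconnected (g '' S) := hSpre.image _ (hgd.continuousOn.mono hSc)
  obtain ⟨t, ⟨s, hs, rfl⟩, ht⟩ := hTpre.intermediate_value ⟨F z, hzS, hgF z hz⟩
    ⟨F z₀, hz₀S, hgF z₀ hz₀⟩ (f := fun u => ‖u - ζ‖) (by fun_prop) ⟨hzζ.le, hxz.le⟩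
  have hgs : g s ∈ Metric.ball (0 : ℂ) 1 := hg.mapsTo (hSc hs)
  obtain ⟨y, hy, hyt⟩ := exists_eq_mul_one_sub_exp hζ (t := g s) (by simpa using hgs)
  simp only at ht
  rw [ht, Real.log_exp] at hy hyt
  have hyI := (hstrip y).1 hy
  refine hSE hs (Or.inr (Or.inr ⟨y, Ioo_subset_Icc_self hyI, ?_⟩))
  rw [hψeq y hyI]
  simp only [φ, e]
  rw [← hyt, hFg s (hSc hs)]

end IsUniformizer

/-- A modulus of continuity for conformal maps onto slit disks that depends only on the local
connectivity of the boundary and on the position of one interior value. -/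
theorem exists_modulus_of_smallConnections {δ ε ρ : ℝ} (hδ : 0 < δ) (hδε : δ ≤ ε) (hρ : ρ < 1)
    (hρ0 : 0 ≤ ρ) :
    ∃ r > 0, ∀ (c : Set ℂ) (F : ℂ → ℂ) (z₀ : ℂ), IsCompact c → IsUniformizer c F →
      SmallConnections (Metric.sphere 0 1 ∪ c) δ ε → ‖z₀‖ ≤ ρ →
      (∀ a ∈ Metric.sphere (0 : ℂ) 1 ∪ c, ε < ‖F z₀ - a‖) →
      ∀ z ∈ Metric.ball (0 : ℂ) 1, ∀ w ∈ Metric.ball (0 : ℂ) 1, ‖z - w‖ < r →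
        ‖F z - F w‖ ≤ 2 * ε := by
  set L := 8 * Real.pi / δ ^ 2 with hL
  have hLpos : 0 < L := by have := Real.pi_pos; positivity
  set b := Real.log (1 - ρ) with hb
  have hexpb : Real.exp b = 1 - ρ := Real.exp_log (by linarith)
  set r := Real.exp (b - L) with hr
  have hrpos : 0 < r := Real.exp_pos _
  have hr1 : r ≤ 1 := by
    have : r < Real.exp b := Real.exp_lt_exp.2 (by linarith)
    linarith
  have hεpos : 0 < ε := hδ.trans_le hδε
  refine ⟨min (r / 2) (r * ε / 2), by positivity, ?_⟩
  intro c F z₀ hc hF hconn hz₀ hbase z hz w hw hzw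
  have hz1 : ‖z‖ < 1 := by simpa using hz
  have hsmall : ∀ ζ : ℂ, ‖ζ‖ = 1 → ∃ a, ∀ u ∈ Metric.ball (0 : ℂ) 1, ‖u - ζ‖ < r →
      F u ∈ Metric.closedBall a ε := by
    intro ζ hζ
    obtain ⟨x, hx, hshort⟩ := exists_short_crosscut hF.differentiableOn hF.bijOn.injOn
      hF.mapsTo_ball hζ (a := b - L) (b := b) (by linarith)
    have hexpx : Real.exp x < 1 - ρ := by rw [← hexpb]; exact Real.exp_lt_exp.2 hx.2
    have hbL : b - (b - L) = L := by ring
    rw [hbL] at hshort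
    obtain ⟨a, ha⟩ := hF.exists_image_subset_closedBall hc hδ hδε hconn (z₀ := z₀)
      (by simpa using hz₀.trans_lt hρ) hζ hbase (x := x) (M := 4 / L) (by linarith)
      (by
        have := norm_sub_norm_le ζ z₀
        rw [norm_sub_rev] at this
        linarith)
      (by rw [hL]; field_simp; linarith) (by positivity) hshort
    exact ⟨a, fun u hu hur => ha u hu (hur.trans (Real.exp_lt_exp.2 hx.1))⟩
  rcases lt_or_ge (1 - r / 2) ‖z‖ with hzb | hzi
  · have hz0 : 0 < ‖z‖ := by linarith
    have hzC : (‖z‖ : ℂ) ≠ 0 := by exact_mod_cast hz0.ne'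
    obtain ⟨a, ha⟩ := hsmall (z / ‖z‖) (by simp [hz0.ne'])
    have hzζ : ‖z - z / ‖z‖‖ < r / 2 := by
      have h1 : z - z / ‖z‖ = z / ‖z‖ * ((‖z‖ - 1 : ℝ) : ℂ) := by
        push_cast; field_simp
      rw [h1, norm_mul, norm_div, Complex.norm_real, Complex.norm_real, norm_norm,
        div_self hz0.ne', one_mul, Real.norm_eq_abs, abs_of_neg (by linarith)]
      linarith
    have h1 := ha z hz (by linarith)
    have h2 := ha w hw (by
      have h3 : ‖z - w‖ < r / 2 := hzw.trans_le (min_le_left _ _)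
      have := norm_sub_le_norm_sub_add_norm_sub w z (z / ‖z‖)
      rw [norm_sub_rev w z] at this
      linarith)
    rw [mem_closedBall_iff_norm] at h1 h2
    have := norm_sub_le_norm_sub_add_norm_sub (F z) a (F w)
    rw [norm_sub_rev a] at this
    linarith
  · have hsub : Metric.ball z (r / 2) ⊆ Metric.ball 0 1 := by
      refine Metric.ball_subset_ball' ?_
      rw [dist_zero_right]
      linarith
    have hwz : w ∈ Metric.ball z (r / 2) := by
      rw [mem_ball_iff_norm, norm_sub_rev]
      exact hzw.trans_le (min_le_left _ _)
    have h1 := Complex.dist_le_div_mul_dist_of_mapsTo_ball (R₂ := 2)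
      (hF.differentiableOn.mono hsub) (fun u hu => by
        have a1 : ‖F u‖ < 1 := by simpa using hF.mapsTo_ball (hsub hu)
        have a2 : ‖F z‖ < 1 := by simpa using hF.mapsTo_ball hz
        rw [mem_closedBall_iff_norm]
        linarith [norm_sub_le (F u) (F z)]) hwz
    rw [dist_comm, dist_eq_norm, dist_comm, dist_eq_norm] at h1
    refine h1.trans ?_
    have h3 : ‖z - w‖ ≤ r * ε / 2 := (hzw.trans_le (min_le_right _ _)).le
    calc 2 / (r / 2) * ‖z - w‖ ≤ 2 / (r / 2) * (r * ε / 2) := by gcongr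
      _ = 2 * ε := by field_simp

/-! ### Simple arcs in the disk and limits of conformal maps -/

/-- A simple arc in the closed unit disk that starts at `1` and stays in the open disk afterwards,
parameterized by `[0, T]` and continued to a continuous function on `[0, ∞)`. -/
structure IsDiskArc (c : ℝ≥0 → ℂ) (T : ℝ≥0) : Prop where
  continuous : Continuous c
  start_eq : c 0 = 1
  injOn : InjOn c (Icc 0 T)
  mem_ball : ∀ t, 0 < t → t ≤ T → c t ∈ Metric.ball (0 : ℂ) 1

/-- Quantitative simplicity of an arc: it does not come back within distance `δ` of itself, or of
the unit circle, after an excursion of size `ε`. -/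
structure IsRegularArc (c : ℝ≥0 → ℂ) (T : ℝ≥0) (δ ε : ℝ) : Prop where
  return_self : ∀ s t, s ≤ t → t ≤ T → ‖c s - c t‖ ≤ δ → ∀ u ∈ Icc s t, ‖c u - c s‖ ≤ ε
  return_circle : ∀ t ≤ T, 1 - ‖c t‖ ≤ δ → ∀ u ≤ t, ‖c u - 1‖ ≤ ε

/-- `(c', T')` is within `η` of `(c, T)`: some monotone time change matches the points of the
first arc to points of the second, and every point of the second is approached. -/
def ArcsWithin (η : ℝ) (c : ℝ≥0 → ℂ) (T : ℝ≥0) (c' : ℝ≥0 → ℂ) (T' : ℝ≥0) : Prop :=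
  (∃ φ : ℝ≥0 → ℝ≥0, MonotoneOn φ (Icc 0 T') ∧ ∀ s ≤ T', φ s ≤ T ∧ ‖c' s - c (φ s)‖ ≤ η) ∧
    ∀ t ≤ T, ∃ s ≤ T', ‖c' s - c t‖ ≤ η

namespace IsDiskArc

variable {c : ℝ≥0 → ℂ} {T : ℝ≥0}

theorem isCompact (hc : IsDiskArc c T) : IsCompact (c '' Icc 0 T) :=
  isCompact_Icc.image hc.continuous

theorem exists_isRegularArc (hc : IsDiskArc c T) {ε : ℝ} (hε : 0 < ε) :
    ∃ δ > 0, IsRegularArc c T δ ε := by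
  have huc : UniformContinuousOn c (Icc 0 T) :=
    isCompact_Icc.uniformContinuousOn_of_continuous hc.continuous.continuousOn
  obtain ⟨κ, hκ, hκc⟩ := Metric.uniformContinuousOn_iff.1 huc ε hε
  -- pairs of times at distance at least `κ` have images at positive distance
  let A : Set (ℝ≥0 × ℝ≥0) := (Icc 0 T ×ˢ Icc 0 T) ∩ {q | κ ≤ dist q.1 q.2}
  have hA : IsCompact A := (isCompact_Icc.prod isCompact_Icc).inter_right
    (isClosed_le continuous_const (by fun_prop))
  have hδ₁ : ∃ δ > 0, ∀ q ∈ A, δ < ‖c q.1 - c q.2‖ := by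
    rcases A.eq_empty_or_nonempty with h | h
    · exact ⟨1, one_pos, by simp [h]⟩
    · have := hc.continuous
      obtain ⟨q, hq, hmin⟩ := hA.exists_isMinOn h
        (f := fun q : ℝ≥0 × ℝ≥0 => ‖c q.1 - c q.2‖) (by fun_prop)
      have hpos : 0 < ‖c q.1 - c q.2‖ := by
        refine norm_pos_iff.2 (sub_ne_zero.2 fun h => ?_)
        have h2 := hc.injOn hq.1.1 hq.1.2 h
        have h3 : κ ≤ dist q.1 q.2 := hq.2
        rw [h2, dist_self] at h3
        linarith
      refine ⟨‖c q.1 - c q.2‖ / 2, by positivity, fun p hp => ?_⟩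
      have : ‖c q.1 - c q.2‖ ≤ ‖c p.1 - c p.2‖ := hmin hp
      linarith
  let A' : Set ℝ≥0 := Icc 0 T ∩ {t | κ ≤ dist t 0}
  have hA' : IsCompact A' := isCompact_Icc.inter_right (isClosed_le continuous_const (by fun_prop))
  have hδ₂ : ∃ δ > 0, ∀ t ∈ A', δ < 1 - ‖c t‖ := by
    rcases A'.eq_empty_or_nonempty with h | h
    · exact ⟨1, one_pos, by simp [h]⟩
    · have := hc.continuous
      obtain ⟨q, hq, hmin⟩ := hA'.exists_isMinOn h (f := fun t => 1 - ‖c t‖) (by fun_prop)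
      have hq0 : 0 < q := by
        refine pos_iff_ne_zero.2 ?_
        rintro rfl
        have h3 : κ ≤ dist (0 : ℝ≥0) 0 := hq.2
        rw [dist_self] at h3
        linarith
      have hpos : ‖c q‖ < 1 := by simpa using hc.mem_ball q hq0 hq.1.2
      refine ⟨(1 - ‖c q‖) / 2, by linarith, fun p hp => ?_⟩
      have : 1 - ‖c q‖ ≤ 1 - ‖c p‖ := hmin hp
      linarith
  obtain ⟨δ₁, hδ₁0, hδ₁⟩ := hδ₁
  obtain ⟨δ₂, hδ₂0, hδ₂⟩ := hδ₂
  refine ⟨min δ₁ δ₂, lt_min hδ₁0 hδ₂0, fun s t hst htT h u hu => ?_, fun t ht h u hu => ?_⟩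
  · have hd : dist s t < κ := by
      by_contra! hcon
      have := hδ₁ (s, t) ⟨⟨⟨zero_le, hst.trans htT⟩, ⟨zero_le, htT⟩⟩, hcon⟩
      have := h.trans (min_le_left _ _)
      simp only at *
      linarith
    have hd2 : dist u s < κ := by
      refine lt_of_le_of_lt ?_ hd
      rw [NNReal.dist_eq, NNReal.dist_eq, abs_of_nonneg (sub_nonneg.2 (NNReal.coe_le_coe.2 hu.1)),
        abs_sub_comm, abs_of_nonneg (sub_nonneg.2 (NNReal.coe_le_coe.2 hst))]
      have : (u : ℝ) ≤ t := by exact_mod_cast hu.2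
      linarith
    have := hκc u ⟨zero_le, hu.2.trans htT⟩ s ⟨zero_le, hst.trans htT⟩ hd2
    rw [dist_eq_norm] at this
    exact this.le
  · have hd : dist t 0 < κ := by
      by_contra! hcon
      have := hδ₂ t ⟨⟨zero_le, ht⟩, hcon⟩
      have := h.trans (min_le_right _ _)
      linarith
    have hd2 : dist u 0 < κ := by
      refine lt_of_le_of_lt ?_ hd
      rw [NNReal.dist_eq, NNReal.dist_eq]
      simpa using hu
    have := hκc u ⟨zero_le, hu.trans ht⟩ 0 ⟨zero_le, zero_le⟩ hd2
    rw [dist_eq_norm, hc.start_eq] at this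
    exact this.le

end IsDiskArc

theorem IsRegularArc.mono {c : ℝ≥0 → ℂ} {T : ℝ≥0} {δ ε δ' ε' : ℝ} (h : IsRegularArc c T δ ε)
    (hδ : δ' ≤ δ) (hε : ε ≤ ε') : IsRegularArc c T δ' ε' :=
  ⟨fun s t hst ht hd u hu => (h.1 s t hst ht (hd.trans hδ) u hu).trans hε,
    fun t ht hd u hu => (h.2 t ht (hd.trans hδ) u hu).trans hε⟩

/-- Regularity with given constants passes to nearby arcs up to `2 η`; this makes the modulus of
continuity locally uniform in the arc. -/
theorem IsRegularArc.of_arcsWithin {c c' : ℝ≥0 → ℂ} {T T' : ℝ≥0} {δ ε η : ℝ}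
    (h : IsRegularArc c T δ ε) (hη : 0 ≤ η) (hw : ArcsWithin η c T c' T') :
    IsRegularArc c' T' (δ - 2 * η) (ε + 2 * η) := by
  obtain ⟨⟨φ, hφ, hφc⟩, -⟩ := hw
  refine ⟨fun s t hst ht hd u hu => ?_, fun t ht hd u hu => ?_⟩
  · have hs := hφc s (hst.trans ht)
    have ht' := hφc t ht
    have hu' := hφc u (hu.2.trans ht)
    have hd' : ‖c (φ s) - c (φ t)‖ ≤ δ := by
      have e : c (φ s) - c (φ t) = (c' s - c' t) - (c' s - c (φ s)) + (c' t - c (φ t)) := by ring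
      rw [e]
      have := norm_add_le ((c' s - c' t) - (c' s - c (φ s))) (c' t - c (φ t))
      have := norm_sub_le (c' s - c' t) (c' s - c (φ s))
      linarith [hs.2, ht'.2]
    have := h.1 (φ s) (φ t) (hφ ⟨zero_le, hst.trans ht⟩ ⟨zero_le, ht⟩ hst) ht'.1 hd' (φ u)
      ⟨hφ ⟨zero_le, hst.trans ht⟩ ⟨zero_le, hu.2.trans ht⟩ hu.1,
        hφ ⟨zero_le, hu.2.trans ht⟩ ⟨zero_le, ht⟩ hu.2⟩
    have e : c' u - c' s = (c (φ u) - c (φ s)) + (c' u - c (φ u)) - (c' s - c (φ s)) := by ring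
    rw [e]
    have := norm_sub_le ((c (φ u) - c (φ s)) + (c' u - c (φ u))) (c' s - c (φ s))
    have := norm_add_le (c (φ u) - c (φ s)) (c' u - c (φ u))
    linarith [hs.2, hu'.2]
  · have ht' := hφc t ht
    have hu' := hφc u (hu.trans ht)
    have hd' : 1 - ‖c (φ t)‖ ≤ δ := by
      have := norm_sub_norm_le (c' t) (c (φ t))
      linarith [ht'.2]
    have := h.2 (φ t) ht'.1 hd' (φ u) (hφ ⟨zero_le, hu.trans ht⟩ ⟨zero_le, ht⟩ hu)
    have e : c' u - 1 = (c (φ u) - 1) + (c' u - c (φ u)) := by ring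
    rw [e]
    have := norm_add_le (c (φ u) - 1) (c' u - c (φ u))
    linarith [hu'.2]

/-- Nearby points of the unit circle are joined by a short arc, the radial projection of a
segment. -/
theorem exists_short_arc_circle {a b : ℂ} (ha : ‖a‖ = 1) (hb : ‖b‖ = 1) (hab : ‖a - b‖ ≤ 1 / 2) :
    ∃ B ⊆ Metric.sphere (0 : ℂ) 1, IsCompact B ∧ IsPreconnected B ∧ a ∈ B ∧ b ∈ B ∧
      B ⊆ Metric.closedBall a (2 * ‖a - b‖) := by
  have hseg : ∀ z ∈ segment ℝ a b, ‖z - a‖ ≤ ‖a - b‖ := fun z hz => by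
    rw [norm_sub_rev a b]; exact norm_sub_le_of_mem_segment hz
  have hnear : ∀ z ∈ segment ℝ a b, |1 - ‖z‖| ≤ ‖a - b‖ := fun z hz => by
    rw [← ha]
    exact (abs_norm_sub_norm_le a z).trans (by rw [norm_sub_rev]; exact hseg z hz)
  have hz0 : ∀ z ∈ segment ℝ a b, 0 < ‖z‖ := fun z hz => by
    have := le_abs_self (1 - ‖z‖)
    linarith [hnear z hz]
  have hcont : ContinuousOn (fun z : ℂ => z / ‖z‖) (segment ℝ a b) := by
    refine ContinuousOn.div continuousOn_id (by fun_prop) fun z hz => ?_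
    exact_mod_cast (hz0 z hz).ne'
  refine ⟨(fun z : ℂ => z / ‖z‖) '' segment ℝ a b, ?_, ?_, ?_, ?_, ?_, ?_⟩
  · rintro _ ⟨z, hz, rfl⟩
    simp [(hz0 z hz).ne']
  · refine IsCompact.image_of_continuousOn ?_ hcont
    rw [segment_eq_image_lineMap]
    exact isCompact_Icc.image AffineMap.lineMap_continuous
  · exact (convex_segment a b).isPreconnected.image _ hcont
  · exact ⟨a, left_mem_segment ℝ a b, by simp [ha]⟩
  · exact ⟨b, right_mem_segment ℝ a b, by simp [hb]⟩
  · rintro _ ⟨z, hz, rfl⟩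
    have hzC : (‖z‖ : ℂ) ≠ 0 := by exact_mod_cast (hz0 z hz).ne'
    have h1 : z / ‖z‖ - z = z / ‖z‖ * ((1 - ‖z‖ : ℝ) : ℂ) := by push_cast; field_simp
    have h2 : ‖z / ‖z‖ - z‖ ≤ ‖a - b‖ := by
      rw [h1, norm_mul, norm_div, Complex.norm_real, norm_norm, div_self (hz0 z hz).ne', one_mul,
        Complex.norm_real, Real.norm_eq_abs]
      exact hnear z hz
    rw [mem_closedBall_iff_norm]
    have := norm_sub_le_norm_sub_add_norm_sub (z / (‖z‖ : ℂ)) z a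
    linarith [hseg z hz]

/-- The unit circle together with a regular arc is uniformly locally connected. -/
theorem IsRegularArc.smallConnections {c : ℝ≥0 → ℂ} {T : ℝ≥0} {δ ε : ℝ} (hc : IsDiskArc c T)
    (h : IsRegularArc c T δ ε) (hε : ε ≤ 1 / 4) (hδε : δ ≤ ε) (hδ : 0 ≤ δ) :
    SmallConnections (Metric.sphere 0 1 ∪ c '' Icc 0 T) δ (6 * ε) := by
  have harc : ∀ s t, t ≤ T → IsCompact (c '' Icc s t) ∧ IsPreconnected (c '' Icc s t) ∧
      c '' Icc s t ⊆ c '' Icc 0 T := fun s t ht =>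
    ⟨isCompact_Icc.image hc.continuous, isPreconnected_Icc.image _ hc.continuous.continuousOn,
      image_mono (Icc_subset_Icc zero_le ht)⟩
  have hcc : ∀ s t, s ≤ t → t ≤ T → ‖c s - c t‖ ≤ δ → ∃ B ⊆ Metric.sphere 0 1 ∪ c '' Icc 0 T,
      IsCompact B ∧ IsPreconnected B ∧ c s ∈ B ∧ c t ∈ B ∧ B ⊆ Metric.closedBall (c s) ε := by
    intro s t hst ht hd
    obtain ⟨h1, h2, h3⟩ := harc s t ht
    refine ⟨_, h3.trans subset_union_right, h1, h2, mem_image_of_mem _ ⟨le_rfl, hst⟩,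
      mem_image_of_mem _ ⟨hst, le_rfl⟩, ?_⟩
    rintro _ ⟨u, hu, rfl⟩
    rw [mem_closedBall_iff_norm]
    exact h.1 s t hst ht hd u hu
  have hsc : ∀ a t, ‖a‖ = 1 → t ≤ T → ‖a - c t‖ ≤ δ → ∃ B ⊆ Metric.sphere 0 1 ∪ c '' Icc 0 T,
      IsCompact B ∧ IsPreconnected B ∧ a ∈ B ∧ c t ∈ B ∧ B ⊆ Metric.closedBall 1 (4 * ε) ∧
      ‖a - 1‖ ≤ 2 * ε ∧ ‖c t - 1‖ ≤ ε := by
    intro a t ha ht hd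
    have h0 : 1 - ‖c t‖ ≤ δ := by
      have := norm_sub_norm_le a (c t)
      linarith
    have hu := h.2 t ht h0
    have ht1 := hu t le_rfl
    have ha1 : ‖a - 1‖ ≤ 2 * ε := by
      have := norm_sub_le_norm_sub_add_norm_sub a (c t) 1
      linarith
    obtain ⟨B, hB1, hB2, hB3, hB4, hB5, hB6⟩ := exists_short_arc_circle (a := 1) (b := a)
      (by simp) ha (by rw [norm_sub_rev]; linarith)
    obtain ⟨h1, h2, h3⟩ := harc 0 t ht
    refine ⟨B ∪ c '' Icc 0 t, union_subset_union hB1 h3, hB2.union h1,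
      hB3.union 1 hB4 ⟨0, ⟨le_rfl, zero_le⟩, hc.start_eq⟩ h2, Or.inl hB5,
      Or.inr ⟨t, ⟨zero_le, le_rfl⟩, rfl⟩, union_subset ?_ ?_, ha1, ht1⟩
    · refine hB6.trans (Metric.closedBall_subset_closedBall ?_)
      rw [norm_sub_rev]; linarith
    · rintro _ ⟨u, hu', rfl⟩
      rw [mem_closedBall_iff_norm]
      linarith [hu u hu'.2]
  rintro a ha b hb hab
  rw [dist_eq_norm] at hab
  have hball : ∀ {B : Set ℂ} {p q : ℂ} {r : ℝ}, B ⊆ Metric.closedBall p r → ‖q - p‖ + r ≤ 6 * ε →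
      B ⊆ Metric.closedBall q (6 * ε) := fun {B p q r} hB hr =>
    hB.trans (Metric.closedBall_subset_closedBall' (by rw [dist_comm, dist_eq_norm]; linarith))
  have hnorm : ∀ u ∈ Metric.sphere (0 : ℂ) 1, ‖u‖ = 1 := fun u hu => by simpa using hu
  rcases ha with ha | ⟨s, hs, rfl⟩ <;> rcases hb with hb | ⟨t, ht, rfl⟩
  · obtain ⟨B, hB1, hB2, hB3, hB4, hB5, hB6⟩ :=
      exists_short_arc_circle (hnorm a ha) (hnorm b hb) (by linarith)
    exact ⟨B, hB1.trans subset_union_left, hB2, hB3, hB4, hB5,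
      hball hB6 (by rw [sub_self, norm_zero]; linarith)⟩
  · obtain ⟨B, hB1, hB2, hB3, hB4, hB5, hB6, h7, h8⟩ := hsc a t (hnorm a ha) ht.2 hab
    exact ⟨B, hB1, hB2, hB3, hB4, hB5, hball hB6 (by linarith)⟩
  · obtain ⟨B, hB1, hB2, hB3, hB4, hB5, hB6, h7, h8⟩ := hsc b s (hnorm b hb) hs.2
      (by rwa [norm_sub_rev])
    exact ⟨B, hB1, hB2, hB3, hB5, hB4, hball hB6 (by linarith)⟩
  · rcases le_total s t with hst | hst
    · obtain ⟨B, hB1, hB2, hB3, hB4, hB5, hB6⟩ := hcc s t hst ht.2 hab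
      exact ⟨B, hB1, hB2, hB3, hB4, hB5, hball hB6 (by rw [sub_self, norm_zero]; linarith)⟩
    · obtain ⟨B, hB1, hB2, hB3, hB4, hB5, hB6⟩ := hcc t s hst hs.2 (by rwa [norm_sub_rev])
      exact ⟨B, hB1, hB2, hB3, hB5, hB4, hball hB6 (by linarith)⟩

/-- Uniformizers of the slit disks of arcs close to a given one share a modulus of continuity. -/
theorem IsDiskArc.exists_uniform_modulus {c : ℝ≥0 → ℂ} {T : ℝ≥0} (hc : IsDiskArc c T) {z₀ : ℂ}
    (hz₀ : ‖z₀‖ < 1) {κ ε : ℝ} (hκ : 0 < κ) (hε : 0 < ε) :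
    ∃ r > 0, ∃ η > 0, ∀ (c' : ℝ≥0 → ℂ) (T' : ℝ≥0) (F : ℂ → ℂ), IsDiskArc c' T' →
      ArcsWithin η c T c' T' → IsUniformizer (c' '' Icc 0 T') F →
      (∀ a ∈ Metric.sphere (0 : ℂ) 1 ∪ c' '' Icc 0 T', κ ≤ ‖F z₀ - a‖) →
      ∀ z ∈ Metric.ball (0 : ℂ) 1, ∀ w ∈ Metric.ball (0 : ℂ) 1, ‖z - w‖ < r →
        ‖F z - F w‖ ≤ ε := by
  obtain ⟨e, he0, he1, he2, he3⟩ : ∃ e > 0, e ≤ 1 / 8 ∧ 12 * e < κ ∧ 24 * e ≤ ε := by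
    refine ⟨min (1 / 8) (min (κ / 13) (ε / 24)), by positivity, min_le_left _ _, ?_, ?_⟩
    · have := (min_le_right (1 / 8) (min (κ / 13) (ε / 24))).trans (min_le_left _ _)
      linarith
    · have := (min_le_right (1 / 8) (min (κ / 13) (ε / 24))).trans (min_le_right _ _)
      linarith
  obtain ⟨δ', hδ', hreg'⟩ := hc.exists_isRegularArc he0
  obtain ⟨δ, hδ, hδe, hreg⟩ : ∃ δ > 0, δ ≤ e ∧ IsRegularArc c T δ e :=
    ⟨min δ' e, lt_min hδ' he0, min_le_right _ _, hreg'.mono (min_le_left _ _) le_rfl⟩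
  obtain ⟨r, hr, hmod⟩ := exists_modulus_of_smallConnections (δ := δ / 2) (ε := 6 * (2 * e))
    (ρ := ‖z₀‖) (by positivity) (by linarith) hz₀ (norm_nonneg _)
  refine ⟨r, hr, δ / 4, by positivity, fun c' T' F hc' hw hF hbase z hz w hw' hzw => ?_⟩
  have hreg'' : IsRegularArc c' T' (δ / 2) (2 * e) :=
    (hreg.of_arcsWithin (by positivity) hw).mono (by linarith) (by linarith)
  have := hmod _ F z₀ hc'.isCompact hF
    (hreg''.smallConnections hc' (by linarith) (by linarith) (by positivity)) le_rfl
    (fun a ha => lt_of_lt_of_le (by linarith) (hbase a ha)) z hz w hw' hzw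
  linarith

theorem ArcsWithin.refl {η : ℝ} (hη : 0 ≤ η) (c : ℝ≥0 → ℂ) (T : ℝ≥0) : ArcsWithin η c T c T :=
  ⟨⟨id, monotone_id.monotoneOn _, fun s hs => ⟨hs, by simpa using hη⟩⟩,
    fun t ht => ⟨t, ht, by simpa using hη⟩⟩

theorem closedBall_subset_closure_ball : Metric.closedBall (0 : ℂ) 1 ⊆ closure (Metric.ball 0 1) := by
  rw [closure_ball _ one_ne_zero]

/-- A uniformizer of the slit disk of a simple arc extends continuously to the closed disk. -/
theorem IsUniformizer.exists_extension {c : ℝ≥0 → ℂ} {T : ℝ≥0} (hc : IsDiskArc c T) {F : ℂ → ℂ}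
    (hF : IsUniformizer (c '' Icc 0 T) F) :
    ∃ G : ℂ → ℂ, ContinuousOn G (Metric.closedBall 0 1) ∧ EqOn G F (Metric.ball 0 1) := by
  have h0 : (0 : ℂ) ∈ Metric.ball (0 : ℂ) 1 := by simp
  have hE : IsClosed (Metric.sphere (0 : ℂ) 1 ∪ c '' Icc 0 T) :=
    Metric.isClosed_sphere.union hc.isCompact.isClosed
  have hF0 : F 0 ∉ Metric.sphere (0 : ℂ) 1 ∪ c '' Icc 0 T := by
    have := hF.bijOn.mapsTo h0
    rintro (h | h)
    · have h1 : ‖F 0‖ = 1 := by simpa using h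
      have h2 : ‖F 0‖ < 1 := by simpa using this.1
      linarith
    · exact this.2 h
  obtain ⟨κ, hκ, hball⟩ := Metric.isOpen_iff.1 hE.isOpen_compl (F 0) hF0
  have hbase : ∀ a ∈ Metric.sphere (0 : ℂ) 1 ∪ c '' Icc 0 T, κ ≤ ‖F 0 - a‖ := by
    intro a ha
    by_contra! hlt
    exact hball (by rwa [mem_ball_iff_norm, norm_sub_rev]) ha
  have huc : UniformContinuousOn F (Metric.ball 0 1) := by
    rw [Metric.uniformContinuousOn_iff]
    intro ε hε
    obtain ⟨r, hr, η, hη, h⟩ := hc.exists_uniform_modulus (z₀ := 0) (by simp) hκ (half_pos hε)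
    refine ⟨r, hr, fun z hz w hw hzw => ?_⟩
    rw [dist_eq_norm] at hzw ⊢
    have := h c T F hc (ArcsWithin.refl hη.le c T) hF hbase z hz w hw hzw
    linarith
  refine ⟨extendFrom (Metric.ball 0 1) F, continuousOn_extendFrom closedBall_subset_closure_ball
    fun x hx => ?_, fun z hz => extendFrom_extends hF.differentiableOn.continuousOn z hz⟩
  have := mem_closure_iff_nhdsWithin_neBot.1 (closedBall_subset_closure_ball hx)
  exact huc.exists_tendsto le_rfl

theorem mul_mem_ball {z : ℂ} (hz : z ∈ Metric.closedBall (0 : ℂ) 1) {s : ℝ} (hs : s ∈ Ioo (0 : ℝ) 1) :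
    (s : ℂ) * z ∈ Metric.ball (0 : ℂ) 1 := by
  have hz1 : ‖z‖ ≤ 1 := by simpa using hz
  rw [mem_ball_zero_iff, norm_mul, Complex.norm_real, Real.norm_eq_abs, abs_of_pos hs.1]
  nlinarith [hs.1, hs.2, norm_nonneg z]

theorem eventually_mem_Ioo_zero_one : ∀ᶠ s : ℝ in 𝓝[<] 1, s ∈ Ioo (0 : ℝ) 1 :=
  Ioo_mem_nhdsLT one_pos

theorem tendsto_ofReal_mul (z : ℂ) : Tendsto (fun s : ℝ => (s : ℂ) * z) (𝓝[<] 1) (𝓝 z) := by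
  have : Continuous fun s : ℝ => (s : ℂ) * z := by fun_prop
  simpa using (this.tendsto 1).mono_left nhdsWithin_le_nhds

theorem tendsto_comp_ofReal_mul {G : ℂ → ℂ} (hG : ContinuousOn G (Metric.closedBall 0 1)) {z : ℂ}
    (hz : z ∈ Metric.closedBall (0 : ℂ) 1) :
    Tendsto (fun s : ℝ => G ((s : ℂ) * z)) (𝓝[<] 1) (𝓝 (G z)) := by
  refine (hG z hz).tendsto.comp (tendsto_nhdsWithin_iff.2 ⟨tendsto_ofReal_mul z, ?_⟩)
  filter_upwards [eventually_mem_Ioo_zero_one] with s hs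
  exact Metric.ball_subset_closedBall (mul_mem_ball hz hs)

namespace IsUniformizer

variable {c : Set ℂ} {F : ℂ → ℂ}

theorem mapsTo_sphere (hF : IsUniformizer c F) (hcont : ContinuousOn F (Metric.closedBall 0 1))
    {p : ℂ} (hp : ‖p‖ = 1) : F p ∈ Metric.sphere (0 : ℂ) 1 ∪ c := by
  have hp' : p ∈ Metric.closedBall (0 : ℂ) 1 := by simp [hp]
  refine hF.mem_of_tendsto (l := 𝓝[<] (1 : ℝ)) (z := fun s => (s : ℂ) * p) ?_ hp
    (tendsto_ofReal_mul p) (tendsto_comp_ofReal_mul hcont hp')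
  filter_upwards [eventually_mem_Ioo_zero_one] with s hs using mul_mem_ball hp' hs

theorem mapsTo_closedBall (hF : IsUniformizer c F)
    (hcont : ContinuousOn F (Metric.closedBall 0 1)) :
    MapsTo F (Metric.closedBall 0 1) (Metric.closedBall 0 1) := by
  intro z hz
  refine Metric.isClosed_closedBall.mem_of_tendsto (tendsto_comp_ofReal_mul hcont hz) ?_
  filter_upwards [eventually_mem_Ioo_zero_one] with s hs
  exact Metric.ball_subset_closedBall (hF.mapsTo_ball (mul_mem_ball hz hs))

end IsUniformizer

/-- A modulus of continuity on the open disk persists on the closed disk. -/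
theorem norm_sub_le_of_ball {F : ℂ → ℂ} (hF : ContinuousOn F (Metric.closedBall 0 1)) {r ε : ℝ}
    (h : ∀ z ∈ Metric.ball (0 : ℂ) 1, ∀ w ∈ Metric.ball (0 : ℂ) 1, ‖z - w‖ < r → ‖F z - F w‖ ≤ ε)
    {z w : ℂ} (hz : z ∈ Metric.closedBall (0 : ℂ) 1) (hw : w ∈ Metric.closedBall (0 : ℂ) 1)
    (hzw : ‖z - w‖ < r) : ‖F z - F w‖ ≤ ε := by
  refine le_of_tendsto ((tendsto_comp_ofReal_mul hF hz).sub (tendsto_comp_ofReal_mul hF hw)).norm ?_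
  filter_upwards [eventually_mem_Ioo_zero_one] with s hs
  refine h _ (mul_mem_ball hz hs) _ (mul_mem_ball hw hs) ?_
  rw [← mul_sub, norm_mul, Complex.norm_real, Real.norm_eq_abs, abs_of_pos hs.1]
  nlinarith [hs.1, hs.2, norm_nonneg (z - w)]

/-- Compactness of uniformizers: along an ultrafilter, uniformizers of arcs converging to a simple
arc converge uniformly on the closed disk, and the limit is a uniformizer of the limiting arc. The
limit is injective by Hurwitz's theorem, and onto because it takes the circle to the boundary. -/
theorem IsDiskArc.exists_tendstoUniformlyOn {ι : Type*} (l : Ultrafilter ι) {c : ℝ≥0 → ℂ}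
    {T : ℝ≥0} (hc : IsDiskArc c T) (hpre : IsPreconnected (Metric.ball 0 1 \ c '' Icc 0 T))
    {c' : ι → ℝ≥0 → ℂ} {T' : ι → ℝ≥0} (hc' : ∀ i, IsDiskArc (c' i) (T' i))
    (hw : ∀ η > 0, ∀ᶠ i in l, ArcsWithin η c T (c' i) (T' i)) {F : ι → ℂ → ℂ}
    (hF : ∀ i, IsUniformizer (c' i '' Icc 0 (T' i)) (F i))
    (hcont : ∀ i, ContinuousOn (F i) (Metric.closedBall 0 1)) {z₀ : ℂ} (hz₀ : ‖z₀‖ < 1) {κ : ℝ}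
    (hκ : 0 < κ)
    (hbase : ∀ᶠ i in l, ∀ a ∈ Metric.sphere (0 : ℂ) 1 ∪ c' i '' Icc 0 (T' i), κ ≤ ‖F i z₀ - a‖) :
    ∃ G : ℂ → ℂ, TendstoUniformlyOn F G l (Metric.closedBall 0 1) ∧
      ContinuousOn G (Metric.closedBall 0 1) ∧ IsUniformizer (c '' Icc 0 T) G := by
  have hequi : ∀ ε > 0, ∃ r > 0, ∀ᶠ i in l, ∀ z ∈ Metric.closedBall (0 : ℂ) 1,
      ∀ w ∈ Metric.closedBall (0 : ℂ) 1, ‖z - w‖ < r → ‖F i z - F i w‖ ≤ ε := by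
    intro ε hε
    obtain ⟨r, hr, η, hη, h⟩ := hc.exists_uniform_modulus hz₀ hκ hε
    refine ⟨r, hr, ?_⟩
    filter_upwards [hw η hη, hbase] with i hi1 hi2 z hz w hw hzw
    exact norm_sub_le_of_ball (hcont i) (h _ _ _ (hc' i) hi1 (hF i) hi2) hz hw hzw
  have hlim : ∀ z : ℂ, ∃ a, z ∈ Metric.closedBall (0 : ℂ) 1 →
      a ∈ Metric.closedBall (0 : ℂ) 1 ∧ Tendsto (fun i => F i z) l (𝓝 a) := by
    intro z
    by_cases hz : z ∈ Metric.closedBall (0 : ℂ) 1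
    · obtain ⟨a, ha, hle⟩ := (isCompact_closedBall (0 : ℂ) 1).ultrafilter_le_nhds
        (l.map fun i => F i z) (by
          rw [le_principal_iff]
          have : ∀ᶠ i in (l : Filter ι), F i z ∈ Metric.closedBall (0 : ℂ) 1 :=
            .of_forall fun i => (hF i).mapsTo_closedBall (hcont i) hz
          exact this)
      exact ⟨a, fun _ => ⟨ha, hle⟩⟩
    · exact ⟨0, fun h => absurd h hz⟩
  choose G hG using hlim
  have hGmod : ∀ ε > 0, ∃ r > 0, ∀ z ∈ Metric.closedBall (0 : ℂ) 1,
      ∀ w ∈ Metric.closedBall (0 : ℂ) 1, ‖z - w‖ < r → ‖G z - G w‖ ≤ ε := by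
    intro ε hε
    obtain ⟨r, hr, h⟩ := hequi ε hε
    refine ⟨r, hr, fun z hz w hw hzw => ?_⟩
    refine le_of_tendsto ((hG z hz).2.sub (hG w hw).2).norm ?_
    filter_upwards [h] with i hi using hi z hz w hw hzw
  have hGc : ContinuousOn G (Metric.closedBall 0 1) := by
    refine UniformContinuousOn.continuousOn (Metric.uniformContinuousOn_iff.2 fun ε hε => ?_)
    obtain ⟨r, hr, h⟩ := hGmod (ε / 2) (half_pos hε)
    refine ⟨r, hr, fun z hz w hw hzw => ?_⟩
    rw [dist_eq_norm] at hzw ⊢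
    linarith [h z hz w hw hzw]
  have hunif : TendstoUniformlyOn F G l (Metric.closedBall 0 1) := by
    rw [Metric.tendstoUniformlyOn_iff]
    intro ε hε
    obtain ⟨r₁, hr₁, h₁⟩ := hequi (ε / 4) (by positivity)
    obtain ⟨r₂, hr₂, h₂⟩ := hGmod (ε / 4) (by positivity)
    obtain ⟨t, ht, htfin, hcover⟩ := (isCompact_closedBall (0 : ℂ) 1).finite_cover_balls
      (lt_min hr₁ hr₂)
    have hfin : ∀ᶠ i in l, ∀ x ∈ t, ‖F i x - G x‖ < ε / 4 := by
      rw [Filter.eventually_all_finite htfin]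
      intro x hx
      have := Metric.tendsto_nhds.1 (hG x (ht hx)).2 (ε / 4) (by positivity)
      simpa [dist_eq_norm] using this
    filter_upwards [h₁, hfin] with i hi1 hi2 z hz
    obtain ⟨x, hx, hzx⟩ := mem_iUnion₂.1 (hcover hz)
    rw [mem_ball_iff_norm, lt_min_iff] at hzx
    have a1 := hi1 z hz x (ht hx) hzx.1
    have a2 := h₂ z hz x (ht hx) hzx.2
    have a3 := hi2 x hx
    rw [dist_eq_norm]
    have e : G z - F i z = (G z - G x) - (F i x - G x) - (F i z - F i x) := by ring
    rw [e]
    have := norm_sub_le ((G z - G x) - (F i x - G x)) (F i z - F i x)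
    have := norm_sub_le (G z - G x) (F i x - G x)
    linarith
  have hunifb : TendstoUniformlyOn F G l (Metric.ball 0 1) :=
    hunif.mono Metric.ball_subset_closedBall
  have hd : ∀ᶠ i in (l : Filter ι), DifferentiableOn ℂ (F i) (Metric.ball 0 1) :=
    .of_forall fun i => (hF i).differentiableOn
  have hGd : DifferentiableOn ℂ G (Metric.ball 0 1) :=
    hunifb.tendstoLocallyUniformlyOn.differentiableOn hd Metric.isOpen_ball
  have hballpre : IsPreconnected (Metric.ball (0 : ℂ) 1) := (convex_ball (0 : ℂ) 1).isPreconnected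
  set E := Metric.sphere (0 : ℂ) 1 ∪ c '' Icc 0 T with hE
  have hEc : IsClosed E := Metric.isClosed_sphere.union hc.isCompact.isClosed
  have hsph : ∀ p : ℂ, ‖p‖ = 1 → G p ∈ E := by
    intro p hp
    rw [← hEc.closure_eq, Metric.mem_closure_iff]
    intro ε hε
    have hp' : p ∈ Metric.closedBall (0 : ℂ) 1 := by simp [hp]
    obtain ⟨i, hi1, hi2⟩ := ((hw (ε / 2) (half_pos hε)).and
      (Metric.tendsto_nhds.1 (hG p hp').2 (ε / 2) (half_pos hε))).exists
    rcases (hF i).mapsTo_sphere (hcont i) hp with h | ⟨s, hs, h⟩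
    · exact ⟨_, Or.inl h, by rw [dist_comm]; linarith⟩
    · obtain ⟨⟨φ, -, hφ⟩, -⟩ := hi1
      obtain ⟨h1, h2⟩ := hφ s hs.2
      refine ⟨c (φ s), Or.inr ⟨_, ⟨zero_le, h1⟩, rfl⟩, ?_⟩
      rw [h, ← dist_eq_norm] at h2
      rw [dist_comm] at hi2
      linarith [dist_triangle (G p) (F i p) (c (φ s))]
  have hz₀b : z₀ ∈ Metric.ball (0 : ℂ) 1 := by simpa using hz₀
  have hz₀c := Metric.ball_subset_closedBall hz₀b
  have hGz₀ : G z₀ ∉ E := by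
    intro hmem
    obtain ⟨i, hi1, hi2, hi3⟩ := ((hw (κ / 3) (by positivity)).and
      ((Metric.tendsto_nhds.1 (hG z₀ hz₀c).2 (κ / 3) (by positivity)).and hbase)).exists
    rw [dist_eq_norm] at hi2
    rcases hmem with h | ⟨t, ht, h⟩
    · linarith [hi3 _ (Or.inl h)]
    · obtain ⟨s, hs, hst⟩ := hi1.2 t ht.2
      have h1 := hi3 _ (Or.inr ⟨s, ⟨zero_le, hs⟩, rfl⟩)
      rw [← h] at hi2
      have e : F i z₀ - c' i s = (F i z₀ - c t) - (c' i s - c t) := by ring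
      rw [e] at h1
      linarith [norm_sub_le (F i z₀ - c t) (c' i s - c t)]
  have hnc : ¬ ∃ a, ∀ z ∈ Metric.ball (0 : ℂ) 1, G z = a := by
    rintro ⟨a, ha⟩
    have h1 : Tendsto (fun s : ℝ => G ((s : ℂ) * 1)) (𝓝[<] 1) (𝓝 (G 1)) :=
      tendsto_comp_ofReal_mul hGc (by simp)
    have h2 : Tendsto (fun s : ℝ => G ((s : ℂ) * 1)) (𝓝[<] 1) (𝓝 a) := by
      refine tendsto_const_nhds.congr' ?_
      filter_upwards [eventually_mem_Ioo_zero_one] with s hs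
      rw [ha _ (mul_mem_ball (by simp) hs)]
    have h3 := tendsto_nhds_unique h1 h2
    refine hGz₀ ?_
    rw [ha z₀ hz₀b, ← h3]
    exact hsph 1 (by simp)
  have hinj : InjOn G (Metric.ball 0 1) := injOn_of_tendstoUniformlyOn Metric.isOpen_ball hballpre
    hunifb hd hGd (.of_forall fun i => (hF i).bijOn.injOn) hnc
  have hopen : IsOpen (G '' Metric.ball 0 1) := isOpen_image_of_injOn Metric.isOpen_ball hGd hinj
  have hGball : G '' Metric.ball 0 1 ⊆ Metric.ball 0 1 := by
    have h1 : G '' Metric.ball 0 1 ⊆ interior (Metric.closedBall 0 1) := by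
      refine interior_maximal ?_ hopen
      rintro _ ⟨z, hz, rfl⟩
      exact (hG z (Metric.ball_subset_closedBall hz)).1
    rwa [interior_closedBall (0 : ℂ) one_ne_zero] at h1
  have hGne : ∀ z ∈ Metric.ball (0 : ℂ) 1, G z ∉ c '' Icc 0 T := by
    rintro z hz ⟨t, ht, hzt⟩
    -- the point of the approximating arc nearest to `c t`
    have hmin : ∀ i, ∃ s ∈ Icc 0 (T' i), IsMinOn (fun s => ‖c' i s - c t‖) (Icc 0 (T' i)) s := by
      intro i
      have := (hc' i).continuous
      exact isCompact_Icc.exists_isMinOn ⟨0, le_rfl, zero_le⟩ (by fun_prop)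
    choose s hs hsmin using hmin
    have hsc : Tendsto (fun i => c' i (s i)) l (𝓝 (c t)) := by
      rw [Metric.tendsto_nhds]
      intro ε hε
      filter_upwards [hw (ε / 2) (half_pos hε)] with i hi
      obtain ⟨s', hs', hle⟩ := hi.2 t ht.2
      have h1 : ‖c' i (s i) - c t‖ ≤ ‖c' i s' - c t‖ := hsmin i ⟨zero_le, hs'⟩
      rw [dist_eq_norm]
      linarith
    rcases ne_or_eq_of_tendstoUniformlyOn Metric.isOpen_ball hballpre hunifb hd hGd hsc
      (.of_forall fun i z hz h => ((hF i).bijOn.mapsTo hz).2 ⟨s i, hs i, h.symm⟩) with h | h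
    · exact h z hz hzt.symm
    · exact hnc ⟨_, h⟩
  refine ⟨G, hunif, hGc, hGd, fun z hz => ⟨hGball ⟨z, hz, rfl⟩, hGne z hz⟩, hinj, ?_⟩
  refine hpre.subset_left_of_subset_union hopen (v := (G '' Metric.closedBall 0 1)ᶜ)
    ((isCompact_closedBall (0 : ℂ) 1).image_of_continuousOn hGc).isClosed.isOpen_compl ?_ ?_
    ⟨G z₀, ⟨hGball ⟨z₀, hz₀b, rfl⟩, hGne z₀ hz₀b⟩, ⟨z₀, hz₀b, rfl⟩⟩
  · exact disjoint_compl_right.mono_left (image_mono Metric.ball_subset_closedBall)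
  · intro w hw
    by_cases hwG : w ∈ G '' Metric.closedBall 0 1
    · obtain ⟨p, hp, rfl⟩ := hwG
      left
      refine ⟨p, ?_, rfl⟩
      by_contra hpb
      have hp1 : ‖p‖ ≤ 1 := by simpa using hp
      have hp2 : 1 ≤ ‖p‖ := by simpa using hpb
      rcases hsph p (le_antisymm hp1 hp2) with h | h
      · have h1 : ‖G p‖ = 1 := by simpa using h
        have h2 : ‖G p‖ < 1 := by simpa using hw.1
        linarith
      · exact hw.2 h
    · exact Or.inr hwG

/-! ### The preimage of the tip -/

namespace IsDiskArc

variable {c : ℝ≥0 → ℂ} {T : ℝ≥0}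

theorem exists_lt_forall_mem_ball (hc : IsDiskArc c T) (hT : 0 < T) {ε : ℝ} (hε : 0 < ε) :
    ∃ m < T, ∀ t ∈ Icc m T, c t ∈ Metric.ball (c T) ε := by
  have h := hc.continuous.continuousAt.eventually (Metric.ball_mem_nhds (c T) hε)
  obtain ⟨m, hm, hmT⟩ := (mem_nhdsLE_iff_exists_Ioc_subset' hT).1 (mem_nhdsWithin_of_mem_nhds h)
  obtain ⟨k, hk, hkT⟩ := exists_between (mem_Iio.1 hm)
  exact ⟨k, hkT, fun t ht => hmT ⟨hk.trans_le ht.1, ht.2⟩⟩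

/-- Times are taken to be real for the separation theorems on arcs. -/
theorem real_param (hc : IsDiskArc c T) {a b : ℝ≥0} (hb : b ≤ T) :
    ContinuousOn (fun t : ℝ => c t.toNNReal) (Icc a b) ∧
    InjOn (fun t : ℝ => c t.toNNReal) (Icc a b) ∧
    (fun t : ℝ => c t.toNNReal) '' Icc a b = c '' Icc a b := by
  refine ⟨(hc.continuous.comp continuous_real_toNNReal).continuousOn, fun s hs t ht h => ?_, ?_⟩
  · have hs0 : 0 ≤ s := a.2.trans hs.1
    have ht0 : 0 ≤ t := a.2.trans ht.1
    have h1 := hc.injOn ⟨zero_le, (Real.toNNReal_le_iff_le_coe.2 hs.2).trans hb⟩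
      ⟨zero_le, (Real.toNNReal_le_iff_le_coe.2 ht.2).trans hb⟩ h
    rwa [Real.toNNReal_eq_toNNReal_iff hs0 ht0] at h1
  · ext z
    constructor
    · rintro ⟨t, ht, rfl⟩
      exact ⟨t.toNNReal, ⟨NNReal.le_toNNReal_of_coe_le ht.1,
        Real.toNNReal_le_iff_le_coe.2 ht.2⟩, rfl⟩
    · rintro ⟨t, ht, rfl⟩
      exact ⟨t, ⟨NNReal.coe_le_coe.2 ht.1, NNReal.coe_le_coe.2 ht.2⟩, by simp⟩

/-- Points near the tip of the arc are connected near the tip off the arc: neither the end piece of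
the arc nor the rest of it together with a circle around the tip separates them. -/
theorem exists_connected_near_tip (hc : IsDiskArc c T) (hT : 0 < T) {ε : ℝ} (hε : 0 < ε) :
    ∃ δ > 0, ∀ z ∈ Metric.ball (0 : ℂ) 1 \ c '' Icc 0 T, ∀ w ∈ Metric.ball (0 : ℂ) 1 \ c '' Icc 0 T,
      z ∈ Metric.ball (c T) δ → w ∈ Metric.ball (c T) δ →
      ∃ S ⊆ Metric.ball (0 : ℂ) 1 \ c '' Icc 0 T, IsPreconnected S ∧ z ∈ S ∧ w ∈ S ∧
        S ⊆ Metric.ball (c T) ε := by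
  obtain ⟨r, hr, hball⟩ := Metric.isOpen_iff.1 Metric.isOpen_ball _ (hc.mem_ball T hT le_rfl)
  obtain ⟨e, he, heε, her⟩ : ∃ e > 0, e ≤ ε ∧ e ≤ r :=
    ⟨min ε r, lt_min hε hr, min_le_left _ _, min_le_right _ _⟩
  obtain ⟨m, hmT, hm⟩ := hc.exists_lt_forall_mem_ball hT he
  have hK : IsCompact (c '' Icc 0 m) := isCompact_Icc.image hc.continuous
  have hpK : c T ∉ c '' Icc 0 m := by
    rintro ⟨t, ht, h⟩
    have := hc.injOn ⟨zero_le, ht.2.trans hmT.le⟩ ⟨zero_le, le_rfl⟩ h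
    rw [this] at ht
    exact hmT.not_ge ht.2
  obtain ⟨d, hd, hdball⟩ := Metric.isOpen_iff.1 hK.isClosed.isOpen_compl _ hpK
  refine ⟨min d e, lt_min hd he, fun z hz w hw hzδ hwδ => ?_⟩
  have hsplit : c '' Icc m T ∪ c '' Icc 0 m = c '' Icc 0 T := by
    rw [← image_union, union_comm, Icc_union_Icc_eq_Icc zero_le hmT.le]
  have h₁ : ConnectedOff (c '' Icc m T) z w := by
    obtain ⟨h1, h2, h3⟩ := hc.real_param (a := m) le_rfl
    rw [← h3]
    refine connectedOff_arc (NNReal.coe_le_coe.2 hmT.le) h1 h2 ?_ ?_ <;> rw [h3]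
    · exact fun h => hz.2 (hsplit ▸ Or.inl h)
    · exact fun h => hw.2 (hsplit ▸ Or.inl h)
  have h₂ : ConnectedOff (Metric.sphere (c T) e ∪ c '' Icc 0 m) z w := by
    refine ⟨Metric.ball (c T) (min d e), fun u hu hu' => ?_,
      (convex_ball _ _).isPreconnected, hzδ, hwδ⟩
    rcases hu' with hu' | hu'
    · have h1 : dist u (c T) < e := hu.trans_le (min_le_right _ _)
      have h2 : dist u (c T) = e := hu'
      linarith
    · exact hdball (Metric.ball_subset_ball (min_le_left _ _) hu) hu'
  have hinter : c '' Icc m T ∩ (Metric.sphere (c T) e ∪ c '' Icc 0 m) = {c m} := by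
    refine Subset.antisymm ?_ (singleton_subset_iff.2
      ⟨⟨m, ⟨le_rfl, hmT.le⟩, rfl⟩, Or.inr ⟨m, ⟨zero_le, le_rfl⟩, rfl⟩⟩)
    rintro _ ⟨⟨t, ht, rfl⟩, h | ⟨s, hs, h⟩⟩
    · have h1 : dist (c t) (c T) < e := hm t ht
      have h2 : dist (c t) (c T) = e := h
      linarith
    · have := hc.injOn ⟨zero_le, hs.2.trans hmT.le⟩ ⟨zero_le, ht.2⟩ h
      rw [this] at hs
      rw [le_antisymm hs.2 ht.1]
      rfl
  obtain ⟨S, hSE, hS, hzS, hwS⟩ := h₁.union (isCompact_Icc.image hc.continuous)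
    ((isCompact_sphere _ _).union hK) (by rw [hinter]; exact isPreconnected_singleton) h₂
  have hSball : S ⊆ Metric.ball (c T) e := hS.subset_ball_of_disjoint_sphere
    (fun u hu h => hSE hu (Or.inr (Or.inl h))) hzS (Metric.ball_subset_ball (min_le_right _ _) hzδ)
  refine ⟨S, fun u hu => ⟨hball (Metric.ball_subset_ball her (hSball hu)), fun h => ?_⟩, hS, hzS,
    hwS, hSball.trans (Metric.ball_subset_ball heε)⟩
  rw [← hsplit] at h
  rcases h with h | h
  · exact hSE hu (Or.inl h)
  · exact hSE hu (Or.inr (Or.inr h))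

theorem tip_mem_closure (hc : IsDiskArc c T) (hT : 0 < T) :
    c T ∈ closure (Metric.ball (0 : ℂ) 1 \ c '' Icc 0 T) := by
  rw [Metric.mem_closure_iff]
  intro ε hε
  obtain ⟨r, hr, hball⟩ := Metric.isOpen_iff.1 Metric.isOpen_ball _ (hc.mem_ball T hT le_rfl)
  obtain ⟨e, he, heε, her⟩ : ∃ e > 0, e < ε ∧ e < r :=
    ⟨min ε r / 2, by positivity, (half_lt_self (by positivity)).trans_le (min_le_left _ _),
      (half_lt_self (by positivity)).trans_le (min_le_right _ _)⟩
  obtain ⟨m, hmT, hm⟩ := hc.exists_lt_forall_mem_ball hT he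
  obtain ⟨h1, h2, h3⟩ := hc.real_param (a := 0) hmT.le
  have hns := not_sphere_subset_arc (p := c T) (NNReal.coe_le_coe.2 (zero_le (a := m))) h1 h2 (by
    rw [h3]
    rintro ⟨t, ht, h⟩
    have := hc.injOn ⟨zero_le, ht.2.trans hmT.le⟩ ⟨zero_le, le_rfl⟩ h
    rw [this] at ht
    exact hmT.not_ge ht.2) he
  rw [h3] at hns
  obtain ⟨z, hz, hzc⟩ := not_subset.1 hns
  have hzd : dist z (c T) = e := hz
  refine ⟨z, ⟨hball (by rw [Metric.mem_ball]; linarith), ?_⟩, by rw [dist_comm]; linarith⟩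
  rintro ⟨t, ht, rfl⟩
  rcases le_total m t with h | h
  · have h1 : dist (c t) (c T) < e := hm t ⟨h, ht.2⟩
    linarith
  · exact hzc ⟨t, ⟨zero_le, h⟩, rfl⟩

end IsDiskArc

/-- A holomorphic function continuous on the closed disk does not take a value it omits at the
centre on a whole boundary arc: finitely many rotations of the arc cover the circle, and the
product of the rotated functions would vanish. -/
theorem exists_sphere_ne {F : ℂ → ℂ} (hd : DifferentiableOn ℂ F (Metric.ball 0 1))
    (hcont : ContinuousOn F (Metric.closedBall 0 1)) {p : ℂ} (h0 : F 0 ≠ p) {O : Set ℂ}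
    (hO : IsOpen O) {q : ℂ} (hq : ‖q‖ = 1) (hqO : q ∈ O) : ∃ z, ‖z‖ = 1 ∧ z ∈ O ∧ F z ≠ p := by
  by_contra! hcon
  have hnhds : ∀ θ ∈ Metric.sphere (0 : ℂ) 1, {z | q / θ * z ∈ O} ∈ 𝓝 θ := by
    intro θ hθ
    have hθ0 : θ ≠ 0 := by rintro rfl; simp at hθ
    refine (hO.preimage (continuous_const.mul continuous_id)).mem_nhds ?_
    simpa [hθ0] using hqO
  obtain ⟨t, ht, hcover⟩ := (isCompact_sphere (0 : ℂ) 1).elim_nhds_subcover _ hnhds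
  have hrot : ∀ θ ∈ t, ∀ z : ℂ, ‖q / θ * z‖ = ‖z‖ := fun θ hθ z => by
    have : ‖θ‖ = 1 := by simpa using ht θ hθ
    rw [norm_mul, norm_div, hq, this]; simp
  let H : ℂ → ℂ := fun z => ∏ θ ∈ t, (F (q / θ * z) - p)
  have hH : DiffContOnCl ℂ H (Metric.ball 0 1) := by
    refine ⟨DifferentiableOn.fun_finsetProd fun θ hθ => ?_, ?_⟩
    · refine DifferentiableOn.sub_const (hd.comp (by fun_prop) fun z hz => ?_) _
      rw [mem_ball_zero_iff] at hz ⊢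
      rwa [hrot θ hθ]
    · rw [closure_ball _ one_ne_zero]
      refine continuousOn_finsetProd _ fun θ hθ => ?_
      refine ContinuousOn.sub (hcont.comp (by fun_prop) fun z hz => ?_) continuousOn_const
      rw [mem_closedBall_zero_iff] at hz ⊢
      rwa [hrot θ hθ]
  have hbound := Complex.norm_le_of_forall_mem_frontier_norm_le Metric.isBounded_ball hH (C := 0)
    (fun z hz => by
      rw [frontier_ball _ one_ne_zero] at hz
      obtain ⟨θ, hθ, hzθ⟩ := mem_iUnion₂.1 (hcover hz)
      have : F (q / θ * z) - p = 0 := by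
        rw [hcon _ ?_ hzθ, sub_self]
        rw [hrot θ hθ]
        simpa using hz
      rw [norm_le_zero_iff]
      exact Finset.prod_eq_zero hθ this) (subset_closure (Metric.mem_ball_self one_pos))
  rw [norm_le_zero_iff, Finset.prod_eq_zero_iff] at hbound
  obtain ⟨θ, -, hθ⟩ := hbound
  rw [mul_zero, sub_eq_zero] at hθ
  exact h0 hθ

/-- The signed distance of `z` from the line through `a` and `b`, up to a positive factor. -/
noncomputable def side (a b z : ℂ) : ℝ := ((z - a) * (starRingEnd ℂ) (b - a)).im

theorem continuous_side (a b : ℂ) : Continuous (side a b) := by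
  unfold side
  exact Complex.continuous_im.comp (by fun_prop)

theorem side_circle {a b z : ℂ} (ha : ‖a‖ = 1) (hb : ‖b‖ = 1) (hz : ‖z‖ = 1) :
    (side a b z : ℂ) * (2 * Complex.I) = (z - a) * (a - b) * (z - b) / (z * a * b) := by
  have hconj : ∀ u : ℂ, ‖u‖ = 1 → (starRingEnd ℂ) u = u⁻¹ := fun u hu =>
    (Complex.inv_eq_conj hu).symm
  have hne : ∀ u : ℂ, ‖u‖ = 1 → u ≠ 0 := fun u hu h => by simp [h] at hu
  have h1 := Complex.sub_conj ((z - a) * (starRingEnd ℂ) (b - a))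
  have ha0 := hne a ha
  have hb0 := hne b hb
  have hz0 := hne z hz
  have h2 : (side a b z : ℂ) * (2 * Complex.I) = (z - a) * (starRingEnd ℂ) (b - a) -
      (starRingEnd ℂ) ((z - a) * (starRingEnd ℂ) (b - a)) := by
    rw [h1, side]; push_cast; ring
  rw [h2]
  simp only [map_mul, map_sub, hconj a ha, hconj b hb, hconj z hz, map_inv₀, inv_inv]
  field_simp
  ring

/-- Two chords of the unit circle separate each other's endpoints simultaneously. -/
theorem side_mul_side {a b p q : ℂ} (ha : ‖a‖ = 1) (hb : ‖b‖ = 1) (hp : ‖p‖ = 1) (hq : ‖q‖ = 1) :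
    side p q a * side p q b * ‖a - b‖ ^ 2 = side a b p * side a b q * ‖p - q‖ ^ 2 := by
  have hne : ∀ u : ℂ, ‖u‖ = 1 → u ≠ 0 := fun u hu h => by simp [h] at hu
  have ha0 := hne a ha
  have hb0 := hne b hb
  have hp0 := hne p hp
  have hq0 := hne q hq
  have hsq : ∀ u v : ℂ, ‖u‖ = 1 → ‖v‖ = 1 → ((‖u - v‖ : ℝ) : ℂ) ^ 2 = -(u - v) ^ 2 / (u * v) := by
    intro u v hu hv
    have hu0 := hne u hu
    have hv0 := hne v hv
    rw [← Complex.mul_conj', map_sub, ← Complex.inv_eq_conj hu, ← Complex.inv_eq_conj hv]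
    field_simp
    ring
  have hI : (2 * Complex.I) ^ 2 ≠ 0 := by simp
  have key : ((side p q a * side p q b * ‖a - b‖ ^ 2 : ℝ) : ℂ) * (2 * Complex.I) ^ 2 =
      ((side a b p * side a b q * ‖p - q‖ ^ 2 : ℝ) : ℂ) * (2 * Complex.I) ^ 2 := by
    push_cast
    rw [hsq a b ha hb, hsq p q hp hq]
    have e1 : ∀ x y w : ℂ, x * y * w * (2 * Complex.I) ^ 2 =
      (x * (2 * Complex.I)) * (y * (2 * Complex.I)) * w := fun x y w => by ring
    rw [e1, e1, side_circle hp hq ha, side_circle hp hq hb, side_circle ha hb hp,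
      side_circle ha hb hq]
    field_simp
    ring
  exact_mod_cast mul_right_cancel₀ hI key

theorem mem_segment_of_side_eq_zero {p q u : ℂ} (hp : ‖p‖ = 1) (hq : ‖q‖ = 1) (hpq : p ≠ q)
    (hu : ‖u‖ < 1) (h : side p q u = 0) : u ∈ segment ℝ p q := by
  have hqp : q - p ≠ 0 := sub_ne_zero.2 hpq.symm
  set D := Complex.normSq (q - p) with hD
  have hDpos : 0 < D := Complex.normSq_pos.2 hqp
  set k := ((u - p) * (starRingEnd ℂ) (q - p)).re / D with hk
  have huk : u = p + k * (q - p) := by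
    have h1 : (u - p) * (starRingEnd ℂ) (q - p) = ((k * D : ℝ) : ℂ) := by
      apply Complex.ext
      · rw [Complex.ofReal_re, hk, div_mul_cancel₀ _ hDpos.ne']
      · rw [Complex.ofReal_im]; exact h
    have h2 : (D : ℂ) = (q - p) * (starRingEnd ℂ) (q - p) := (Complex.mul_conj _).symm
    push_cast at h1
    rw [h2, ← mul_assoc] at h1
    have h3 : (starRingEnd ℂ) (q - p) ≠ 0 := (map_ne_zero _).2 hqp
    have := mul_right_cancel₀ h3 h1
    linear_combination this
  have hnsq : ∀ z : ℂ, ‖z‖ ^ 2 = z.re ^ 2 + z.im ^ 2 := fun z => by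
    rw [Complex.sq_norm, Complex.normSq_apply]; ring
  have hu2 : ‖u‖ ^ 2 = 1 - k * (1 - k) * D := by
    have e1 := hnsq p
    have e2 := hnsq q
    rw [hp] at e1
    rw [hq] at e2
    rw [hnsq u, huk, hD, Complex.normSq_apply]
    simp
    linear_combination (-(1 - k)) * e1 - k * e2
  have hlt : ‖u‖ ^ 2 < 1 := by nlinarith [norm_nonneg u]
  have hkk : 0 < k * (1 - k) := by
    by_contra! hle
    nlinarith
  have hk0 : 0 < k := by
    by_contra! hle
    nlinarith
  have hk1 : k < 1 := by
    by_contra! hle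
    nlinarith
  refine ⟨1 - k, k, by linarith, hk0.le, by ring, ?_⟩
  rw [huk]
  simp only [Complex.real_smul]
  push_cast
  ring

theorem exists_side_pos_neg {a b : ℂ} (ha : ‖a‖ = 1) (hb : ‖b‖ = 1) (hab : a ≠ b) :
    (∃ z, ‖z‖ = 1 ∧ 0 < side a b z) ∧ ∃ z, ‖z‖ = 1 ∧ side a b z < 0 := by
  have hba : b - a ≠ 0 := sub_ne_zero.2 hab.symm
  set d := ‖b - a‖ with hd
  have hdpos : 0 < d := norm_pos_iff.2 hba
  set s := (a * (starRingEnd ℂ) (b - a)).im with hs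
  have hnsq : ∀ z : ℂ, ‖z‖ ^ 2 = z.re ^ 2 + z.im ^ 2 := fun z => by
    rw [Complex.sq_norm, Complex.normSq_apply]; ring
  have hsd : |s| < d := by
    refine abs_lt_of_sq_lt_sq ?_ hdpos.le
    have e1 := hnsq a
    have e2 := hnsq b
    rw [ha] at e1
    rw [hb] at e2
    have e3 := hnsq (b - a)
    rw [← hd] at e3
    simp only [Complex.sub_re, Complex.sub_im] at e3
    have e4 : s = a.im * b.re - a.re * b.im := by rw [hs]; simp; ring
    set r := a.re * b.re + a.im * b.im with hr
    have e5 : s ^ 2 = 1 - r ^ 2 := by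
      rw [e4, hr]
      linear_combination (-(b.re ^ 2 + b.im ^ 2)) * e1 - e2
    have e6 : d ^ 2 = 2 - 2 * r := by rw [e3, hr]; linear_combination (-1 : ℝ) * e1 - e2
    have hd2 : 0 < d ^ 2 := by positivity
    nlinarith
  have hdC : (d : ℂ) ≠ 0 := by exact_mod_cast hdpos.ne'
  have hmul : (b - a) / d * (starRingEnd ℂ) (b - a) = d := by
    rw [div_mul_eq_mul_div, Complex.mul_conj', ← hd]
    field_simp
  have hz : ∀ k : ℂ, (side a b (k * ((b - a) / d))) = k.im * d - s := by
    intro k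
    have : (k * ((b - a) / d) - a) * (starRingEnd ℂ) (b - a) =
        k * d - a * (starRingEnd ℂ) (b - a) := by
      rw [sub_mul, mul_assoc, hmul]
    rw [side, this, Complex.sub_im, ← hs]
    simp
  have hn : ‖(b - a) / d‖ = 1 := by
    rw [norm_div, Complex.norm_real, Real.norm_eq_abs, abs_of_pos hdpos, ← hd, div_self hdpos.ne']
  have habs := abs_lt.1 hsd
  refine ⟨⟨Complex.I * ((b - a) / d), by simp [hn, -Complex.norm_div], ?_⟩,
    ⟨-Complex.I * ((b - a) / d), by simp [hn, -Complex.norm_div], ?_⟩⟩ <;> rw [hz] <;> simp <;> linarith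

/-- The tip of the arc has only one preimage under the boundary extension of a uniformizer. If it
had two, connected sets joining them inside the disk would be mapped close to the tip, whereas they
have to cross a fixed chord that avoids the preimages of the tip. -/
theorem IsUniformizer.eq_of_map_eq_tip {c : ℝ≥0 → ℂ} {T : ℝ≥0} (hc : IsDiskArc c T) (hT : 0 < T)
    {F : ℂ → ℂ} (hF : IsUniformizer (c '' Icc 0 T) F)
    (hcont : ContinuousOn F (Metric.closedBall 0 1)) {a b : ℂ} (ha : ‖a‖ = 1) (hb : ‖b‖ = 1)
    (hFa : F a = c T) (hFb : F b = c T) : a = b := by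
  by_contra hab
  have htip : c T ∈ c '' Icc 0 T := ⟨T, ⟨zero_le, le_rfl⟩, rfl⟩
  have hne : ∀ z ∈ Metric.ball (0 : ℂ) 1, F z ≠ c T := fun z hz h =>
    (hF.bijOn.mapsTo hz).2 (h ▸ htip)
  obtain ⟨⟨z₁, hz₁, hs₁⟩, ⟨z₂, hz₂, hs₂⟩⟩ := exists_side_pos_neg ha hb hab
  obtain ⟨p, hp, hsp, hFp⟩ := exists_sphere_ne hF.differentiableOn hcont (hne 0 (by simp))
    (isOpen_lt continuous_const (continuous_side a b)) hz₁ hs₁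
  obtain ⟨q, hq, hsq, hFq⟩ := exists_sphere_ne hF.differentiableOn hcont (hne 0 (by simp))
    (isOpen_lt (continuous_side a b) continuous_const) hz₂ hs₂
  have hsp' : 0 < side a b p := hsp
  have hsq' : side a b q < 0 := hsq
  have hpq : p ≠ q := by rintro rfl; linarith
  have hsign : side p q a * side p q b < 0 := by
    have h1 := side_mul_side ha hb hp hq
    have h2 : 0 < ‖a - b‖ ^ 2 := by have := norm_pos_iff.2 (sub_ne_zero.2 hab); positivity
    have h3 : 0 < ‖p - q‖ ^ 2 := by have := norm_pos_iff.2 (sub_ne_zero.2 hpq); positivity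
    have h4 : side a b p * side a b q < 0 := mul_neg_of_pos_of_neg hsp' hsq'
    by_contra! hle
    nlinarith [mul_nonneg hle h2.le, mul_neg_of_neg_of_pos h4 h3]
  have hsegball : segment ℝ p q ⊆ Metric.closedBall 0 1 :=
    (convex_closedBall (0 : ℂ) 1).segment_subset (by simp [hp]) (by simp [hq])
  have hsegne : ∀ z ∈ segment ℝ p q, F z ≠ c T := by
    intro z hz
    by_cases hzp : z = p
    · rw [hzp]; exact hFp
    by_cases hzq : z = q
    · rw [hzq]; exact hFq
    refine hne z ?_
    have hopen : z ∈ openSegment ℝ p q :=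
      mem_openSegment_of_ne_left_right (Ne.symm hzp) (Ne.symm hzq) hz
    have := (strictConvex_closedBall ℝ (0 : ℂ) 1).openSegment_subset
      (show p ∈ Metric.closedBall (0 : ℂ) 1 by simp [hp])
      (show q ∈ Metric.closedBall (0 : ℂ) 1 by simp [hq]) hpq hopen
    rwa [interior_closedBall _ one_ne_zero] at this
  obtain ⟨ε, hε, hεle⟩ : ∃ ε > 0, ∀ z ∈ segment ℝ p q, ε ≤ ‖F z - c T‖ := by
    have hcomp : IsCompact (segment ℝ p q) := by
      rw [segment_eq_image_lineMap]
      exact isCompact_Icc.image AffineMap.lineMap_continuous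
    obtain ⟨z, hz, hmin⟩ := hcomp.exists_isMinOn ⟨p, left_mem_segment ℝ p q⟩
      (f := fun z => ‖F z - c T‖) ((hcont.mono hsegball).sub continuousOn_const).norm
    exact ⟨_, norm_pos_iff.2 (sub_ne_zero.2 (hsegne z hz)), fun w hw => hmin hw⟩
  obtain ⟨δ, hδ, hloc⟩ := hc.exists_connected_near_tip hT hε
  have hac : a ∈ Metric.closedBall (0 : ℂ) 1 := by simp [ha]
  have hbc : b ∈ Metric.closedBall (0 : ℂ) 1 := by simp [hb]
  have ev1 : ∀ᶠ s : ℝ in 𝓝[<] 1, F ((s : ℂ) * a) ∈ Metric.ball (c T) δ := by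
    have := tendsto_comp_ofReal_mul hcont hac
    rw [hFa] at this
    exact this.eventually (Metric.ball_mem_nhds _ hδ)
  have ev2 : ∀ᶠ s : ℝ in 𝓝[<] 1, F ((s : ℂ) * b) ∈ Metric.ball (c T) δ := by
    have := tendsto_comp_ofReal_mul hcont hbc
    rw [hFb] at this
    exact this.eventually (Metric.ball_mem_nhds _ hδ)
  have ev3 : ∀ᶠ s : ℝ in 𝓝[<] 1, side p q (s * a) * side p q (s * b) < 0 :=
    ((((continuous_side p q).tendsto a).comp (tendsto_ofReal_mul a)).mul
      (((continuous_side p q).tendsto b).comp (tendsto_ofReal_mul b))).eventually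
        (gt_mem_nhds hsign)
  obtain ⟨s, hs1, hs2, hs3, hs4⟩ :=
    (ev1.and (ev2.and (ev3.and eventually_mem_Ioo_zero_one))).exists
  have hsa := mul_mem_ball hac hs4
  have hsb := mul_mem_ball hbc hs4
  obtain ⟨S, hSsub, hS, haS, hbS, hSball⟩ := hloc _ (hF.bijOn.mapsTo hsa) _ (hF.bijOn.mapsTo hsb)
    hs1 hs2
  obtain ⟨g, hg, hgF, hFg, hgd⟩ := hF.exists_inverse
  have hL : IsPreconnected (g '' S) := hS.image _ (hgd.continuousOn.mono hSsub)
  have haL : (s : ℂ) * a ∈ g '' S := ⟨_, haS, hgF _ hsa⟩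
  have hbL : (s : ℂ) * b ∈ g '' S := ⟨_, hbS, hgF _ hsb⟩
  obtain ⟨_, ⟨v, hv, rfl⟩, hv0⟩ : ∃ u ∈ g '' S, side p q u = 0 := by
    rcases le_total (side p q (s * a)) 0 with h | h
    · exact hL.intermediate_value haL hbL (continuous_side p q).continuousOn ⟨h, by nlinarith⟩
    · exact hL.intermediate_value hbL haL (continuous_side p q).continuousOn ⟨by nlinarith, h⟩
  have hgv : g v ∈ Metric.ball (0 : ℂ) 1 := hg.mapsTo (hSsub hv)
  have h1 := hεle _ (mem_segment_of_side_eq_zero hp hq hpq (by simpa using hgv) hv0)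
  rw [hFg v (hSsub hv)] at h1
  have h2 := hSball hv
  rw [mem_ball_iff_norm] at h2
  linarith

/-- Near the image of a boundary point with a single preimage, the inverse of a uniformizer is
close to that preimage. -/
theorem IsUniformizer.tendsto_inverse {c : Set ℂ} {F g : ℂ → ℂ} {p a : ℂ}
    (hcont : ContinuousOn F (Metric.closedBall 0 1))
    (hg : MapsTo g (Metric.ball 0 1 \ c) (Metric.ball 0 1))
    (hFg : ∀ w ∈ Metric.ball (0 : ℂ) 1 \ c, F (g w) = w)
    (huniq : ∀ y ∈ Metric.closedBall (0 : ℂ) 1, F y = p → y = a) :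
    Tendsto g (𝓝[Metric.ball 0 1 \ c] p) (𝓝 a) := by
  have hev : ∀ᶠ w in 𝓝[Metric.ball 0 1 \ c] p, w ∈ Metric.ball (0 : ℂ) 1 \ c := self_mem_nhdsWithin
  refine (isCompact_closedBall (0 : ℂ) 1).tendsto_nhds_of_unique_mapClusterPt
    (hev.mono fun w hw => Metric.ball_subset_closedBall (hg hw)) fun y hy hcl => huniq y hy ?_
  obtain ⟨u, hu, huy⟩ := mapClusterPt_iff_ultrafilter.1 hcl
  have h1 : Tendsto (fun w => F (g w)) u (𝓝 (F y)) := by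
    refine (hcont y hy).tendsto.comp (tendsto_nhdsWithin_iff.2 ⟨huy, ?_⟩)
    exact hu (hev.mono fun w hw => Metric.ball_subset_closedBall (hg hw))
  have h2 : Tendsto (fun w => F (g w)) u (𝓝 p) := by
    have h3 : Tendsto (fun w : ℂ => w) u (𝓝 p) := hu.trans nhdsWithin_le_nhds
    exact h3.congr' (hu (hev.mono fun w hw => (hFg w hw).symm))
  exact tendsto_nhds_unique h1 h2

/-- Boundary points in the closure of the slit disk are attained by the boundary extension. -/
theorem IsUniformizer.exists_preimage {c : Set ℂ} {F : ℂ → ℂ} (hF : IsUniformizer c F)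
    (hcont : ContinuousOn F (Metric.closedBall 0 1)) {p : ℂ}
    (hp : p ∈ closure (Metric.ball (0 : ℂ) 1 \ c)) : ∃ a ∈ Metric.closedBall (0 : ℂ) 1, F a = p := by
  have hK := (isCompact_closedBall (0 : ℂ) 1).image_of_continuousOn hcont
  refine closure_minimal ?_ hK.isClosed hp
  rw [← hF.bijOn.image_eq]
  exact image_mono Metric.ball_subset_closedBall

/-! ### The two reference domains in disk coordinates -/

namespace LoewnerCase

/-- The inverse of `toDisk`. -/
noncomputable def fromDisk : LoewnerCase → ℂ → ℂ
  | radial, u => u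
  | chordal, u => 2 * Complex.I * (1 - u) / (1 + u)

/-- The image of the closed domain in the closed disk: all of it, or all of it except the point
`-1` that corresponds to `∞`. -/
def diskImage : LoewnerCase → Set ℂ
  | radial => Metric.closedBall 0 1
  | chordal => Metric.closedBall 0 1 \ {-1}

theorem domain_radial : radial.domain = Metric.ball 0 1 := by
  ext z; simp [domain]

theorem closure_domain_radial : closure radial.domain = Metric.closedBall 0 1 := by
  rw [domain_radial, closure_ball _ one_ne_zero]

theorem closure_domain_chordal : closure chordal.domain = {z | 0 ≤ z.im} :=
  Complex.closure_setOfPred_lt_im 0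

theorem isOpen_domain (G : LoewnerCase) : IsOpen G.domain := by
  cases G
  · rw [domain_radial]; exact Metric.isOpen_ball
  · exact isOpen_lt continuous_const Complex.continuous_im

theorem two_I_add_ne_zero {z : ℂ} (hz : 0 ≤ z.im) : 2 * Complex.I + z ≠ 0 := by
  intro h
  have := congrArg Complex.im h
  simp at this
  linarith

theorem toDisk_chordal_add_one {z : ℂ} (hz : 0 ≤ z.im) :
    chordal.toDisk z + 1 = 4 * Complex.I / (2 * Complex.I + z) := by
  have := two_I_add_ne_zero hz
  simp only [toDisk]
  field_simp
  ring

theorem norm_toDisk_chordal_sq {z : ℂ} (hz : 0 ≤ z.im) :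
    ‖chordal.toDisk z‖ ^ 2 = 1 - 8 * z.im / ‖2 * Complex.I + z‖ ^ 2 := by
  have h0 := norm_pos_iff.2 (two_I_add_ne_zero hz)
  simp only [toDisk, norm_div, div_pow]
  field_simp
  rw [Complex.sq_norm, Complex.sq_norm, Complex.normSq_apply, Complex.normSq_apply]
  simp
  ring

theorem one_add_ne_zero {u : ℂ} (hu : u ≠ -1) : 1 + u ≠ 0 := fun h =>
  hu (by linear_combination h)

theorem im_fromDisk_chordal {u : ℂ} (hu : u ≠ -1) :
    (chordal.fromDisk u).im = 2 * (1 - ‖u‖ ^ 2) / ‖1 + u‖ ^ 2 := by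
  have h0 := norm_pos_iff.2 (one_add_ne_zero hu)
  have h1 : ‖1 + u‖ ^ 2 = Complex.normSq (1 + u) := Complex.sq_norm _
  have h2 : 0 < Complex.normSq (1 + u) := by rw [← h1]; positivity
  rw [h1, Complex.sq_norm]
  simp only [fromDisk, Complex.div_im]
  field_simp
  simp [Complex.normSq_apply]
  ring

theorem toDisk_mem_diskImage (G : LoewnerCase) {z : ℂ} (hz : z ∈ closure G.domain) :
    G.toDisk z ∈ G.diskImage := by
  cases G
  · rwa [closure_domain_radial] at hz
  · rw [closure_domain_chordal] at hz
    have hz' : 0 ≤ z.im := hz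
    refine ⟨?_, fun h => ?_⟩
    · rw [mem_closedBall_zero_iff]
      have h1 := norm_toDisk_chordal_sq hz'
      have h2 : 0 ≤ 8 * z.im / ‖2 * Complex.I + z‖ ^ 2 := by positivity
      nlinarith [norm_nonneg (chordal.toDisk z)]
    · have h1 := toDisk_chordal_add_one hz'
      rw [mem_singleton_iff.1 h, neg_add_cancel] at h1
      have := div_ne_zero (show (4 * Complex.I : ℂ) ≠ 0 by simp) (two_I_add_ne_zero hz')
      exact this h1.symm

theorem toDisk_mem_ball (G : LoewnerCase) {z : ℂ} (hz : z ∈ G.domain) :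
    G.toDisk z ∈ Metric.ball (0 : ℂ) 1 := by
  cases G
  · rwa [domain_radial] at hz
  · have hz' : 0 < z.im := hz
    have h0 := norm_pos_iff.2 (two_I_add_ne_zero hz'.le)
    rw [mem_ball_zero_iff]
    have h1 := norm_toDisk_chordal_sq hz'.le
    have h2 : 0 < 8 * z.im / ‖2 * Complex.I + z‖ ^ 2 := by positivity
    nlinarith [norm_nonneg (chordal.toDisk z)]

theorem ball_subset_diskImage (G : LoewnerCase) : Metric.ball 0 1 ⊆ G.diskImage := by
  cases G
  · exact Metric.ball_subset_closedBall
  · refine fun u hu => ⟨Metric.ball_subset_closedBall hu, ?_⟩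
    rintro rfl
    simp at hu

theorem diskImage_subset_closedBall (G : LoewnerCase) : G.diskImage ⊆ Metric.closedBall 0 1 := by
  cases G
  · exact Subset.rfl
  · exact sdiff_subset

theorem fromDisk_mem_closure (G : LoewnerCase) {u : ℂ} (hu : u ∈ G.diskImage) :
    G.fromDisk u ∈ closure G.domain := by
  cases G
  · rwa [closure_domain_radial]
  · rw [closure_domain_chordal]
    have h1 : ‖u‖ ≤ 1 := by simpa using hu.1
    change 0 ≤ (chordal.fromDisk u).im
    rw [im_fromDisk_chordal hu.2]
    have : 0 ≤ 1 - ‖u‖ ^ 2 := by nlinarith [norm_nonneg u]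
    positivity

theorem fromDisk_mem_domain (G : LoewnerCase) {u : ℂ} (hu : u ∈ Metric.ball (0 : ℂ) 1) :
    G.fromDisk u ∈ G.domain := by
  cases G
  · rwa [domain_radial]
  · have hne : u ≠ -1 := (chordal.ball_subset_diskImage hu).2
    have h1 : ‖u‖ < 1 := by simpa using hu
    change 0 < (chordal.fromDisk u).im
    rw [im_fromDisk_chordal hne]
    have : 0 < 1 - ‖u‖ ^ 2 := by nlinarith [norm_nonneg u]
    have := norm_pos_iff.2 (one_add_ne_zero hne)
    positivity

theorem fromDisk_toDisk (G : LoewnerCase) {z : ℂ} (hz : z ∈ closure G.domain) :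
    G.fromDisk (G.toDisk z) = z := by
  cases G
  · rfl
  · rw [closure_domain_chordal] at hz
    have h0 := two_I_add_ne_zero hz
    have hI : (4 * Complex.I : ℂ) ≠ 0 := by simp
    have h1 : 1 + chordal.toDisk z = 4 * Complex.I / (2 * Complex.I + z) := by
      rw [add_comm]; exact toDisk_chordal_add_one hz
    have h2 : 1 - chordal.toDisk z = 2 * z / (2 * Complex.I + z) := by
      simp only [toDisk]; field_simp; ring
    simp only [fromDisk, h1, h2]
    field_simp
    ring

theorem toDisk_fromDisk (G : LoewnerCase) {u : ℂ} (hu : u ∈ G.diskImage) :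
    G.toDisk (G.fromDisk u) = u := by
  cases G
  · rfl
  · have h0 := one_add_ne_zero hu.2
    have hI : (4 * Complex.I : ℂ) ≠ 0 := by simp
    have h1 : 2 * Complex.I + chordal.fromDisk u = 4 * Complex.I / (1 + u) := by
      simp only [fromDisk]; field_simp; ring
    have h2 : 2 * Complex.I - chordal.fromDisk u = 4 * Complex.I * u / (1 + u) := by
      simp only [fromDisk]; field_simp; ring
    simp only [toDisk, h1, h2]
    field_simp

theorem toDisk_injOn (G : LoewnerCase) : InjOn G.toDisk (closure G.domain) := fun z hz w hw h => by
  rw [← G.fromDisk_toDisk hz, h, G.fromDisk_toDisk hw]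

theorem continuousOn_toDisk (G : LoewnerCase) : ContinuousOn G.toDisk (closure G.domain) := by
  cases G
  · exact continuousOn_id
  · refine ContinuousOn.div (by fun_prop) (by fun_prop) fun z hz => ?_
    rw [closure_domain_chordal] at hz
    exact two_I_add_ne_zero hz

theorem continuousOn_fromDisk (G : LoewnerCase) : ContinuousOn G.fromDisk G.diskImage := by
  cases G
  · exact continuousOn_id
  · exact ContinuousOn.div (by fun_prop) (by fun_prop) fun u hu => one_add_ne_zero hu.2

theorem differentiableOn_toDisk (G : LoewnerCase) : DifferentiableOn ℂ G.toDisk G.domain := by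
  cases G
  · exact differentiableOn_id
  · exact DifferentiableOn.div (by fun_prop) (by fun_prop) fun z hz =>
      two_I_add_ne_zero (le_of_lt hz)

theorem differentiableOn_fromDisk (G : LoewnerCase) :
    DifferentiableOn ℂ G.fromDisk (Metric.ball 0 1) := by
  cases G
  · exact differentiableOn_id
  · exact DifferentiableOn.div (by fun_prop) (by fun_prop) fun u hu =>
      one_add_ne_zero (chordal.ball_subset_diskImage hu).2

theorem toDisk_start (G : LoewnerCase) : G.toDisk G.start = 1 := by
  cases G
  · rfl
  · simp [toDisk, start]

theorem start_mem_closure (G : LoewnerCase) : G.start ∈ closure G.domain := by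
  cases G
  · rw [closure_domain_radial]; simp [start]
  · rw [closure_domain_chordal]; simp [start]

theorem start_notMem_domain (G : LoewnerCase) : G.start ∉ G.domain := by
  cases G <;> simp [start, domain]

theorem toDisk_mem_ball_iff (G : LoewnerCase) {z : ℂ} (hz : z ∈ closure G.domain) :
    G.toDisk z ∈ Metric.ball (0 : ℂ) 1 ↔ z ∈ G.domain :=
  ⟨fun h => by rw [← G.fromDisk_toDisk hz]; exact G.fromDisk_mem_domain h, G.toDisk_mem_ball⟩

theorem bijOn_toDisk (G : LoewnerCase) : BijOn G.toDisk G.domain (Metric.ball 0 1) :=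
  ⟨fun _ hz => G.toDisk_mem_ball hz, G.toDisk_injOn.mono subset_closure, fun _ hu =>
    ⟨_, G.fromDisk_mem_domain hu, G.toDisk_fromDisk (G.ball_subset_diskImage hu)⟩⟩

theorem bijOn_fromDisk (G : LoewnerCase) : BijOn G.fromDisk (Metric.ball 0 1) G.domain :=
  ⟨fun _ hu => G.fromDisk_mem_domain hu, fun _ hu _ hv h => by
    rw [← G.toDisk_fromDisk (G.ball_subset_diskImage hu), h,
      G.toDisk_fromDisk (G.ball_subset_diskImage hv)], fun z hz =>
    ⟨_, G.toDisk_mem_ball hz, G.fromDisk_toDisk (subset_closure hz)⟩⟩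

/-- Undo the centering `LoewnerCase.center`. -/
noncomputable def uncenter : LoewnerCase → ℂ → ℂ → ℂ
  | radial, w, u => w * u
  | chordal, w, u => u + w

/-- `uncenter` in disk coordinates. The formula is also valid at the point `-1`, which corresponds
to `∞`. -/
noncomputable def diskUncenter : LoewnerCase → ℂ → ℂ → ℂ
  | radial, w, u => w * u
  | chordal, w, u => (4 * Complex.I * u - w * (1 + u)) / (4 * Complex.I + w * (1 + u))

/-- The boundary of the domain, where the images of tips lie. -/
def boundary : LoewnerCase → Set ℂ
  | radial => Metric.sphere 0 1
  | chordal => {w | w.im = 0}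

theorem mem_boundary_iff (G : LoewnerCase) {w : ℂ} :
    w ∈ G.boundary ↔ w ∈ closure G.domain ∧ w ∉ G.domain := by
  cases G
  · rw [closure_domain_radial, domain_radial]
    simp [boundary, le_antisymm_iff]
  · rw [closure_domain_chordal]
    simp [boundary, domain, le_antisymm_iff, and_comm]

theorem uncenter_mem_closure (G : LoewnerCase) {w z : ℂ} (hw : w ∈ G.boundary)
    (hz : z ∈ closure G.domain) : G.uncenter w z ∈ closure G.domain := by
  cases G
  · rw [closure_domain_radial] at *
    have : ‖w‖ = 1 := by simpa [boundary] using hw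
    simpa [uncenter, this] using hz
  · rw [closure_domain_chordal] at *
    have h1 : w.im = 0 := hw
    have h2 : 0 ≤ z.im := hz
    simpa [uncenter, h1] using h2

theorem uncenter_mem_domain (G : LoewnerCase) {w z : ℂ} (hw : w ∈ G.boundary)
    (hz : z ∈ G.domain) : G.uncenter w z ∈ G.domain := by
  cases G
  · have : ‖w‖ = 1 := by simpa [boundary] using hw
    simpa [uncenter, this, domain] using hz
  · have h1 : w.im = 0 := hw
    have h2 : 0 < z.im := hz
    simpa [uncenter, h1, domain] using h2

theorem center_uncenter (G : LoewnerCase) {w z : ℂ} (hw : w ∈ G.boundary) :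
    G.center w (G.uncenter w z) = z := by
  cases G
  · have : w ≠ 0 := by rintro rfl; simp [boundary] at hw
    simp [center, uncenter, this]
  · simp [center, uncenter]

theorem uncenter_center (G : LoewnerCase) {w z : ℂ} (hw : w ∈ G.boundary) :
    G.uncenter w (G.center w z) = z := by
  cases G
  · have : w ≠ 0 := by rintro rfl; simp [boundary] at hw
    simp [center, uncenter, this]
  · simp [center, uncenter]

theorem center_mem_domain (G : LoewnerCase) {w z : ℂ} (hw : w ∈ G.boundary)
    (hz : z ∈ G.domain) : G.center w z ∈ G.domain := by
  cases G
  · have : ‖w‖ = 1 := by simpa [boundary] using hw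
    simpa [center, this, domain] using hz
  · have h1 : w.im = 0 := hw
    have h2 : 0 < z.im := hz
    simpa [center, h1, domain] using h2

theorem uncenter_start (G : LoewnerCase) (w : ℂ) : G.uncenter w G.start = w := by
  cases G <;> simp [uncenter, start]

theorem differentiable_uncenter (G : LoewnerCase) (w : ℂ) : Differentiable ℂ (G.uncenter w) := by
  cases G
  · change Differentiable ℂ fun u => w * u
    fun_prop
  · change Differentiable ℂ fun u => u + w
    fun_prop

theorem differentiable_center (G : LoewnerCase) (w : ℂ) : Differentiable ℂ (G.center w) := by
  cases G
  · change Differentiable ℂ fun u => w⁻¹ * u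
    fun_prop
  · change Differentiable ℂ fun u => u - w
    fun_prop

theorem diskUncenter_denom_ne_zero {w u : ℂ} (hw : w.im = 0) (hu : ‖u‖ ≤ 1) :
    4 * Complex.I + w * (1 + u) ≠ 0 := by
  intro h
  have h1 : 4 * Complex.I + w = -(w * u) := by linear_combination h
  have h2 : ‖4 * Complex.I + w‖ ^ 2 ≤ ‖w‖ ^ 2 := by
    rw [h1, norm_neg, norm_mul]
    have := mul_le_mul_of_nonneg_left hu (norm_nonneg w)
    rw [mul_one] at this
    gcongr
  rw [Complex.sq_norm, Complex.sq_norm, Complex.normSq_apply, Complex.normSq_apply] at h2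
  simp [hw] at h2
  linarith

theorem diskUncenter_toDisk (G : LoewnerCase) {w z : ℂ} (hw : w ∈ G.boundary)
    (hz : z ∈ closure G.domain) :
    G.diskUncenter w (G.toDisk z) = G.toDisk (G.uncenter w z) := by
  cases G
  · rfl
  · have hz' := hz
    have h1 := chordal.uncenter_mem_closure hw hz
    have hu : ‖chordal.toDisk z‖ ≤ 1 := by simpa using (chordal.toDisk_mem_diskImage hz).1
    rw [closure_domain_chordal] at hz' h1
    have h2 := two_I_add_ne_zero hz'
    have h3 := two_I_add_ne_zero h1
    have h4 := diskUncenter_denom_ne_zero (w := w) hw hu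
    have h5 : 4 * Complex.I + w * (1 + chordal.toDisk z) =
        4 * Complex.I * (2 * Complex.I + (z + w)) / (2 * Complex.I + z) := by
      rw [add_comm 1, toDisk_chordal_add_one hz', eq_div_iff h2, add_mul, mul_assoc w,
        div_mul_cancel₀ _ h2]
      ring
    have h6 : 4 * Complex.I * chordal.toDisk z - w * (1 + chordal.toDisk z) =
        4 * Complex.I * (2 * Complex.I - (z + w)) / (2 * Complex.I + z) := by
      rw [add_comm 1, toDisk_chordal_add_one hz', eq_div_iff h2, sub_mul, mul_assoc w,
        div_mul_cancel₀ _ h2]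
      simp only [toDisk]
      rw [mul_assoc, div_mul_cancel₀ _ h2]
      ring
    have hI : (4 * Complex.I : ℂ) ≠ 0 := by simp
    simp only [uncenter] at h3
    simp only [diskUncenter, h5, h6, uncenter]
    rw [div_div_div_cancel_right₀ h2, mul_div_mul_left _ _ hI]
    rfl

theorem continuousOn_diskUncenter (G : LoewnerCase) :
    ContinuousOn (fun q : ℂ × ℂ => G.diskUncenter q.1 q.2)
      (G.boundary ×ˢ Metric.closedBall 0 1) := by
  cases G
  · simp only [diskUncenter]; fun_prop
  · refine ContinuousOn.div (by fun_prop) (by fun_prop) fun q hq => ?_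
    exact diskUncenter_denom_ne_zero hq.1 (by simpa using hq.2)

theorem diskUncenter_mapsTo (G : LoewnerCase) {w : ℂ} (hw : w ∈ G.boundary) :
    MapsTo (G.diskUncenter w) (Metric.closedBall 0 1) (Metric.closedBall 0 1) := by
  have hgen : ∀ u ∈ G.diskImage, G.diskUncenter w u ∈ Metric.closedBall (0 : ℂ) 1 := by
    intro u hu
    rw [← G.toDisk_fromDisk hu, G.diskUncenter_toDisk hw (G.fromDisk_mem_closure hu)]
    exact G.diskImage_subset_closedBall
      (G.toDisk_mem_diskImage (G.uncenter_mem_closure hw (G.fromDisk_mem_closure hu)))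
  intro u hu
  cases G
  · exact hgen u hu
  · by_cases h : u = -1
    · have hI : (4 * Complex.I : ℂ) ≠ 0 := by simp
      rw [h]
      simp [diskUncenter]
    · exact hgen u ⟨hu, h⟩

end LoewnerCase

/-! ### Mapping-out functions and their inverses -/

/-- A Julia-type inequality: a holomorphic map of the upper half-plane into its closure that almost
fixes a sequence tending to `∞` along the imaginary axis does not decrease the imaginary part. -/
theorem im_le_im_of_sequence {p : ℂ → ℂ} (hp : DifferentiableOn ℂ p {z | 0 < z.im})
    (hmap : ∀ z, 0 < z.im → 0 ≤ (p z).im) {z : ℕ → ℂ} (hz : ∀ᶠ k in atTop, 0 < (z k).im)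
    (h₁ : Tendsto (fun k => z k - k * Complex.I) atTop (𝓝 0))
    (h₂ : Tendsto (fun k => p (z k) - k * Complex.I) atTop (𝓝 0)) {x : ℂ} (hx : 0 < x.im) :
    x.im ≤ (p x).im := by
  have hinv : Tendsto (fun k : ℕ => (k : ℂ)⁻¹) atTop (𝓝 0) :=
    tendsto_inv₀_cobounded.comp (tendsto_norm_atTop_iff_cobounded.1 (by
      simpa using tendsto_natCast_atTop_atTop (R := ℝ)))
  have hscale : ∀ u : ℕ → ℂ, Tendsto (fun k => u k - k * Complex.I) atTop (𝓝 0) →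
      Tendsto (fun k => u k / k) atTop (𝓝 Complex.I) := by
    intro u hu
    have h3 : Tendsto (fun k => (u k - k * Complex.I) * (k : ℂ)⁻¹ + Complex.I) atTop
        (𝓝 (0 * 0 + Complex.I)) := (hu.mul hinv).add_const _
    rw [zero_mul, zero_add] at h3
    refine h3.congr' ?_
    filter_upwards [eventually_ne_atTop 0] with k hk
    have : (k : ℂ) ≠ 0 := by exact_mod_cast hk
    field_simp
    ring
  have hz' := hscale _ h₁
  have hp' := hscale _ h₂
  have hxk : ∀ y : ℂ, Tendsto (fun k : ℕ => y / k) atTop (𝓝 0) := fun y => by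
    simpa [div_eq_mul_inv] using hinv.const_mul y
  have hd1 := (((hxk (p x)).sub hp').norm.pow 2).mul
    (((Complex.continuous_im.tendsto _).comp hz').const_mul x.im)
  have hd2 := (((Complex.continuous_im.tendsto _).comp hp').const_mul (p x).im).mul
    (((hxk x).sub hz').norm.pow 2)
  have hle := le_of_tendsto_of_tendsto hd1 hd2 ?_
  · simpa using hle
  · filter_upwards [hz, eventually_gt_atTop 0] with k hk hk0
    have hsp := schwarz_pick_upperHalfPlane hp hmap hx hk
    have hkR : (0 : ℝ) < k := by exact_mod_cast hk0
    have hn : ∀ u : ℂ, ‖u / k‖ = ‖u‖ / k := fun u => by simp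
    have hi : ∀ u : ℂ, (u / k).im = u.im / k := fun u => Complex.div_natCast_im u k
    simp only [Function.comp, ← sub_div, hn, hi]
    have e1 : (‖p x - p (z k)‖ / k) ^ 2 * (x.im * ((z k).im / k)) =
        ‖p x - p (z k)‖ ^ 2 * (x.im * (z k).im) / k ^ 3 := by field_simp
    have e2 : (p x).im * ((p (z k)).im / k) * (‖x - z k‖ / k) ^ 2 =
        (p x).im * (p (z k)).im * ‖x - z k‖ ^ 2 / k ^ 3 := by field_simp
    rw [e1, e2]
    gcongr

/-- Uniqueness for the chordal normalization: an injective self-map of the half-plane with a left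
inverse that almost fixes a sequence tending to `∞` is the identity. The Julia-type inequality for
`h` and for `k` makes `h z - z` real, hence constant. -/
theorem eq_self_of_upperHalfPlane {h k : ℂ → ℂ} (hh : DifferentiableOn ℂ h {z | 0 < z.im})
    (hk : DifferentiableOn ℂ k {z | 0 < z.im}) (hhm : ∀ z, 0 < z.im → 0 < (h z).im)
    (hkm : ∀ z, 0 < z.im → 0 < (k z).im) (hkh : ∀ z, 0 < z.im → k (h z) = z) {z : ℕ → ℂ}
    (hz : ∀ᶠ k in atTop, 0 < (z k).im) (h₁ : Tendsto (fun k => z k - k * Complex.I) atTop (𝓝 0))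
    (h₂ : Tendsto (fun k => h (z k) - k * Complex.I) atTop (𝓝 0)) {x : ℂ} (hx : 0 < x.im) :
    h x = x := by
  have hle : ∀ y, 0 < y.im → (h y - y).im = 0 := fun y hy => by
    have a1 := im_le_im_of_sequence hh (fun z hz => (hhm z hz).le) hz h₁ h₂ hy
    have a2 := im_le_im_of_sequence hk (fun z hz => (hkm z hz).le) (z := fun i => h (z i))
      (hz.mono fun i hi => hhm _ hi) h₂
      (h₁.congr' (hz.mono fun i hi => by simp only [hkh _ hi])) (hhm y hy)
    rw [hkh y hy] at a2
    rw [Complex.sub_im]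
    linarith
  have hconst : ∀ y, 0 < y.im → h y - y = h x - x := fun y hy => by
    have hsp := schwarz_pick_upperHalfPlane (q := fun y => h y - y) (hh.sub differentiableOn_id)
      (fun z hz => (hle z hz).ge) hx hy
    simp only [hle x hx, zero_mul] at hsp
    have h4 : 0 < x.im * y.im := mul_pos hx hy
    have h5 : ‖(h x - x) - (h y - y)‖ ^ 2 ≤ 0 := by
      by_contra! hpos
      nlinarith
    have h6 : ‖(h x - x) - (h y - y)‖ = 0 := by
      have := sq_nonneg ‖(h x - x) - (h y - y)‖
      exact pow_eq_zero_iff two_ne_zero |>.1 (le_antisymm h5 this)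
    exact (sub_eq_zero.1 (norm_eq_zero.1 h6)).symm
  have hlim : Tendsto (fun i => h (z i) - z i) atTop (𝓝 0) := by
    have := h₂.sub h₁
    rw [sub_zero] at this
    exact this.congr fun i => by ring
  have hlim' : Tendsto (fun i => h (z i) - z i) atTop (𝓝 (h x - x)) :=
    tendsto_const_nhds.congr' (hz.mono fun i hi => (hconst _ hi).symm)
  exact sub_eq_zero.1 (tendsto_nhds_unique hlim' hlim)

/-- Uniqueness for the radial normalization, by the Schwarz lemma for `h` and for its left inverse
`k`. -/
theorem eq_self_of_ball {h k : ℂ → ℂ} (hh : DifferentiableOn ℂ h (Metric.ball 0 1))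
    (hk : DifferentiableOn ℂ k (Metric.ball 0 1))
    (hhm : MapsTo h (Metric.ball 0 1) (Metric.ball 0 1))
    (hkm : MapsTo k (Metric.ball 0 1) (Metric.ball 0 1))
    (hkh : ∀ z ∈ Metric.ball (0 : ℂ) 1, k (h z) = z) (h0 : h 0 = 0)
    {r : ℝ} (hr : 0 < r) (hd : deriv h 0 = r) {x : ℂ} (hx : x ∈ Metric.ball (0 : ℂ) 1) :
    h x = x := by
  have hzero : (0 : ℂ) ∈ Metric.ball (0 : ℂ) 1 := by simp
  have hk0 : k 0 = 0 := by rw [← h0]; exact (hkh 0 hzero).trans h0.symm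
  have hn1 : ‖deriv h 0‖ ≤ 1 := Complex.norm_deriv_le_one_of_mapsTo_ball hh
    (by rw [h0]; exact hhm.mono_right Metric.ball_subset_closedBall) one_pos
  have hn2 : ‖deriv k 0‖ ≤ 1 := Complex.norm_deriv_le_one_of_mapsTo_ball hk
    (by rw [hk0]; exact hkm.mono_right Metric.ball_subset_closedBall) one_pos
  have hprod : deriv k 0 * deriv h 0 = 1 := by
    have dk : HasDerivAt k (deriv k 0) (h 0) := by
      rw [h0]; exact (hk.differentiableAt (Metric.isOpen_ball.mem_nhds hzero)).hasDerivAt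
    have dh := (hh.differentiableAt (Metric.isOpen_ball.mem_nhds hzero)).hasDerivAt
    have h1 := dk.comp 0 dh
    have h2 : HasDerivAt (k ∘ h) 1 0 := (hasDerivAt_id 0).congr_of_eventuallyEq (by
      filter_upwards [Metric.isOpen_ball.mem_nhds hzero] with z hz using hkh z hz)
    exact h1.unique h2
  have hr1 : r = 1 := by
    rw [hd, Complex.norm_real, Real.norm_eq_abs, abs_of_pos hr] at hn1
    have := congrArg norm hprod
    rw [norm_mul, hd, Complex.norm_real, Real.norm_eq_abs, abs_of_pos hr, norm_one] at this
    nlinarith [norm_nonneg (deriv k 0)]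
  have haff := Complex.affine_of_mapsTo_ball_of_norm_dslope_eq_div (R₂ := 1) hh
    (by rw [h0]; exact hhm.mono_right Metric.ball_subset_closedBall) hzero
    (by rw [dslope_same, hd, hr1]; simp) hx
  simp only [dslope_same, hd, hr1, h0] at haff
  simpa using haff

namespace LoewnerCase

variable {G : LoewnerCase} {K : Set ℂ} {g f : ℂ → ℂ}

/-- A normalization of the inverse of a mapping-out function. In the chordal case it only asks for
one sequence tending to `∞` along the imaginary axis to be almost fixed. -/
def IsNormalizedInverse : LoewnerCase → (ℂ → ℂ) → Prop
  | radial, f => f 0 = 0 ∧ ∃ r : ℝ, 0 < r ∧ deriv f 0 = (r : ℂ)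
  | chordal, f => ∃ z : ℕ → ℂ, (∀ᶠ k in atTop, 0 < (z k).im) ∧
      Tendsto (fun k => z k - k * Complex.I) atTop (𝓝 0) ∧
      Tendsto (fun k => f (z k) - k * Complex.I) atTop (𝓝 0)

theorem IsHull.isOpen_diff (hK : G.IsHull K) : IsOpen (G.domain \ K) :=
  G.isOpen_domain.sdiff hK.isCompact.isClosed

theorem IsMappingOut.exists_inverse (hK : G.IsHull K) (hg : G.IsMappingOut K g) :
    ∃ f : ℂ → ℂ, DifferentiableOn ℂ f G.domain ∧ BijOn f G.domain (G.domain \ K) ∧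
      (∀ z ∈ G.domain, g (f z) = z) ∧ ∀ z ∈ G.domain \ K, f (g z) = z := by
  have hinv := hg.bijOn.invOn_invFunOn
  refine ⟨Function.invFunOn g (G.domain \ K), ?_, hg.bijOn.symm hinv.symm, hinv.2, hinv.1⟩
  have := differentiableOn_leftInverse_of_injOn hK.isOpen_diff hg.differentiableOn
    hg.bijOn.injOn hinv.1
  rwa [hg.bijOn.image_eq] at this

theorem tendsto_natCast_mul_I_cobounded :
    Tendsto (fun k : ℕ => (k : ℂ) * Complex.I) atTop (Bornology.cobounded ℂ) := by
  rw [← tendsto_norm_atTop_iff_cobounded]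
  simpa using tendsto_natCast_atTop_atTop (R := ℝ)

theorem tendsto_cobounded_of_sub {ι : Type*} {l : Filter ι} {u v : ι → ℂ}
    (hu : Tendsto u l (Bornology.cobounded ℂ)) {a : ℂ}
    (huv : Tendsto (fun i => v i - u i) l (𝓝 a)) : Tendsto v l (Bornology.cobounded ℂ) := by
  rw [← tendsto_norm_atTop_iff_cobounded] at *
  have h1 : ∀ᶠ i in l, ‖v i - u i‖ < ‖a‖ + 1 :=
    huv.norm.eventually (gt_mem_nhds (by linarith))
  refine tendsto_atTop_mono' l ?_ (tendsto_atTop_add_const_right l (-(‖a‖ + 1)) hu)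
  filter_upwards [h1] with i hi
  have := norm_sub_norm_le (u i) (v i)
  rw [norm_sub_rev] at this
  linarith

/-- The imaginary axis approaches `∞` inside the complement of the hull. -/
theorem eventually_natCast_mul_I_mem (hK : chordal.IsHull K) :
    ∀ᶠ k : ℕ in atTop, (k : ℂ) * Complex.I ∈ chordal.domain \ K := by
  have h1 : ∀ᶠ k : ℕ in atTop, (k : ℂ) * Complex.I ∈ Kᶜ :=
    tendsto_natCast_mul_I_cobounded (Bornology.isBounded_def.1 hK.isCompact.isBounded)
  filter_upwards [h1, eventually_gt_atTop 0] with k hk hk0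
  exact ⟨by simpa [domain] using hk0, hk⟩

/-- A normalized conformal map of the domain onto the complement of a hull is the inverse of the
mapping-out function. -/
theorem IsMappingOut.comp_eq (hK : G.IsHull K) (hg : G.IsMappingOut K g)
    (hfd : DifferentiableOn ℂ f G.domain) (hf : BijOn f G.domain (G.domain \ K))
    (hn : G.IsNormalizedInverse f) {z : ℂ} (hz : z ∈ G.domain) : g (f z) = z := by
  obtain ⟨f', hf'd, hf', hgf', hf'g⟩ := hg.exists_inverse hK
  have hinv := hf.invOn_invFunOn
  set k := Function.invFunOn f G.domain
  have hkd : DifferentiableOn ℂ k (G.domain \ K) := by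
    have := differentiableOn_leftInverse_of_injOn G.isOpen_domain hfd hf.injOn hinv.1
    rwa [hf.image_eq] at this
  have hkb : BijOn k (G.domain \ K) G.domain := hf.symm hinv.symm
  have hhd : DifferentiableOn ℂ (fun z => g (f z)) G.domain := hg.differentiableOn.comp hfd hf.mapsTo
  have hkd' : DifferentiableOn ℂ (fun z => k (f' z)) G.domain := hkd.comp hf'd hf'.mapsTo
  have hkh : ∀ z ∈ G.domain, k (f' (g (f z))) = z := fun z hz => by
    rw [hf'g _ (hf.mapsTo hz), hinv.1 hz]
  have hhm : ∀ z ∈ G.domain, g (f z) ∈ G.domain := fun z hz => hg.bijOn.mapsTo (hf.mapsTo hz)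
  have hkm : ∀ z ∈ G.domain, k (f' z) ∈ G.domain := fun z hz => hkb.mapsTo (hf'.mapsTo hz)
  cases G
  · obtain ⟨hf0, r, hr, hfr⟩ := hn
    obtain ⟨hg0, s, hs, hgs⟩ := hg.normalized
    rw [domain_radial] at *
    have h0 : (0 : ℂ) ∈ Metric.ball (0 : ℂ) 1 := by simp
    have dg : HasDerivAt g s (f 0) := by
      rw [hf0, ← hgs]
      have hmem : (0 : ℂ) ∈ Metric.ball (0 : ℂ) 1 \ K := ⟨h0, hK.avoidsTarget⟩
      have ho := hK.isOpen_diff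
      rw [domain_radial] at ho
      have := hg.differentiableOn
      rw [domain_radial] at this
      exact (this.differentiableAt (ho.mem_nhds hmem)).hasDerivAt
    have df : HasDerivAt f r 0 := by
      rw [← hfr]
      exact (hfd.differentiableAt (Metric.isOpen_ball.mem_nhds h0)).hasDerivAt
    refine eq_self_of_ball (k := fun z => k (f' z)) hhd hkd' hhm hkm hkh (by simp only [hf0, hg0])
      (r := s * r) (by positivity) ?_ hz
    rw [Complex.ofReal_mul]
    exact (dg.comp 0 df).deriv
  · obtain ⟨u, hu, hu1, hu2⟩ := hn
    have hcob : Tendsto (fun i => f (u i)) atTop (Bornology.cobounded ℂ ⊓ 𝓟 (chordal.domain \ K)) := by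
      refine tendsto_inf.2 ⟨tendsto_cobounded_of_sub tendsto_natCast_mul_I_cobounded hu2,
        tendsto_principal.2 (hu.mono fun i hi => hf.mapsTo hi)⟩
    have h3 := (hg.normalized.comp hcob).add hu2
    rw [add_zero] at h3
    exact eq_self_of_upperHalfPlane (k := fun z => k (f' z)) hhd hkd' hhm hkm hkh hu hu1
      (h3.congr fun i => by simp only [Function.comp]; ring) hz

theorem IsMappingOut.isNormalizedInverse (hK : G.IsHull K) (hg : G.IsMappingOut K g)
    (hfd : DifferentiableOn ℂ f G.domain) (hgf : ∀ z ∈ G.domain, g (f z) = z)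
    (hfg : ∀ z ∈ G.domain \ K, f (g z) = z) : G.IsNormalizedInverse f := by
  cases G
  · obtain ⟨hg0, s, hs, hgs⟩ := hg.normalized
    have h0 : (0 : ℂ) ∈ radial.domain := by simp [domain]
    have h0K : (0 : ℂ) ∈ radial.domain \ K := ⟨h0, hK.avoidsTarget⟩
    have hf0 : f 0 = 0 := by
      have := hfg 0 h0K
      rwa [hg0] at this
    have dg : HasDerivAt g s (f 0) := by
      rw [hf0, ← hgs]
      exact (hg.differentiableOn.differentiableAt (hK.isOpen_diff.mem_nhds h0K)).hasDerivAt
    have df := (hfd.differentiableAt (radial.isOpen_domain.mem_nhds h0)).hasDerivAt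
    have h1 := dg.comp 0 df
    have h2 : HasDerivAt (g ∘ f) 1 0 := (hasDerivAt_id 0).congr_of_eventuallyEq (by
      filter_upwards [radial.isOpen_domain.mem_nhds h0] with z hz using hgf z hz)
    have h3 := h1.unique h2
    have hsC : (s : ℂ) ≠ 0 := by exact_mod_cast hs.ne'
    refine ⟨hf0, s⁻¹, inv_pos.2 hs, ?_⟩
    push_cast
    field_simp
    linear_combination h3
  · have hev := eventually_natCast_mul_I_mem hK
    have hcob : Tendsto (fun k : ℕ => (k : ℂ) * Complex.I) atTop
        (Bornology.cobounded ℂ ⊓ 𝓟 (chordal.domain \ K)) :=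
      tendsto_inf.2 ⟨tendsto_natCast_mul_I_cobounded, tendsto_principal.2 hev⟩
    refine ⟨fun k => g (k * Complex.I), hev.mono fun k hk => hg.bijOn.mapsTo hk,
      hg.normalized.comp hcob, ?_⟩
    refine tendsto_const_nhds.congr' (hev.mono fun k hk => ?_)
    change 0 = f (g (k * Complex.I)) - k * Complex.I
    rw [hfg _ hk, sub_self]

/-- The mapping-out function of a hull is unique. -/
theorem IsMappingOut.eqOn {g₁ g₂ : ℂ → ℂ} (hK : G.IsHull K) (h₁ : G.IsMappingOut K g₁)
    (h₂ : G.IsMappingOut K g₂) : EqOn g₁ g₂ (G.domain \ K) := by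
  obtain ⟨f, hfd, hf, hgf, hfg⟩ := h₁.exists_inverse hK
  intro z hz
  have := h₂.comp_eq hK hfd hf (h₁.isNormalizedInverse hK hfd hgf hfg) (h₁.bijOn.mapsTo hz)
  rw [hfg z hz] at this
  exact this.symm

theorem norm_toDisk_chordal_add_one {z : ℂ} (hz : 0 ≤ z.im) :
    ‖chordal.toDisk z + 1‖ = 4 / ‖2 * Complex.I + z‖ := by
  rw [toDisk_chordal_add_one hz, norm_div]; simp

/-- In disk coordinates `∞` is the point `-1`. -/
theorem tendsto_toDisk_neg_one_iff {ι : Type*} {l : Filter ι} {z : ι → ℂ}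
    (hz : ∀ᶠ i in l, 0 ≤ (z i).im) :
    Tendsto (fun i => chordal.toDisk (z i)) l (𝓝 (-1)) ↔
      Tendsto z l (Bornology.cobounded ℂ) := by
  have hn : ‖(2 * Complex.I : ℂ)‖ = 2 := by simp
  rw [tendsto_iff_norm_sub_tendsto_zero, ← tendsto_norm_atTop_iff_cobounded]
  simp only [sub_neg_eq_add]
  constructor
  · intro h
    have h1 : Tendsto (fun i => ‖chordal.toDisk (z i) + 1‖⁻¹) l atTop := by
      refine tendsto_inv_nhdsGT_zero.comp (tendsto_nhdsWithin_iff.2 ⟨h, ?_⟩)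
      filter_upwards [hz] with i hi
      rw [mem_Ioi, norm_toDisk_chordal_add_one hi]
      have := norm_pos_iff.2 (two_I_add_ne_zero hi)
      positivity
    refine tendsto_atTop_mono' l ?_
      (tendsto_atTop_add_const_right l (-2) (h1.const_mul_atTop (show (0 : ℝ) < 4 by norm_num)))
    filter_upwards [hz] with i hi
    rw [norm_toDisk_chordal_add_one hi, inv_div]
    have := norm_add_le (2 * Complex.I) (z i)
    rw [hn] at this
    linarith
  · intro h
    have h1 : Tendsto (fun i => ‖2 * Complex.I + z i‖) l atTop := by
      refine tendsto_atTop_mono' l ?_ (tendsto_atTop_add_const_right l (-2) h)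
      filter_upwards with i
      have := norm_sub_norm_le (z i) (-(2 * Complex.I))
      rw [norm_neg, hn, sub_neg_eq_add, add_comm (z i)] at this
      linarith
    refine (h1.const_div_atTop 4).congr' ?_
    filter_upwards [hz] with i hi
    rw [norm_toDisk_chordal_add_one hi]

/-- The inverse `f` of the mapping-out function `g` of `K`, and the same map `F` in disk
coordinates, extended continuously to the closed disk. -/
structure IsDiskModel (G : LoewnerCase) (K : Set ℂ) (g f F : ℂ → ℂ) : Prop where
  isHull : G.IsHull K
  mappingOut : G.IsMappingOut K g
  differentiableOn : DifferentiableOn ℂ f G.domain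
  bijOn : BijOn f G.domain (G.domain \ K)
  left_inv : ∀ z ∈ G.domain, g (f z) = z
  right_inv : ∀ z ∈ G.domain \ K, f (g z) = z
  uniformizer : IsUniformizer (G.toDisk '' K) F
  continuousOn : ContinuousOn F (Metric.closedBall 0 1)
  conj : ∀ z ∈ G.domain, F (G.toDisk z) = G.toDisk (f z)

theorem bijOn_toDisk_diff (hK : K ⊆ closure G.domain) :
    BijOn G.toDisk (G.domain \ K) (Metric.ball 0 1 \ G.toDisk '' K) := by
  refine ⟨fun z hz => ⟨G.toDisk_mem_ball hz.1, ?_⟩, G.toDisk_injOn.mono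
    (sdiff_subset.trans subset_closure), ?_⟩
  · rintro ⟨w, hw, h⟩
    rw [G.toDisk_injOn (hK hw) (subset_closure hz.1) h] at hw
    exact hz.2 hw
  · rintro u ⟨hu, huK⟩
    have h1 := G.toDisk_fromDisk (G.ball_subset_diskImage hu)
    exact ⟨G.fromDisk u, ⟨G.fromDisk_mem_domain hu, fun h => huK ⟨_, h, h1⟩⟩, h1⟩

theorem isUniformizer_of_bijOn (hK : K ⊆ closure G.domain) (hfd : DifferentiableOn ℂ f G.domain)
    (hf : BijOn f G.domain (G.domain \ K)) :
    IsUniformizer (G.toDisk '' K) (fun u => G.toDisk (f (G.fromDisk u))) := by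
  refine ⟨?_, ?_⟩
  · refine G.differentiableOn_toDisk.comp (hfd.comp G.differentiableOn_fromDisk
      G.bijOn_fromDisk.mapsTo) fun u hu => ?_
    exact (hf.mapsTo (G.fromDisk_mem_domain hu)).1
  · exact (bijOn_toDisk_diff hK).comp (hf.comp G.bijOn_fromDisk)

end LoewnerCase

namespace StoppedCurve

variable {G : LoewnerCase}

/-- The curve in disk coordinates. -/
noncomputable def diskCurve (γ : StoppedCurve G) (t : ℝ≥0) : ℂ := G.toDisk (γ.toFun t)

theorem continuous_diskCurve (γ : StoppedCurve G) : Continuous γ.diskCurve :=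
  G.continuousOn_toDisk.comp_continuous γ.continuous_toFun γ.mem_closure

theorem diskCurve_image (γ : StoppedCurve G) (t : ℝ≥0) :
    γ.diskCurve '' Icc 0 t = G.toDisk '' γ.segment t := by
  rw [segment, image_image]; rfl

theorem IsSimple.isDiskArc {γ : StoppedCurve G} (hγ : γ.IsSimple) :
    IsDiskArc γ.diskCurve γ.lifetime where
  continuous := γ.continuous_diskCurve
  start_eq := by rw [diskCurve, hγ.start_eq, G.toDisk_start]
  injOn := fun s hs t ht h => hγ.injOn hs ht (G.toDisk_injOn (γ.mem_closure s) (γ.mem_closure t) h)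
  mem_ball := fun t h0 ht => G.toDisk_mem_ball (hγ.mem_domain t h0 ht)

theorem segment_subset_closure (γ : StoppedCurve G) (t : ℝ≥0) :
    γ.segment t ⊆ closure G.domain := by
  rintro _ ⟨s, -, rfl⟩
  exact γ.mem_closure s

/-- The complement of a simple arc has the continuous boundary extension. -/
theorem IsSimple.exists_isDiskModel {γ : StoppedCurve G} (hγ : γ.IsSimple) {g : ℂ → ℂ}
    (hg : G.IsMappingOut γ.trace g) : ∃ f F, G.IsDiskModel γ.trace g f F := by
  have hK := (hγ.capacity_eq _ le_rfl).1
  obtain ⟨f, hfd, hf, hgf, hfg⟩ := hg.exists_inverse hK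
  have hU := LoewnerCase.isUniformizer_of_bijOn (γ.segment_subset_closure _) hfd hf
  have hU' := hU
  rw [← γ.diskCurve_image] at hU'
  obtain ⟨F, hFc, hFe⟩ := hU'.exists_extension hγ.isDiskArc
  refine ⟨f, F, hK, hg, hfd, hf, hgf, hfg, ⟨hU.differentiableOn.congr hFe,
    hU.bijOn.congr hFe.symm⟩, hFc, fun z hz => ?_⟩
  rw [hFe (G.toDisk_mem_ball hz)]
  change G.toDisk (f (G.fromDisk (G.toDisk z))) = _
  rw [G.fromDisk_toDisk (subset_closure hz)]

end StoppedCurve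

namespace LoewnerCase.IsDiskModel

variable {G : LoewnerCase} {K : Set ℂ} {g f F : ℂ → ℂ}

/-- The chordal uniformizer fixes `∞`. -/
theorem map_neg_one (h : chordal.IsDiskModel K g f F) : F (-1) = -1 := by
  have hev := eventually_natCast_mul_I_mem h.isHull
  have hcob : Tendsto (fun k : ℕ => (k : ℂ) * Complex.I) atTop
      (Bornology.cobounded ℂ ⊓ 𝓟 (chordal.domain \ K)) :=
    tendsto_inf.2 ⟨tendsto_natCast_mul_I_cobounded, tendsto_principal.2 hev⟩
  have h1 : Tendsto (fun k : ℕ => chordal.toDisk (k * Complex.I)) atTop (𝓝 (-1)) :=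
    (tendsto_toDisk_neg_one_iff (hev.mono fun k hk => le_of_lt hk.1)).2
      tendsto_natCast_mul_I_cobounded
  have h2 : Tendsto (fun k : ℕ => chordal.toDisk (g (k * Complex.I))) atTop (𝓝 (-1)) :=
    (tendsto_toDisk_neg_one_iff (hev.mono fun k hk => le_of_lt (h.mappingOut.bijOn.mapsTo hk))).2
      (tendsto_cobounded_of_sub tendsto_natCast_mul_I_cobounded (h.mappingOut.normalized.comp hcob))
  have h3 : Tendsto (fun k : ℕ => F (chordal.toDisk (g (k * Complex.I)))) atTop (𝓝 (F (-1))) := by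
    refine (h.continuousOn (-1) (by simp)).tendsto.comp (tendsto_nhdsWithin_iff.2 ⟨h2, ?_⟩)
    filter_upwards [hev] with k hk
    exact Metric.ball_subset_closedBall (chordal.toDisk_mem_ball (h.mappingOut.bijOn.mapsTo hk))
  refine tendsto_nhds_unique h3 (h1.congr' ?_)
  filter_upwards [hev] with k hk
  rw [h.conj _ (h.mappingOut.bijOn.mapsTo hk), h.right_inv _ hk]

/-- The point `∞` is the only preimage of `∞`, because `f z - z` is small where `f z` is large. -/
theorem eq_neg_one_of_map (h : chordal.IsDiskModel K g f F) {u : ℂ}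
    (hu : u ∈ Metric.closedBall (0 : ℂ) 1) (hFu : F u = -1) : u = -1 := by
  have h1 := tendsto_comp_ofReal_mul h.continuousOn hu
  rw [hFu] at h1
  have hdom : ∀ᶠ s : ℝ in 𝓝[<] 1, chordal.fromDisk (s * u) ∈ chordal.domain := by
    filter_upwards [eventually_mem_Ioo_zero_one] with s hs
    exact chordal.fromDisk_mem_domain (mul_mem_ball hu hs)
  have hback : ∀ᶠ s : ℝ in 𝓝[<] 1, chordal.toDisk (chordal.fromDisk (s * u)) = s * u := by
    filter_upwards [eventually_mem_Ioo_zero_one] with s hs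
    exact chordal.toDisk_fromDisk (chordal.ball_subset_diskImage (mul_mem_ball hu hs))
  have h2 : Tendsto (fun s : ℝ => chordal.toDisk (f (chordal.fromDisk (s * u)))) (𝓝[<] 1)
      (𝓝 (-1)) := by
    refine h1.congr' ?_
    filter_upwards [hdom, hback] with s hs hs'
    rw [← h.conj _ hs, hs']
  have h3 := (tendsto_toDisk_neg_one_iff
    (hdom.mono fun s hs => le_of_lt (h.bijOn.mapsTo hs).1)).1 h2
  have h4 := h.mappingOut.normalized.comp (tendsto_inf.2 ⟨h3, tendsto_principal.2
    (hdom.mono fun s hs => h.bijOn.mapsTo hs)⟩)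
  have h5 : Tendsto (fun s : ℝ => chordal.fromDisk (s * u)) (𝓝[<] 1) (Bornology.cobounded ℂ) := by
    refine tendsto_cobounded_of_sub h3 (h4.congr' ?_)
    filter_upwards [hdom] with s hs
    simp only [Function.comp, h.left_inv _ hs]
  have h6 := (tendsto_toDisk_neg_one_iff (hdom.mono fun s hs => le_of_lt hs)).2 h5
  exact tendsto_nhds_unique (tendsto_ofReal_mul u) (h6.congr' hback)

/-- The extended map does not take a point of the closed domain to `∞`, so that it can be carried
back to the original coordinates. -/
theorem mapsTo_diskImage (h : G.IsDiskModel K g f F) : MapsTo F G.diskImage G.diskImage := by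
  have h1 := h.uniformizer.mapsTo_closedBall h.continuousOn
  cases G
  · exact h1
  · exact fun u hu => ⟨h1 hu.1, fun h2 => hu.2 (h.eq_neg_one_of_map hu.1 h2)⟩

end LoewnerCase.IsDiskModel

/-! ### The image of the tip and the centered inverse -/

namespace StoppedCurve

variable {G : LoewnerCase} {γ : StoppedCurve G} {g f F : ℂ → ℂ} {w : ℂ}

/-- The disk model of the trace of a curve together with the boundary point `w` that corresponds to
its tip. -/
structure IsTipModel (γ : StoppedCurve G) (g f F : ℂ → ℂ) (w : ℂ) : Prop where
  model : G.IsDiskModel γ.trace g f F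
  mem_boundary : w ∈ G.boundary
  map_tip : F (G.toDisk w) = G.toDisk γ.tip
  eq_of_map : ∀ y ∈ Metric.closedBall (0 : ℂ) 1, F y = G.toDisk γ.tip → y = G.toDisk w

theorem tip_mem_trace (γ : StoppedCurve G) : γ.tip ∈ γ.trace :=
  ⟨γ.lifetime, ⟨zero_le, le_rfl⟩, rfl⟩

theorem tip_mem_closure (γ : StoppedCurve G) : γ.tip ∈ closure G.domain := γ.mem_closure _

theorem IsSimple.domain_diff_trace (hγ : γ.IsSimple) (h0 : γ.lifetime = 0) :
    G.domain \ γ.trace = G.domain := by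
  refine sdiff_eq_left.2 (disjoint_left.2 ?_)
  rintro _ hz ⟨t, ht, rfl⟩
  rw [h0, Icc_self, mem_singleton_iff] at ht
  rw [ht, hγ.start_eq] at hz
  exact G.start_notMem_domain hz

/-- The trivial hull has the identity as its mapping-out function. -/
theorem _root_.LoewnerCase.IsDiskModel.eqOn_id {K : Set ℂ} (h : G.IsDiskModel K g f F)
    (hK : G.domain \ K = G.domain) : EqOn F id (Metric.closedBall 0 1) := by
  have hn : G.IsNormalizedInverse id := by
    cases G
    · exact ⟨rfl, 1, one_pos, by simp⟩
    · refine ⟨fun k => k * Complex.I, ?_, by simp, by simp⟩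
      filter_upwards [eventually_gt_atTop 0] with k hk
      simpa using hk
  have hg : ∀ z ∈ G.domain, g z = z := fun z hz =>
    h.mappingOut.comp_eq h.isHull differentiableOn_id (by rw [hK]; exact bijOn_id _) hn hz
  have hf : ∀ z ∈ G.domain, f z = z := fun z hz => by
    have := h.right_inv z (hK.symm ▸ hz)
    rwa [hg z hz] at this
  have hb : EqOn F id (Metric.ball 0 1) := fun u hu => by
    have h1 := G.toDisk_fromDisk (G.ball_subset_diskImage hu)
    have h2 := h.conj _ (G.fromDisk_mem_domain hu)
    rwa [hf _ (G.fromDisk_mem_domain hu), h1] at h2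
  exact hb.of_subset_closure h.continuousOn continuousOn_id Metric.ball_subset_closedBall
    closedBall_subset_closure_ball

/-- The tip corresponds to exactly one boundary point. Lifetime `0` is treated separately, because
the tip is then the starting point on the boundary. -/
theorem IsSimple.exists_isTipModel_of_isDiskModel (hγ : γ.IsSimple)
    (h : G.IsDiskModel γ.trace g f F) : ∃ w, γ.IsTipModel g f F w := by
  rcases eq_zero_or_pos γ.lifetime with h0 | hT
  · have hF := h.eqOn_id (hγ.domain_diff_trace h0)
    have htip : γ.tip = G.start := by rw [tip, h0, hγ.start_eq]
    refine ⟨G.start, h, ?_, ?_, fun y hy hFy => ?_⟩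
    · exact G.mem_boundary_iff.2 ⟨G.start_mem_closure, G.start_notMem_domain⟩
    · rw [htip]
      exact hF (G.diskImage_subset_closedBall (G.toDisk_mem_diskImage G.start_mem_closure))
    · rwa [hF hy, htip] at hFy
  · have htr : γ.diskCurve '' Icc 0 γ.lifetime = G.toDisk '' γ.trace := γ.diskCurve_image _
    have hU : IsUniformizer (γ.diskCurve '' Icc 0 γ.lifetime) F := htr ▸ h.uniformizer
    have htip : G.toDisk γ.tip = γ.diskCurve γ.lifetime := rfl
    obtain ⟨a, ha, hFa⟩ := hU.exists_preimage h.continuousOn (hγ.isDiskArc.tip_mem_closure hT)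
    have hsph : ∀ y ∈ Metric.closedBall (0 : ℂ) 1, F y = G.toDisk γ.tip → ‖y‖ = 1 := by
      intro y hy hFy
      refine le_antisymm (by simpa using hy) (not_lt.1 fun hlt => ?_)
      refine (h.uniformizer.bijOn.mapsTo (mem_ball_zero_iff.2 hlt)).2 ?_
      rw [hFy]
      exact mem_image_of_mem _ γ.tip_mem_trace
    have haI : a ∈ G.diskImage := by
      cases G
      · exact ha
      · refine ⟨ha, ?_⟩
        rintro rfl
        rw [h.map_neg_one] at hFa
        exact (LoewnerCase.chordal.toDisk_mem_diskImage γ.tip_mem_closure).2 hFa.symm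
    have hw : G.toDisk (G.fromDisk a) = a := G.toDisk_fromDisk haI
    refine ⟨G.fromDisk a, h, ?_, by rw [hw, hFa, htip], fun y hy hFy => ?_⟩
    · refine G.mem_boundary_iff.2 ⟨G.fromDisk_mem_closure haI, fun hd => ?_⟩
      have h1 := G.toDisk_mem_ball hd
      rw [hw, mem_ball_zero_iff, hsph a ha hFa] at h1
      exact lt_irrefl _ h1
    · rw [hw]
      exact hU.eq_of_map_eq_tip hγ.isDiskArc hT h.continuousOn (hsph y hy hFy) (hsph a ha hFa) hFy hFa

theorem IsSimple.exists_isTipModel (hγ : γ.IsSimple) : ∃ g f F w, γ.IsTipModel g f F w ∧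
    G.CapacityExpansion γ.trace g γ.lifetime := by
  obtain ⟨-, g, hg, hcap⟩ := hγ.capacity_eq _ le_rfl
  obtain ⟨f, F, h⟩ := hγ.exists_isDiskModel hg
  obtain ⟨w, hw⟩ := hγ.exists_isTipModel_of_isDiskModel h
  exact ⟨g, f, F, w, hw, hcap⟩

end StoppedCurve

/-- The boundary extension of the inverse of the centered mapping-out function, given by the map
`F` in disk coordinates and the image `w` of the tip. -/
noncomputable def LoewnerCase.centeredInverse (G : LoewnerCase) (F : ℂ → ℂ) (w z : ℂ) : ℂ :=
  G.fromDisk (F (G.diskUncenter w (G.toDisk z)))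

namespace StoppedCurve.IsTipModel

variable {G : LoewnerCase} {γ : StoppedCurve G} {g f F : ℂ → ℂ} {w : ℂ}

theorem toDisk_centeredInverse (h : γ.IsTipModel g f F w) {z : ℂ} (hz : z ∈ closure G.domain) :
    G.toDisk (G.centeredInverse F w z) = F (G.diskUncenter w (G.toDisk z)) := by
  rw [LoewnerCase.centeredInverse, G.toDisk_fromDisk]
  rw [G.diskUncenter_toDisk h.mem_boundary hz]
  exact h.model.mapsTo_diskImage (G.toDisk_mem_diskImage (G.uncenter_mem_closure h.mem_boundary hz))

theorem centeredInverse_mem_closure (h : γ.IsTipModel g f F w) {z : ℂ} (hz : z ∈ closure G.domain) :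
    G.centeredInverse F w z ∈ closure G.domain := by
  refine G.fromDisk_mem_closure ?_
  rw [G.diskUncenter_toDisk h.mem_boundary hz]
  exact h.model.mapsTo_diskImage (G.toDisk_mem_diskImage (G.uncenter_mem_closure h.mem_boundary hz))

theorem centeredInverse_eq (h : γ.IsTipModel g f F w) {z : ℂ} (hz : z ∈ G.domain) :
    G.centeredInverse F w z = f (G.uncenter w z) := by
  have h1 := G.uncenter_mem_domain h.mem_boundary hz
  rw [LoewnerCase.centeredInverse, G.diskUncenter_toDisk h.mem_boundary (subset_closure hz),
    h.model.conj _ h1, G.fromDisk_toDisk (subset_closure (h.model.bijOn.mapsTo h1).1)]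

theorem continuousOn_diskMap (h : γ.IsTipModel g f F w) :
    ContinuousOn (fun u => F (G.diskUncenter w u)) (Metric.closedBall 0 1) := by
  have h1 : ContinuousOn (G.diskUncenter w) (Metric.closedBall 0 1) :=
    G.continuousOn_diskUncenter.comp (f := fun u : ℂ => (w, u)) (by fun_prop)
      fun _ hu => ⟨h.mem_boundary, hu⟩
  exact h.model.continuousOn.comp h1 (G.diskUncenter_mapsTo h.mem_boundary)

theorem continuousOn_centeredInverse (h : γ.IsTipModel g f F w) :
    ContinuousOn (G.centeredInverse F w) (closure G.domain) := by
  refine G.continuousOn_fromDisk.comp (h.continuousOn_diskMap.comp G.continuousOn_toDisk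
    fun z hz => G.diskImage_subset_closedBall (G.toDisk_mem_diskImage hz)) fun z hz => ?_
  rw [G.diskUncenter_toDisk h.mem_boundary hz]
  exact h.model.mapsTo_diskImage (G.toDisk_mem_diskImage (G.uncenter_mem_closure h.mem_boundary hz))

theorem centeredInverse_start (h : γ.IsTipModel g f F w) :
    G.centeredInverse F w G.start = γ.tip := by
  rw [LoewnerCase.centeredInverse, G.diskUncenter_toDisk h.mem_boundary G.start_mem_closure,
    G.uncenter_start, h.map_tip, G.fromDisk_toDisk γ.tip_mem_closure]

theorem centeredInverse_mem (h : γ.IsTipModel g f F w) {z : ℂ} (hz : z ∈ G.domain) :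
    G.centeredInverse F w z ∈ G.domain \ γ.trace := by
  rw [h.centeredInverse_eq hz]
  exact h.model.bijOn.mapsTo (G.uncenter_mem_domain h.mem_boundary hz)

theorem center_centeredInverse (h : γ.IsTipModel g f F w) {z : ℂ} (hz : z ∈ G.domain) :
    G.center w (g (G.centeredInverse F w z)) = z := by
  rw [h.centeredInverse_eq hz, h.model.left_inv _ (G.uncenter_mem_domain h.mem_boundary hz),
    G.center_uncenter h.mem_boundary]

/-- The inverse extends continuously to the closed disk and the tip has a single preimage, so by
compactness the mapping-out function converges at the tip. -/
theorem tendsto_tip (h : γ.IsTipModel g f F w) :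
    Tendsto g (𝓝[G.domain \ γ.trace] γ.tip) (𝓝 w) := by
  have hb := LoewnerCase.bijOn_toDisk_diff (γ.segment_subset_closure γ.lifetime)
  have hwc : w ∈ closure G.domain := (G.mem_boundary_iff.1 h.mem_boundary).1
  have hback : ∀ u ∈ Metric.ball (0 : ℂ) 1 \ G.toDisk '' γ.trace,
      G.fromDisk u ∈ G.domain \ γ.trace ∧ G.toDisk (G.fromDisk u) = u := by
    rintro u hu
    obtain ⟨z, hz, rfl⟩ := hb.surjOn hu
    rw [G.fromDisk_toDisk (subset_closure hz.1)]
    exact ⟨hz, rfl⟩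
  have h1 : Tendsto (fun u => G.toDisk (g (G.fromDisk u)))
      (𝓝[Metric.ball 0 1 \ G.toDisk '' γ.trace] (G.toDisk γ.tip)) (𝓝 (G.toDisk w)) := by
    refine IsUniformizer.tendsto_inverse h.model.continuousOn (fun u hu => ?_) (fun u hu => ?_)
      h.eq_of_map
    · exact G.toDisk_mem_ball (h.model.mappingOut.bijOn.mapsTo (hback u hu).1)
    · rw [h.model.conj _ (h.model.mappingOut.bijOn.mapsTo (hback u hu).1),
        h.model.right_inv _ (hback u hu).1, (hback u hu).2]
  have h2 : Tendsto G.toDisk (𝓝[G.domain \ γ.trace] γ.tip)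
      (𝓝[Metric.ball 0 1 \ G.toDisk '' γ.trace] (G.toDisk γ.tip)) := by
    refine tendsto_nhdsWithin_iff.2 ⟨?_, ?_⟩
    · exact (G.continuousOn_toDisk _ γ.tip_mem_closure).tendsto.mono_left
        (nhdsWithin_mono _ (sdiff_subset.trans subset_closure))
    · filter_upwards [self_mem_nhdsWithin] with z hz using hb.mapsTo hz
  have hev : ∀ᶠ z in 𝓝[G.domain \ γ.trace] γ.tip, z ∈ G.domain \ γ.trace := self_mem_nhdsWithin
  have h3 := (G.continuousOn_fromDisk _ (G.toDisk_mem_diskImage hwc)).tendsto.comp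
    (tendsto_nhdsWithin_iff.2 ⟨h1.comp h2, by
      filter_upwards [hev] with z hz
      simp only [Function.comp]
      rw [G.fromDisk_toDisk (subset_closure hz.1)]
      exact G.ball_subset_diskImage (G.toDisk_mem_ball (h.model.mappingOut.bijOn.mapsTo hz))⟩)
  rw [G.fromDisk_toDisk hwc] at h3
  refine h3.congr' ?_
  filter_upwards [hev] with z hz
  simp only [Function.comp]
  rw [G.fromDisk_toDisk (subset_closure hz.1),
    G.fromDisk_toDisk (subset_closure (h.model.mappingOut.bijOn.mapsTo hz))]

theorem tip_mem_closure (h : γ.IsTipModel g f F w) : γ.tip ∈ closure (G.domain \ γ.trace) := by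
  rw [← h.centeredInverse_start]
  exact closure_mono (image_subset_iff.2 fun z hz => h.centeredInverse_mem hz)
    (h.continuousOn_centeredInverse.image_closure ⟨_, G.start_mem_closure, rfl⟩)

theorem isCenteredInverse (h : γ.IsTipModel g f F w) :
    γ.IsCenteredInverse (G.centeredInverse F w) :=
  ⟨g, w, h.model.mappingOut, h.tendsto_tip, h.continuousOn_centeredInverse, fun _ hz =>
    ⟨h.centeredInverse_mem hz, h.center_centeredInverse hz⟩⟩

/-- The centered inverse is determined on the closed domain. -/
theorem eqOn_centeredInverse (h : γ.IsTipModel g f F w) {f' : ℂ → ℂ}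
    (hf' : γ.IsCenteredInverse f') : EqOn f' (G.centeredInverse F w) (closure G.domain) := by
  obtain ⟨g', w', hg', hw', hc', hinv⟩ := hf'
  have hK := h.model.isHull
  have hgg : EqOn g g' (G.domain \ γ.trace) := h.model.mappingOut.eqOn hK hg'
  have hev : ∀ᶠ z in 𝓝[G.domain \ γ.trace] γ.tip, z ∈ G.domain \ γ.trace := self_mem_nhdsWithin
  have : (𝓝[G.domain \ γ.trace] γ.tip).NeBot := mem_closure_iff_nhdsWithin_neBot.1 h.tip_mem_closure
  have hww : w' = w := tendsto_nhds_unique hw' (h.tendsto_tip.congr' (hev.mono fun z hz => hgg hz))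
  have hd : EqOn f' (G.centeredInverse F w) G.domain := fun z hz => by
    obtain ⟨h1, h2⟩ := hinv z hz
    rw [hww, ← hgg h1] at h2
    have h3 : G.uncenter w z = g (f' z) := by rw [← h2, G.uncenter_center h.mem_boundary, h2]
    rw [h.centeredInverse_eq hz, h3, h.model.right_inv _ h1]
  exact hd.of_subset_closure hc' h.continuousOn_centeredInverse subset_closure Subset.rfl

end StoppedCurve.IsTipModel

/-! ### Estimates for chordal mapping-out functions -/

/-- A maximum principle in the upper half-plane for imaginary parts with nonpositive boundary
values, at the point `∞` included. -/
theorem im_nonpos_of_boundary {q : ℂ → ℂ} (hq : DifferentiableOn ℂ q {z | 0 < z.im})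
    (hinf : ∀ ε > 0, ∀ᶠ z in Bornology.cobounded ℂ ⊓ 𝓟 {z : ℂ | 0 < z.im}, (q z).im < ε)
    (hbd : ∀ x : ℂ, x.im = 0 → ∀ ε > 0, ∀ᶠ z in 𝓝[{z : ℂ | 0 < z.im}] x, (q z).im < ε)
    {z : ℂ} (hz : 0 < z.im) : (q z).im ≤ 0 := by
  have hopen : IsOpen {z : ℂ | 0 < z.im} := isOpen_lt continuous_const Complex.continuous_im
  refine im_nonpos_of_forall_compact (U := {z : ℂ | 0 < z.im}) hopen
    (convex_halfSpace_im_gt 0).isPreconnected ?_ hq (fun ε hε => ?_) hz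
  · intro hc
    have h1 : (0 : ℂ) ∈ closure {z : ℂ | 0 < z.im} := by
      rw [Complex.closure_setOfPred_lt_im]
      simp
    rw [hc.isClosed.closure_eq] at h1
    exact lt_irrefl (0 : ℝ) h1
  refine ⟨{z | 0 < z.im} ∩ {z | ε ≤ (q z).im}, inter_subset_left, ?_, fun w hw hwS => ?_⟩
  · refine Metric.isCompact_of_isClosed_isBounded ?_ ?_
    · refine isClosed_of_closure_subset fun x hx => ?_
      have hx0 : 0 ≤ x.im := by
        have h1 := closure_mono inter_subset_left hx
        rwa [Complex.closure_setOfPred_lt_im] at h1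
      rw [mem_closure_iff_frequently] at hx
      have hlt : 0 < x.im := by
        refine lt_of_le_of_ne hx0 fun h0 => hx ?_
        filter_upwards [eventually_nhdsWithin_iff.1 (hbd x h0.symm ε hε)] with w hw hwS
        exact absurd (hw hwS.1) (not_lt.2 hwS.2)
      refine ⟨hlt, not_lt.1 fun (hqx : (q x).im < ε) => hx ?_⟩
      have hc := (hq.differentiableAt (hopen.mem_nhds hlt)).continuousAt
      filter_upwards [(Complex.continuous_im.continuousAt.comp hc).eventually
        (gt_mem_nhds hqx)] with w hw hwS
      exact absurd hw (not_lt.2 hwS.2)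
    · rw [← Bornology.isCobounded_compl_iff]
      have := eventually_inf_principal.1 (hinf ε hε)
      refine mem_of_superset (x := {w : ℂ | w ∈ {z : ℂ | 0 < z.im} → (q w).im < ε}) this ?_
      exact fun w hw hwS => absurd (hw hwS.1) (not_lt.2 hwS.2)
  · exact not_le.1 fun h => hwS ⟨hw, h⟩

namespace LoewnerCase.IsDiskModel

variable {K : Set ℂ} {g f F : ℂ → ℂ}

theorem tendsto_cobounded (h : chordal.IsDiskModel K g f F) :
    Tendsto f (Bornology.cobounded ℂ ⊓ 𝓟 chordal.domain)
      (Bornology.cobounded ℂ ⊓ 𝓟 (chordal.domain \ K)) := by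
  have hev : ∀ᶠ z in Bornology.cobounded ℂ ⊓ 𝓟 chordal.domain, z ∈ chordal.domain :=
    mem_inf_of_right (mem_principal_self _)
  refine tendsto_inf.2 ⟨?_, tendsto_principal.2 (hev.mono fun z hz => h.bijOn.mapsTo hz)⟩
  refine (tendsto_toDisk_neg_one_iff (hev.mono fun z hz => le_of_lt (h.bijOn.mapsTo hz).1)).1 ?_
  have h1 : Tendsto chordal.toDisk (Bornology.cobounded ℂ ⊓ 𝓟 chordal.domain) (𝓝 (-1)) :=
    (tendsto_toDisk_neg_one_iff (z := fun z => z) (hev.mono fun z hz => le_of_lt hz)).2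
      (tendsto_id.mono_left inf_le_left)
  have h2 := (h.continuousOn (-1) (by simp)).tendsto.comp (tendsto_nhdsWithin_iff.2 ⟨h1,
    hev.mono fun z hz => Metric.ball_subset_closedBall (chordal.toDisk_mem_ball hz)⟩)
  rw [h.map_neg_one] at h2
  exact h2.congr' (hev.mono fun z hz => h.conj z hz)

theorem tendsto_sub_zero (h : chordal.IsDiskModel K g f F) :
    Tendsto (fun z => f z - z) (Bornology.cobounded ℂ ⊓ 𝓟 chordal.domain) (𝓝 0) := by
  have hev : ∀ᶠ z in Bornology.cobounded ℂ ⊓ 𝓟 chordal.domain, z ∈ chordal.domain :=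
    mem_inf_of_right (mem_principal_self _)
  have h1 : Tendsto (fun z => g (f z) - f z) (Bornology.cobounded ℂ ⊓ 𝓟 chordal.domain) (𝓝 0) :=
    Tendsto.comp (g := fun z : ℂ => g z - z) h.mappingOut.normalized h.tendsto_cobounded
  have h2 := h1.neg
  rw [neg_zero] at h2
  refine h2.congr' (hev.mono fun z hz => ?_)
  rw [h.left_inv z hz, neg_sub]

/-- The capacity read off from the inverse mapping-out function. -/
theorem tendsto_mul_sub (h : chordal.IsDiskModel K g f F) {T : ℝ}
    (hT : chordal.CapacityExpansion K g T) :
    Tendsto (fun z => z * (f z - z)) (Bornology.cobounded ℂ ⊓ 𝓟 chordal.domain)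
      (𝓝 (-((2 * T : ℝ) : ℂ))) := by
  have hev : ∀ᶠ z in Bornology.cobounded ℂ ⊓ 𝓟 chordal.domain, z ∈ chordal.domain :=
    mem_inf_of_right (mem_principal_self _)
  have h1 : Tendsto (fun z => f z * (g (f z) - f z)) (Bornology.cobounded ℂ ⊓ 𝓟 chordal.domain)
      (𝓝 ((2 * T : ℝ) : ℂ)) :=
    Tendsto.comp (g := fun z : ℂ => z * (g z - z)) hT h.tendsto_cobounded
  have h2 := h1.neg.sub (h.tendsto_sub_zero.pow 2)
  rw [zero_pow two_ne_zero, sub_zero] at h2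
  refine h2.congr' (hev.mono fun z hz => ?_)
  rw [h.left_inv z hz]
  ring

/-- At a real point the inverse mapping-out function has the boundary value given by the disk
model. -/
theorem tendsto_boundary (h : chordal.IsDiskModel K g f F) {x : ℂ} (hx : x.im = 0) :
    Tendsto f (𝓝[chordal.domain] x) (𝓝 (chordal.fromDisk (F (chordal.toDisk x)))) := by
  have hxc : x ∈ closure chordal.domain := by
    rw [closure_domain_chordal]
    exact hx.ge
  have hxI := chordal.toDisk_mem_diskImage hxc
  have hev : ∀ᶠ z in 𝓝[chordal.domain] x, z ∈ chordal.domain := self_mem_nhdsWithin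
  have h1 : Tendsto chordal.toDisk (𝓝[chordal.domain] x) (𝓝 (chordal.toDisk x)) :=
    (chordal.continuousOn_toDisk x hxc).tendsto.mono_left (nhdsWithin_mono _ subset_closure)
  have h2 := (h.continuousOn _ hxI.1).tendsto.comp (tendsto_nhdsWithin_iff.2 ⟨h1,
    hev.mono fun z hz => Metric.ball_subset_closedBall (chordal.toDisk_mem_ball hz)⟩)
  have h3 := (chordal.continuousOn_fromDisk _ (h.mapsTo_diskImage hxI)).tendsto.comp
    (tendsto_nhdsWithin_iff.2 ⟨h2, hev.mono fun z hz =>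
      h.mapsTo_diskImage (chordal.ball_subset_diskImage (chordal.toDisk_mem_ball hz))⟩)
  refine h3.congr' (hev.mono fun z hz => ?_)
  simp only [Function.comp]
  rw [h.conj z hz, chordal.fromDisk_toDisk (subset_closure (h.bijOn.mapsTo hz).1)]

theorem im_boundary_nonneg (h : chordal.IsDiskModel K g f F) {x : ℂ} (hx : x.im = 0) :
    0 ≤ (chordal.fromDisk (F (chordal.toDisk x))).im := by
  have hxc : x ∈ closure chordal.domain := by
    rw [closure_domain_chordal]
    exact hx.ge
  have := chordal.fromDisk_mem_closure (h.mapsTo_diskImage (chordal.toDisk_mem_diskImage hxc))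
  rwa [closure_domain_chordal] at this

/-- Boundary values of `f` are real or lie in the hull. -/
theorem im_boundary_eq_zero_or_mem (h : chordal.IsDiskModel K g f F) {x : ℂ} (hx : x.im = 0) :
    (chordal.fromDisk (F (chordal.toDisk x))).im = 0 ∨
      chordal.fromDisk (F (chordal.toDisk x)) ∈ K := by
  have hxc : x ∈ closure chordal.domain := by
    rw [closure_domain_chordal]
    exact hx.ge
  have hxI := chordal.toDisk_mem_diskImage hxc
  have hnorm : ‖chordal.toDisk x‖ = 1 := by
    have h1 := norm_toDisk_chordal_sq hx.ge
    rw [hx, mul_zero, zero_div, sub_zero] at h1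
    exact (pow_eq_one_iff_of_nonneg (norm_nonneg _) two_ne_zero).1 h1
  rcases h.uniformizer.mapsTo_sphere h.continuousOn hnorm with h1 | ⟨y, hy, hyF⟩
  · left
    rw [im_fromDisk_chordal (h.mapsTo_diskImage hxI).2, mem_sphere_zero_iff_norm.1 h1]
    simp
  · right
    rw [← hyF, chordal.fromDisk_toDisk (h.isHull.subset hy)]
    exact hy

/-- The maximum principle for `Im (z - f z)`, whose boundary values are nonpositive. -/
theorem im_le (h : chordal.IsDiskModel K g f F) {z : ℂ} (hz : 0 < z.im) : z.im ≤ (f z).im := by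
  have key : ((fun z => z - f z) z).im ≤ 0 := by
    refine im_nonpos_of_boundary (differentiableOn_id.sub h.differentiableOn) (fun ε hε => ?_)
      (fun x hx ε hε => ?_) hz
    · have h1 := (Complex.continuous_im.tendsto _).comp h.tendsto_sub_zero.neg
      rw [neg_zero, Complex.zero_im] at h1
      filter_upwards [h1.eventually (gt_mem_nhds hε)] with z hz
      simpa using hz
    · have h1 : Tendsto (fun z => z - f z) (𝓝[chordal.domain] x) _ :=
        (tendsto_id.mono_left nhdsWithin_le_nhds).sub (h.tendsto_boundary hx)
      refine ((Complex.continuous_im.tendsto _).comp h1).eventually (gt_mem_nhds ?_)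
      have := h.im_boundary_nonneg hx
      rw [Complex.sub_im]
      simp only [hx]
      linarith
  simp only [Complex.sub_im] at key
  linarith

theorem im_add_div {R : ℝ} {w : ℂ} (hw : w ≠ 0) :
    (w + (R : ℂ) ^ 2 / w).im = w.im * (1 - R ^ 2 / ‖w‖ ^ 2) := by
  have h0 : Complex.normSq w ≠ 0 := by simpa using hw
  have h1 : ((R : ℂ) ^ 2).re = R ^ 2 := by rw [← Complex.ofReal_pow, Complex.ofReal_re]
  have h2 : ((R : ℂ) ^ 2).im = 0 := by rw [← Complex.ofReal_pow, Complex.ofReal_im]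
  rw [Complex.add_im, Complex.div_im, Complex.sq_norm, h1, h2]
  field_simp
  ring

/-- Comparison with the Joukowsky map, which takes the complement of a half-disk containing the
hull onto the half-plane. -/
theorem im_joukowsky_le (h : chordal.IsDiskModel K g f F) {R : ℝ} (hR : 0 < R)
    (hK : K ⊆ Metric.closedBall 0 R) {z : ℂ} (hz : 0 < z.im) :
    (f z + (R : ℂ) ^ 2 / f z).im ≤ z.im := by
  have hne : ∀ z, 0 < z.im → f z ≠ 0 := fun z hz h0 => by
    have h1 : 0 < (f z).im := (h.bijOn.mapsTo hz).1
    rw [h0] at h1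
    exact lt_irrefl _ h1
  have key : ((fun z => f z + (R : ℂ) ^ 2 / f z - z) z).im ≤ 0 := by
    refine im_nonpos_of_boundary ((h.differentiableOn.add ((differentiableOn_const _).div
      h.differentiableOn hne)).sub differentiableOn_id) (fun ε hε => ?_) (fun x hx ε hε => ?_) hz
    · have h0 := (tendsto_inv₀_cobounded.comp (h.tendsto_cobounded.mono_right inf_le_left)).const_mul
        ((R : ℂ) ^ 2)
      have h1 := (Complex.continuous_im.tendsto _).comp (h.tendsto_sub_zero.add h0)
      rw [mul_zero, add_zero, Complex.zero_im] at h1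
      filter_upwards [h1.eventually (gt_mem_nhds hε)] with z hz
      refine lt_of_eq_of_lt (congrArg Complex.im ?_) hz
      change f z + (R : ℂ) ^ 2 / f z - z = f z - z + (R : ℂ) ^ 2 * (f z)⁻¹
      ring
    · have hlim := h.tendsto_boundary hx
      have hev : ∀ᶠ z in 𝓝[chordal.domain] x, z ∈ chordal.domain := self_mem_nhdsWithin
      set y := chordal.fromDisk (F (chordal.toDisk x)) with hy
      by_cases hy0 : y = 0
      · rw [hy0] at hlim
        filter_upwards [hlim (Metric.ball_mem_nhds 0 hR), hev] with z h1 h2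
        have h3 : ‖f z‖ < R := by simpa using h1
        have h4 := norm_pos_iff.2 (hne z h2)
        have h5 : 0 < (f z).im := (h.bijOn.mapsTo h2).1
        have h6 : 0 < z.im := h2
        change (f z + (R : ℂ) ^ 2 / f z - z).im < ε
        rw [Complex.sub_im, im_add_div (hne z h2)]
        have h7 : 1 ≤ R ^ 2 / ‖f z‖ ^ 2 := by
          rw [le_div_iff₀ (by positivity)]
          nlinarith
        nlinarith
      · have h1 : Tendsto (fun z => f z + (R : ℂ) ^ 2 / f z - z) (𝓝[chordal.domain] x) _ :=
          (hlim.add (tendsto_const_nhds.div hlim hy0)).sub (tendsto_id.mono_left nhdsWithin_le_nhds)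
        refine ((Complex.continuous_im.tendsto _).comp h1).eventually (gt_mem_nhds ?_)
        have h2 : (y + (R : ℂ) ^ 2 / y).im ≤ 0 := by
          rw [im_add_div hy0]
          rcases h.im_boundary_eq_zero_or_mem hx with h3 | h3
          · rw [← hy] at h3
            simp [h3]
          · have h4 : ‖y‖ ≤ R := by simpa using hK h3
            have h5 := norm_pos_iff.2 hy0
            have h7 : 1 ≤ R ^ 2 / ‖y‖ ^ 2 := by
              rw [le_div_iff₀ (by positivity)]
              nlinarith
            have h8 : 0 ≤ y.im := h.im_boundary_nonneg hx
            nlinarith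
        rw [Complex.sub_im]
        simp only [hx]
        linarith
  simp only [Complex.sub_im] at key
  linarith

theorem im_sub_le (h : chordal.IsDiskModel K g f F) {R : ℝ} (hR : 0 < R)
    (hK : K ⊆ Metric.closedBall 0 R) {z : ℂ} (hz : 0 < z.im) : (f z - z).im ≤ R ^ 2 / z.im := by
  have h1 := h.im_joukowsky_le hR hK hz
  have h2 := h.im_le hz
  have h3 : 0 < (f z).im := hz.trans_le h2
  have h4 : f z ≠ 0 := by
    intro h0
    rw [h0] at h3
    exact lt_irrefl _ h3
  rw [im_add_div h4] at h1
  have h5 := norm_pos_iff.2 h4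
  have h6 : (f z).im * (R ^ 2 / ‖f z‖ ^ 2) ≤ R ^ 2 / (f z).im := by
    rw [mul_div_assoc', div_le_div_iff₀ (by positivity) h3]
    have h7 : (f z).im ≤ ‖f z‖ := (le_abs_self _).trans (Complex.abs_im_le_norm _)
    have h8 : (f z).im ^ 2 ≤ ‖f z‖ ^ 2 := by gcongr
    nlinarith [sq_nonneg R]
  have h7 : R ^ 2 / (f z).im ≤ R ^ 2 / z.im := by gcongr
  rw [Complex.sub_im]
  linarith

/-- The Schwarz–Pick lemma for `f z - z`, with the second point tending to `∞`. -/
theorem norm_sub_le (h : chordal.IsDiskModel K g f F) {R : ℝ} (hR : 0 < R)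
    (hK : K ⊆ Metric.closedBall 0 R) {z : ℂ} (hz : 0 < z.im) : ‖f z - z‖ ≤ R ^ 2 / z.im := by
  set p : ℂ → ℂ := fun z => f z - z with hp
  have hpd : DifferentiableOn ℂ p {z | 0 < z.im} := h.differentiableOn.sub differentiableOn_id
  have hpm : ∀ z, 0 < z.im → 0 ≤ (p z).im := fun z hz => by
    have := h.im_le hz
    simp only [hp, Complex.sub_im]
    linarith
  have hcob : Tendsto (fun n : ℕ => (n : ℂ) * Complex.I) atTop
      (Bornology.cobounded ℂ ⊓ 𝓟 chordal.domain) := by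
    refine tendsto_inf.2 ⟨tendsto_natCast_mul_I_cobounded, tendsto_principal.2 ?_⟩
    filter_upwards [eventually_gt_atTop 0] with n hn
    simpa [domain] using hn
  have h1 : Tendsto (fun n : ℕ => p (n * Complex.I)) atTop (𝓝 0) := h.tendsto_sub_zero.comp hcob
  have h2 : Tendsto (fun n : ℕ => ‖z / n - Complex.I‖ ^ 2) atTop (𝓝 1) := by
    have : Tendsto (fun n : ℕ => z * (n : ℂ)⁻¹) atTop (𝓝 (z * 0)) :=
      (tendsto_inv₀_cobounded.comp (tendsto_norm_atTop_iff_cobounded.1 (by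
        simpa using tendsto_natCast_atTop_atTop (R := ℝ)))).const_mul z
    rw [mul_zero] at this
    have := ((this.sub_const Complex.I).norm.pow 2)
    simpa [div_eq_mul_inv] using this
  have h3 := ((tendsto_const_nhds (x := p z)).sub h1).norm.pow 2 |>.mul_const z.im
  have h4 := h2.const_mul ((p z).im * R ^ 2)
  rw [sub_zero] at h3
  rw [mul_one] at h4
  have hle : ‖p z‖ ^ 2 * z.im ≤ (p z).im * R ^ 2 := by
    refine le_of_tendsto_of_tendsto h3 h4 ?_
    filter_upwards [eventually_gt_atTop 0] with n hn
    have hnR : (0 : ℝ) < n := by exact_mod_cast hn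
    have hnC : (n : ℂ) ≠ 0 := by exact_mod_cast hn.ne'
    have him : ((n : ℂ) * Complex.I).im = n := by simp
    have hsp := schwarz_pick_upperHalfPlane hpd hpm hz (w := n * Complex.I) (by rwa [him])
    have h5 := h.im_sub_le hR hK (z := n * Complex.I) (by rwa [him])
    rw [him] at hsp h5
    have h6 : ‖z - n * Complex.I‖ = n * ‖z / n - Complex.I‖ := by
      have : z - n * Complex.I = n * (z / n - Complex.I) := by field_simp
      rw [this, norm_mul]
      simp
    rw [h6] at hsp
    have h7 : (p z).im * (p (n * Complex.I)).im * (n * ‖z / n - Complex.I‖) ^ 2 ≤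
        (p z).im * (R ^ 2 / n) * (n * ‖z / n - Complex.I‖) ^ 2 := by
      gcongr
      exact hpm z hz
    have h8 : (p z).im * (R ^ 2 / n) * (n * ‖z / n - Complex.I‖) ^ 2 =
        (p z).im * R ^ 2 * ‖z / n - Complex.I‖ ^ 2 * n := by field_simp
    refine le_of_mul_le_mul_right ?_ hnR
    linarith
  have h5 : (p z).im * R ^ 2 ≤ R ^ 2 / z.im * R ^ 2 :=
    mul_le_mul_of_nonneg_right (h.im_sub_le hR hK hz) (sq_nonneg R)
  refine (sq_le_sq₀ (norm_nonneg _) (by positivity)).1 ?_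
  change ‖p z‖ ^ 2 ≤ _
  rw [div_pow, le_div_iff₀ (by positivity)]
  have h6 : R ^ 2 / z.im * R ^ 2 * z.im = (R ^ 2) ^ 2 := by field_simp
  nlinarith

/-- If the boundary values of `f₁` are at most `ε` above those of `f₂` on `[-M, M]`, and not above
them elsewhere, then the capacities differ by at most `M ε` in one direction. The imaginary part of
the function `2 M ε / (z + i M)` is at most `-ε` on `[-M, M]`. -/
theorem capacity_le (h : chordal.IsDiskModel K g f F) {K₂ : Set ℂ} {g₂ f₂ F₂ : ℂ → ℂ}
    (h₂ : chordal.IsDiskModel K₂ g₂ f₂ F₂) {T T₂ : ℝ} (hT : chordal.CapacityExpansion K g T)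
    (hT₂ : chordal.CapacityExpansion K₂ g₂ T₂) {M ε : ℝ} (hM : 0 < M) (hε : 0 ≤ ε)
    (hin : ∀ x : ℂ, x.im = 0 → ‖x‖ ≤ M → (chordal.fromDisk (F (chordal.toDisk x))).im ≤
      (chordal.fromDisk (F₂ (chordal.toDisk x))).im + ε)
    (hout : ∀ x : ℂ, x.im = 0 → M < ‖x‖ → (chordal.fromDisk (F (chordal.toDisk x))).im ≤
      (chordal.fromDisk (F₂ (chordal.toDisk x))).im) : T ≤ T₂ + M * ε := by
  set q : ℂ → ℂ := fun z => f z - f₂ z + ((2 * M * ε : ℝ) : ℂ) * (z + M * Complex.I)⁻¹ with hq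
  have hne : ∀ z : ℂ, 0 ≤ z.im → z + M * Complex.I ≠ 0 := fun z hz h0 => by
    have := congrArg Complex.im h0
    simp at this
    linarith
  have him : ∀ x : ℂ, (((2 * M * ε : ℝ) : ℂ) * (x + M * Complex.I)⁻¹).im =
      -(2 * M * ε * (x.im + M)) / (x.re ^ 2 + (x.im + M) ^ 2) := fun x => by
    rw [Complex.im_ofReal_mul, Complex.inv_im, Complex.normSq_apply]
    simp
    ring
  have key : ∀ z : ℂ, 0 < z.im → (q z).im ≤ 0 := by
    intro z hz
    refine im_nonpos_of_boundary ?_ (fun δ hδ => ?_) (fun x hx δ hδ => ?_) hz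
    · refine (h.differentiableOn.sub h₂.differentiableOn).add
        (DifferentiableOn.const_mul (DifferentiableOn.inv (by fun_prop) ?_) _)
      exact fun z hz => hne z (le_of_lt hz)
    · have h0 : Tendsto (fun z : ℂ => z + M * Complex.I) (Bornology.cobounded ℂ ⊓ 𝓟 chordal.domain)
          (Bornology.cobounded ℂ) :=
        tendsto_cobounded_of_sub (tendsto_id.mono_left inf_le_left) (a := M * Complex.I) (by
          simpa using tendsto_const_nhds)
      have h1 := (tendsto_inv₀_cobounded.comp h0).const_mul ((2 * M * ε : ℝ) : ℂ)
      have h3 := (Complex.continuous_im.tendsto _).comp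
        ((h.tendsto_sub_zero.sub h₂.tendsto_sub_zero).add h1)
      rw [mul_zero, sub_zero, add_zero, Complex.zero_im] at h3
      filter_upwards [h3.eventually (gt_mem_nhds hδ)] with z hz
      refine lt_of_eq_of_lt (congrArg Complex.im ?_) hz
      simp only [hq, Function.comp]
      ring
    · have h1 : Tendsto (fun z : ℂ => ((2 * M * ε : ℝ) : ℂ) * (z + M * Complex.I)⁻¹)
          (𝓝[chordal.domain] x) (𝓝 (((2 * M * ε : ℝ) : ℂ) * (x + M * Complex.I)⁻¹)) := by
        refine (Tendsto.inv₀ ?_ (hne x hx.ge)).const_mul _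
        exact (tendsto_id.mono_left nhdsWithin_le_nhds).add_const _
      have h3 := ((h.tendsto_boundary hx).sub (h₂.tendsto_boundary hx)).add h1
      refine ((Complex.continuous_im.tendsto _).comp h3).eventually (gt_mem_nhds ?_)
      rw [Complex.add_im, Complex.sub_im, him, hx, zero_add]
      refine lt_of_le_of_lt ?_ hδ
      have hnorm : ‖x‖ ^ 2 = x.re ^ 2 := by
        rw [Complex.sq_norm, Complex.normSq_apply, hx]
        ring
      rcases le_or_gt ‖x‖ M with hxM | hxM
      · have h4 := hin x hx hxM
        have h5 : x.re ^ 2 ≤ M ^ 2 := by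
          rw [← hnorm]
          gcongr
        have h6 : -(2 * M * ε * M) / (x.re ^ 2 + M ^ 2) ≤ -ε := by
          rw [div_le_iff₀ (by positivity)]
          nlinarith
        linarith
      · have h4 := hout x hx hxM
        have h6 : -(2 * M * ε * M) / (x.re ^ 2 + M ^ 2) ≤ 0 :=
          div_nonpos_of_nonpos_of_nonneg (by have : 0 ≤ 2 * M * ε * M := by positivity
                                             linarith) (by positivity)
        linarith
  have hcob : Tendsto (fun n : ℕ => (n : ℂ) * Complex.I) atTop
      (Bornology.cobounded ℂ ⊓ 𝓟 chordal.domain) := by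
    refine tendsto_inf.2 ⟨tendsto_natCast_mul_I_cobounded, tendsto_principal.2 ?_⟩
    filter_upwards [eventually_gt_atTop 0] with n hn
    simpa [domain] using hn
  have h1 := ((h.tendsto_mul_sub hT).sub (h₂.tendsto_mul_sub hT₂)).comp hcob
  have h3 := ((Complex.continuous_re.tendsto _).comp h1).neg
  have h4 : Tendsto (fun n : ℕ => -(2 * M * ε * (n / (n + M)))) atTop (𝓝 (-(2 * M * ε * 1))) := by
    refine Tendsto.neg (Tendsto.const_mul _ ?_)
    have h5 : Tendsto (fun n : ℕ => 1 - M * ((n : ℝ) + M)⁻¹) atTop (𝓝 (1 - M * 0)) :=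
      ((tendsto_inv_atTop_zero.comp (tendsto_atTop_add_const_right _ M
        tendsto_natCast_atTop_atTop)).const_mul M).const_sub 1
    rw [mul_zero, sub_zero] at h5
    refine h5.congr fun n => ?_
    have : (n : ℝ) + M ≠ 0 := by positivity
    field_simp
    ring
  have h5 := le_of_tendsto_of_tendsto (h3.add h4) (tendsto_const_nhds (x := (0 : ℝ))) ?_
  · simp at h5
    linarith
  · filter_upwards [eventually_gt_atTop 0] with n hn
    have hnR : (0 : ℝ) < n := by exact_mod_cast hn
    have h6 := key (n * Complex.I) (by simpa using hn)
    rw [hq] at h6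
    simp only [Complex.add_im, him] at h6
    simp only [Function.comp]
    simp at h6 ⊢
    have h7 : -(2 * M * ε * ((n : ℝ) + M)) / ((n : ℝ) + M) ^ 2 * n = -(2 * M * ε * (n / (n + M))) := by
      have : (n : ℝ) + M ≠ 0 := by positivity
      field_simp
    have h8 := mul_le_mul_of_nonneg_right h6 hnR.le
    rw [add_mul, h7] at h8
    linarith

end LoewnerCase.IsDiskModel

/-- Uniformly for hulls in `closedBall 0 R`, the uniformizers take a suitable point to a point at a
definite distance from the boundary of their image. -/
theorem LoewnerCase.exists_base_separation {R : ℝ} (hR : 0 < R) :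
    ∃ z₀ : ℂ, ‖z₀‖ < 1 ∧ ∃ κ > 0, ∀ (K : Set ℂ) (g f F : ℂ → ℂ), chordal.IsDiskModel K g f F →
      K ⊆ Metric.closedBall 0 R →
      ∀ a ∈ Metric.sphere (0 : ℂ) 1 ∪ chordal.toDisk '' K, κ ≤ ‖F z₀ - a‖ := by
  set Y : ℝ := 2 * R with hY
  have hz : 0 < ((Y : ℂ) * Complex.I).im := by simp [hY, hR]
  set A : Set ℂ := Metric.closedBall 0 (4 * R) ∩ {z | Y ≤ z.im}
  have hAd : A ⊆ chordal.domain := fun z hz => lt_of_lt_of_le (show 0 < Y by positivity) hz.2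
  have hA : IsCompact (chordal.toDisk '' A) :=
    ((isCompact_closedBall _ _).inter_right (isClosed_le continuous_const
      Complex.continuous_im)).image_of_continuousOn
      (chordal.continuousOn_toDisk.mono (hAd.trans subset_closure))
  set B : Set ℂ := Metric.closedBall 0 R ∩ closure chordal.domain
  have hB : IsCompact (chordal.toDisk '' B) :=
    ((isCompact_closedBall _ _).inter_right isClosed_closure).image_of_continuousOn
      (chordal.continuousOn_toDisk.mono inter_subset_right)
  have hdisj : Disjoint (chordal.toDisk '' A)
      (Metric.sphere (0 : ℂ) 1 ∪ chordal.toDisk '' B) := by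
    rw [disjoint_left]
    rintro _ ⟨z, hz, rfl⟩ (h | ⟨w, hw, h⟩)
    · have h1 := chordal.toDisk_mem_ball (hAd hz)
      rw [mem_ball_zero_iff, mem_sphere_zero_iff_norm.1 h] at h1
      exact lt_irrefl _ h1
    · have h1 := chordal.toDisk_injOn hw.2 (subset_closure (hAd hz)) h
      have h2 : ‖z‖ ≤ R := by simpa [h1] using hw.1
      have h3 : Y ≤ z.im := hz.2
      have h4 : z.im ≤ ‖z‖ := (le_abs_self _).trans (Complex.abs_im_le_norm _)
      linarith
  obtain ⟨κ, hκ, hlt⟩ := Metric.exists_pos_forall_lt_edist hA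
    (Metric.isClosed_sphere.union hB.isClosed) hdisj
  refine ⟨chordal.toDisk (Y * Complex.I), ?_, κ, hκ, fun K g f F h hK a ha => ?_⟩
  · simpa using chordal.toDisk_mem_ball hz
  have h1 := h.im_le hz
  have h2 := h.norm_sub_le hR hK hz
  have h3 : ((Y : ℂ) * Complex.I).im = 2 * R := by simp [hY]
  have h4 : R ^ 2 / (2 * R) ≤ R := by
    rw [div_le_iff₀ (by positivity)]
    nlinarith
  have hfA : f (Y * Complex.I) ∈ A := by
    refine ⟨mem_closedBall_zero_iff.2 ?_, ?_⟩
    · have h5 := norm_le_norm_add_norm_sub' (f (Y * Complex.I)) (Y * Complex.I)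
      have h6 : ‖(Y * Complex.I : ℂ)‖ = 2 * R := by
        rw [norm_mul, Complex.norm_I, mul_one, Complex.norm_real, Real.norm_of_nonneg (by positivity)]
      rw [h3] at h2
      linarith
    · rw [h3] at h1
      exact h1
  have h5 := hlt (F (chordal.toDisk (Y * Complex.I)))
    (by rw [h.conj _ hz]; exact mem_image_of_mem _ hfA) a
    (ha.imp_right fun ha => image_mono (subset_inter hK h.isHull.subset) ha)
  rw [edist_nndist, ENNReal.coe_lt_coe] at h5
  rw [← dist_eq_norm]
  exact h5.le

/-! ### Convergence of mapping-out functions and of capacities -/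

/-- Continuous convergence along ultrafilters on a compact set is uniform convergence. -/
theorem tendstoUniformlyOn_of_forall_ultrafilter {ι : Type*} {l : Filter ι} {K : Set ℂ}
    (hK : IsCompact K) {F : ι → ℂ → ℂ} {F₀ : ℂ → ℂ} (hF₀ : ContinuousOn F₀ K)
    (h : ∀ u : Ultrafilter ι, (u : Filter ι) ≤ l → ∀ x : ι → ℂ, (∀ᶠ i in u, x i ∈ K) → ∀ a ∈ K,
      Tendsto x u (𝓝 a) → Tendsto (fun i => F i (x i)) u (𝓝 (F₀ a))) :
    TendstoUniformlyOn F F₀ l K := by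
  rw [Metric.tendstoUniformlyOn_iff]
  intro ε hε
  by_contra hcon
  have hfreq : ∃ᶠ i in l, ∃ x ∈ K, ε ≤ dist (F₀ x) (F i x) := by
    refine fun hn => hcon (hn.mono fun i hi x hx => ?_)
    exact not_le.1 fun hle => hi ⟨x, hx, hle⟩
  have := frequently_iff_neBot.1 hfreq
  set u := Ultrafilter.of (l ⊓ 𝓟 {i | ∃ x ∈ K, ε ≤ dist (F₀ x) (F i x)})
  have hu : (u : Filter ι) ≤ _ := Ultrafilter.of_le _
  have hbad : ∀ᶠ i in (u : Filter ι), ∃ x ∈ K, ε ≤ dist (F₀ x) (F i x) :=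
    hu (mem_inf_of_right (mem_principal_self _))
  have hch : ∀ i, ∃ x, (∃ x ∈ K, ε ≤ dist (F₀ x) (F i x)) → x ∈ K ∧ ε ≤ dist (F₀ x) (F i x) := by
    intro i
    by_cases hi : ∃ x ∈ K, ε ≤ dist (F₀ x) (F i x)
    · exact hi.imp fun x hx _ => hx
    · exact ⟨0, fun h => absurd h hi⟩
  choose x hx using hch
  have hxK : ∀ᶠ i in (u : Filter ι), x i ∈ K := hbad.mono fun i hi => (hx i hi).1
  obtain ⟨a, ha, hlim⟩ := hK.ultrafilter_le_nhds (u.map x) (le_principal_iff.2 hxK)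
  have hxa : Tendsto x u (𝓝 a) := hlim
  have h1 := h u (hu.trans inf_le_left) x hxK a ha hxa
  have h2 : Tendsto (fun i => F₀ (x i)) u (𝓝 (F₀ a)) :=
    (hF₀ a ha).tendsto.comp (tendsto_nhdsWithin_iff.2 ⟨hxa, hxK⟩)
  have h3 := h2.dist h1
  rw [dist_self] at h3
  obtain ⟨i, hi1, hi2⟩ := ((h3.eventually (gt_mem_nhds hε)).and hbad).exists
  exact absurd hi1 (not_lt.2 (hx i hi2).2)

theorem tendstoUniformlyOn_iff_forall_ultrafilter {ι : Type*} {l : Filter ι} {K : Set ℂ}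
    {F : ι → ℂ → ℂ} {F₀ : ℂ → ℂ} : TendstoUniformlyOn F F₀ l K ↔
      ∀ u : Ultrafilter ι, (u : Filter ι) ≤ l → TendstoUniformlyOn F F₀ u K := by
  refine ⟨fun h u hu s hs => hu (h s hs), fun h s hs => mem_iff_ultrafilter.2 fun u hu => ?_⟩
  exact h u hu s hs

theorem TendstoUniformlyOn.tendsto_apply {ι : Type*} {l : Filter ι} {K : Set ℂ}
    {F : ι → ℂ → ℂ} {F₀ : ℂ → ℂ} (h : TendstoUniformlyOn F F₀ l K) (hF₀ : ContinuousOn F₀ K)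
    {x : ι → ℂ} (hx : ∀ᶠ i in l, x i ∈ K) {a : ℂ} (ha : a ∈ K) (hxa : Tendsto x l (𝓝 a)) :
    Tendsto (fun i => F i (x i)) l (𝓝 (F₀ a)) := by
  have h2 : Tendsto (fun i => F₀ (x i)) l (𝓝 (F₀ a)) :=
    (hF₀ a ha).tendsto.comp (tendsto_nhdsWithin_iff.2 ⟨hxa, hx⟩)
  rw [Metric.tendsto_nhds] at h2 ⊢
  intro ε hε
  filter_upwards [h2 _ (half_pos hε), Metric.tendstoUniformlyOn_iff.1 h _ (half_pos hε), hx]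
    with i h3 h4 h5
  have := dist_triangle (F i (x i)) (F₀ (x i)) (F₀ a)
  have h6 := h4 _ h5
  rw [dist_comm] at h6
  linarith

namespace LoewnerCase

variable {G : LoewnerCase} {K : Set ℂ} {g f F : ℂ → ℂ}

/-- The target point in disk coordinates. -/
def diskTarget : LoewnerCase → ℂ
  | radial => 0
  | chordal => -1

theorem IsHull.diskTarget_notMem (hK : G.IsHull K) : G.diskTarget ∉ G.toDisk '' K := by
  rintro ⟨z, hz, h⟩
  cases G
  · have h' : z = 0 := h
    exact hK.avoidsTarget (h' ▸ hz)
  · exact (chordal.toDisk_mem_diskImage (hK.subset hz)).2 h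

theorem norm_le_of_toDisk_chordal {z : ℂ} (hz : 0 ≤ z.im) {r : ℝ} (hr : 0 < r)
    (h : r ≤ ‖chordal.toDisk z - chordal.diskTarget‖) : ‖z‖ ≤ 4 / r + 2 := by
  have h0 := norm_pos_iff.2 (two_I_add_ne_zero hz)
  rw [diskTarget, sub_neg_eq_add, norm_toDisk_chordal_add_one hz, le_div_iff₀ h0] at h
  have h1 : ‖2 * Complex.I + z‖ ≤ 4 / r := by
    rw [le_div_iff₀ hr]
    linarith
  have h2 := norm_sub_le (2 * Complex.I + z) (2 * Complex.I)
  rw [add_sub_cancel_left] at h2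
  have h3 : ‖(2 * Complex.I : ℂ)‖ = 2 := by simp
  linarith

namespace IsDiskModel

theorem isNormalizedInverse (h : G.IsDiskModel K g f F) : G.IsNormalizedInverse f :=
  h.mappingOut.isNormalizedInverse h.isHull h.differentiableOn h.left_inv h.right_inv

theorem eq_fromDisk (h : G.IsDiskModel K g f F) {z : ℂ} (hz : z ∈ G.domain) :
    f z = G.fromDisk (F (G.toDisk z)) := by
  rw [h.conj z hz, G.fromDisk_toDisk (subset_closure (h.bijOn.mapsTo hz).1)]

/-- A second uniformizer that is normalized in the same way is the same. -/
theorem eqOn_of_isUniformizer (h : G.IsDiskModel K g f F) {F' : ℂ → ℂ}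
    (hF' : IsUniformizer (G.toDisk '' K) F') (hc : ContinuousOn F' (Metric.closedBall 0 1))
    (hn : G.IsNormalizedInverse fun z => G.fromDisk (F' (G.toDisk z))) :
    EqOn F' F (Metric.closedBall 0 1) := by
  have hb := bijOn_toDisk_diff h.isHull.subset
  have hb' : BijOn G.fromDisk (Metric.ball 0 1 \ G.toDisk '' K) (G.domain \ K) := by
    refine ⟨fun u hu => ?_, G.bijOn_fromDisk.injOn.mono sdiff_subset, fun z hz =>
      ⟨_, hb.mapsTo hz, G.fromDisk_toDisk (subset_closure hz.1)⟩⟩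
    obtain ⟨z, hz, rfl⟩ := hb.surjOn hu
    rwa [G.fromDisk_toDisk (subset_closure hz.1)]
  have hbij : BijOn (fun z => G.fromDisk (F' (G.toDisk z))) G.domain (G.domain \ K) :=
    hb'.comp (hF'.bijOn.comp G.bijOn_toDisk)
  have hd : DifferentiableOn ℂ (fun z => G.fromDisk (F' (G.toDisk z))) G.domain :=
    G.differentiableOn_fromDisk.comp (hF'.differentiableOn.comp G.differentiableOn_toDisk
      G.bijOn_toDisk.mapsTo) fun z hz => hF'.mapsTo_ball (G.toDisk_mem_ball hz)
  have hball : EqOn F' F (Metric.ball 0 1) := by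
    intro u hu
    obtain ⟨z, hz, rfl⟩ := G.bijOn_toDisk.surjOn hu
    have h1 := h.mappingOut.comp_eq h.isHull hd hbij hn hz
    have h2 := h.right_inv _ (hbij.mapsTo hz)
    rw [h1] at h2
    rw [h.conj z hz, h2,
      G.toDisk_fromDisk (G.ball_subset_diskImage (hF'.mapsTo_ball (G.toDisk_mem_ball hz)))]
  exact hball.of_subset_closure hc h.continuousOn Metric.ball_subset_closedBall
    closedBall_subset_closure_ball

theorem map_zero (h : radial.IsDiskModel K g f F) : F 0 = 0 := by
  have := h.conj 0 (by simp [domain])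
  rwa [show radial.toDisk 0 = 0 from rfl, h.isNormalizedInverse.1] at this

theorem deriv_zero (h : radial.IsDiskModel K g f F) : deriv F 0 = deriv f 0 := by
  refine Filter.EventuallyEq.deriv_eq ?_
  filter_upwards [radial.isOpen_domain.mem_nhds (show (0 : ℂ) ∈ radial.domain by simp [domain])]
    with z hz using h.conj z hz

theorem deriv_mul_deriv (h : radial.IsDiskModel K g f F) : deriv g 0 * deriv F 0 = 1 := by
  have h0 : (0 : ℂ) ∈ radial.domain := by simp [domain]
  have h0K : (0 : ℂ) ∈ radial.domain \ K := ⟨h0, h.isHull.avoidsTarget⟩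
  have hf0 : f 0 = 0 := h.isNormalizedInverse.1
  have dg : HasDerivAt g (deriv g 0) (f 0) := by
    rw [hf0]
    exact (h.mappingOut.differentiableOn.differentiableAt
      (h.isHull.isOpen_diff.mem_nhds h0K)).hasDerivAt
  have df := (h.differentiableOn.differentiableAt (radial.isOpen_domain.mem_nhds h0)).hasDerivAt
  have h2 : HasDerivAt (g ∘ f) 1 0 := (hasDerivAt_id 0).congr_of_eventuallyEq (by
    filter_upwards [radial.isOpen_domain.mem_nhds h0] with z hz using h.left_inv z hz)
  rw [h.deriv_zero]
  exact (dg.comp 0 df).unique h2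

theorem deriv_eq_exp (h : radial.IsDiskModel K g f F) {T : ℝ}
    (hT : radial.CapacityExpansion K g T) : deriv F 0 = (Real.exp (-T) : ℂ) := by
  rw [← show (deriv g 0)⁻¹ = (Real.exp (-T) : ℂ) from hT]
  exact eq_inv_of_mul_eq_one_right h.deriv_mul_deriv

theorem tendsto_deriv {ι : Type*} {l : Filter ι} {K : ι → Set ℂ} {g f F : ι → ℂ → ℂ}
    (h : ∀ i, radial.IsDiskModel (K i) (g i) (f i) (F i)) {F₀ : ℂ → ℂ}
    (hF : TendstoUniformlyOn F F₀ l (Metric.closedBall 0 1)) :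
    Tendsto (fun i => deriv (F i) 0) l (𝓝 (deriv F₀ 0)) := by
  rcases l.eq_or_neBot with rfl | hl
  · exact tendsto_bot
  have h1 : TendstoLocallyUniformlyOn F F₀ l (Metric.ball 0 1) :=
    (hF.mono Metric.ball_subset_closedBall).tendstoLocallyUniformlyOn
  exact (h1.deriv (.of_forall fun i => (h i).uniformizer.differentiableOn)
    Metric.isOpen_ball).tendsto_at (by simp)

theorem im_boundary_eq_zero (h : chordal.IsDiskModel K g f F) {x : ℂ} (hx : x.im = 0)
    (hF : F (chordal.toDisk x) ∉ chordal.toDisk '' K) :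
    (chordal.fromDisk (F (chordal.toDisk x))).im = 0 := by
  refine (h.im_boundary_eq_zero_or_mem hx).resolve_right fun hK => hF ?_
  have hxc : x ∈ closure chordal.domain := by
    rw [closure_domain_chordal]
    exact hx.ge
  exact ⟨_, hK, chordal.toDisk_fromDisk (h.mapsTo_diskImage (chordal.toDisk_mem_diskImage hxc))⟩

/-- Capacities depend continuously on the uniformizers, as long as the hulls stay away from the
target point. -/
theorem tendsto_capacity {ι : Type*} {l : Filter ι} {K' : ι → Set ℂ} {g' f' F' : ι → ℂ → ℂ}
    (h' : ∀ i, G.IsDiskModel (K' i) (g' i) (f' i) (F' i)) (h : G.IsDiskModel K g f F)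
    (hF : TendstoUniformlyOn F' F l (Metric.closedBall 0 1)) {r : ℝ} (hr : 0 < r)
    (hr' : ∀ᶠ i in l, ∀ a ∈ G.toDisk '' K' i, r ≤ ‖a - G.diskTarget‖)
    (hrK : ∀ a ∈ G.toDisk '' K, r ≤ ‖a - G.diskTarget‖)
    {T' : ι → ℝ} {T : ℝ} (hT' : ∀ i, G.CapacityExpansion (K' i) (g' i) (T' i))
    (hT : G.CapacityExpansion K g T) : Tendsto T' l (𝓝 T) := by
  cases G
  · have h1 := tendsto_deriv h' hF
    simp only [(h' _).deriv_eq_exp (hT' _), h.deriv_eq_exp hT] at h1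
    have h2 := (Complex.continuous_re.tendsto _).comp h1
    have h3 : Tendsto (fun i => Real.exp (-T' i)) l (𝓝 (Real.exp (-T))) := h2
    have h4 := ((Real.continuousAt_log (Real.exp_pos _).ne').tendsto.comp h3).neg
    simpa [Function.comp_def] using h4
  · obtain ⟨δ, hδ, hnear⟩ := Metric.continuousOn_iff.1 h.continuousOn (-1) (by simp) (r / 2)
      (by positivity)
    rw [h.map_neg_one] at hnear
    set M := 4 / δ + 2
    have hM : 0 < M := by positivity
    have hfar : ∀ x : ℂ, x.im = 0 → M < ‖x‖ → ‖F (chordal.toDisk x) + 1‖ < r / 2 ∧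
        chordal.toDisk x ∈ Metric.closedBall (0 : ℂ) 1 := by
      intro x hx hMx
      have hxc : x ∈ closure chordal.domain := by
        rw [closure_domain_chordal]
        exact hx.ge
      have h1 := (chordal.toDisk_mem_diskImage hxc).1
      have h2 : ‖chordal.toDisk x - chordal.diskTarget‖ < δ := not_le.1 fun hle =>
        absurd (norm_le_of_toDisk_chordal hx.ge hδ hle) (not_le.2 hMx)
      have h3 := hnear _ h1 (by rwa [dist_eq_norm])
      rw [dist_eq_norm, sub_neg_eq_add] at h3
      exact ⟨h3, h1⟩
    have hclose : ∀ ε > 0, ∀ᶠ i in l, ∀ x : ℂ, x.im = 0 → ‖x‖ ≤ M →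
        |(chordal.fromDisk (F (chordal.toDisk x))).im -
          (chordal.fromDisk (F' i (chordal.toDisk x))).im| ≤ ε := by
      have hKc : IsCompact (Metric.closedBall (0 : ℂ) M ∩ {x | x.im = 0}) :=
        (isCompact_closedBall _ _).inter_right (isClosed_eq Complex.continuous_im continuous_const)
      have hsub : Metric.closedBall (0 : ℂ) M ∩ {x | x.im = 0} ⊆ closure chordal.domain := by
        rw [closure_domain_chordal]
        exact fun x hx => hx.2.ge
      have hin : ∀ x ∈ Metric.closedBall (0 : ℂ) M ∩ {x | x.im = 0},
          chordal.toDisk x ∈ chordal.diskImage := fun x hx => chordal.toDisk_mem_diskImage (hsub hx)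
      have hcont : ContinuousOn (fun x => chordal.fromDisk (F (chordal.toDisk x)))
          (Metric.closedBall (0 : ℂ) M ∩ {x | x.im = 0}) :=
        chordal.continuousOn_fromDisk.comp (h.continuousOn.comp
          (chordal.continuousOn_toDisk.mono hsub) fun x hx => (hin x hx).1)
          fun x hx => h.mapsTo_diskImage (hin x hx)
      have huni : TendstoUniformlyOn (fun i x => chordal.fromDisk (F' i (chordal.toDisk x)))
          (fun x => chordal.fromDisk (F (chordal.toDisk x))) l
          (Metric.closedBall (0 : ℂ) M ∩ {x | x.im = 0}) := by
        refine tendstoUniformlyOn_of_forall_ultrafilter hKc hcont fun u hu x hx a ha hxa => ?_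
        have h1 : Tendsto (fun i => chordal.toDisk (x i)) u (𝓝 (chordal.toDisk a)) :=
          (chordal.continuousOn_toDisk a (hsub ha)).tendsto.comp
            (tendsto_nhdsWithin_iff.2 ⟨hxa, hx.mono fun i hi => hsub hi⟩)
        have h2 := (tendstoUniformlyOn_iff_forall_ultrafilter.1 hF u hu).tendsto_apply h.continuousOn
          (hx.mono fun i hi => (hin _ hi).1) (hin a ha).1 h1
        exact (chordal.continuousOn_fromDisk _ (h.mapsTo_diskImage (hin a ha))).tendsto.comp
          (tendsto_nhdsWithin_iff.2 ⟨h2, hx.mono fun i hi => (h' i).mapsTo_diskImage (hin _ hi)⟩)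
      intro ε hε
      filter_upwards [Metric.tendstoUniformlyOn_iff.1 huni ε hε] with i hi x hx hxM
      have := hi x ⟨by simpa using hxM, hx⟩
      rw [dist_eq_norm] at this
      rw [← Complex.sub_im]
      exact (Complex.abs_im_le_norm _).trans this.le
    rw [Metric.tendsto_nhds]
    intro ε hε
    filter_upwards [hclose (ε / (2 * M)) (by positivity), hr',
      Metric.tendstoUniformlyOn_iff.1 hF (r / 2) (by positivity)] with i h1 h2 h3
    have hz : ∀ x : ℂ, x.im = 0 → M < ‖x‖ → (chordal.fromDisk (F (chordal.toDisk x))).im = 0 := by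
      intro x hx hMx
      refine h.im_boundary_eq_zero hx fun hK => ?_
      have h4 := hrK _ hK
      rw [diskTarget, sub_neg_eq_add] at h4
      linarith [(hfar x hx hMx).1]
    have hz' : ∀ x : ℂ, x.im = 0 → M < ‖x‖ →
        (chordal.fromDisk (F' i (chordal.toDisk x))).im = 0 := by
      intro x hx hMx
      refine (h' i).im_boundary_eq_zero hx fun hK => ?_
      have h4 := h2 _ hK
      have h5 := h3 _ (hfar x hx hMx).2
      rw [diskTarget, sub_neg_eq_add] at h4
      rw [dist_comm, dist_eq_norm] at h5
      have h6 := norm_add_le (F' i (chordal.toDisk x) - F (chordal.toDisk x))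
        (F (chordal.toDisk x) + 1)
      rw [← add_assoc, sub_add_cancel] at h6
      linarith [(hfar x hx hMx).1]
    have e1 : M * (ε / (2 * M)) = ε / 2 := by field_simp
    have hle1 := h.capacity_le (h' i) hT (hT' i) hM (ε := ε / (2 * M)) (by positivity)
      (fun x hx hxM => by linarith [(abs_le.1 (h1 x hx hxM)).2])
      (fun x hx hxM => by rw [hz x hx hxM, hz' x hx hxM])
    have hle2 := (h' i).capacity_le h (hT' i) hT hM (ε := ε / (2 * M)) (by positivity)
      (fun x hx hxM => by linarith [(abs_le.1 (h1 x hx hxM)).1])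
      (fun x hx hxM => by rw [hz x hx hxM, hz' x hx hxM])
    rw [Real.dist_eq, abs_lt]
    constructor <;> linarith

end IsDiskModel

end LoewnerCase

/-! ### Convergence of simple curves -/

namespace StoppedCurve

variable {G : LoewnerCase}

theorem continuous_unitPath (γ : StoppedCurve G) : Continuous γ.unitPath := by
  refine γ.continuous_diskCurve.comp ?_
  refine Continuous.mul ?_ continuous_const
  exact Continuous.subtype_mk continuous_subtype_val _

theorem edist_diskCurve_le (γ η : StoppedCurve G) (t : ℝ≥0) :
    edist (γ.diskCurve t) (η.diskCurve t) ≤ distance .capacity γ η :=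
  le_iSup (fun t => edist (G.toDisk (γ.toFun t)) (G.toDisk (η.toFun t))) t

theorem norm_diskCurve_sub_lt {γ η : StoppedCurve G} {ε : ℝ}
    (h : distance .capacity γ η < ENNReal.ofReal ε) (t : ℝ≥0) :
    ‖γ.diskCurve t - η.diskCurve t‖ < ε := by
  have h1 := (edist_diskCurve_le γ η t).trans_lt h
  rw [edist_dist, dist_eq_norm] at h1
  exact (ENNReal.ofReal_lt_ofReal_iff_of_nonneg (norm_nonneg _)).1 h1

theorem diskCurve_stopped (γ : StoppedCurve G) {t : ℝ≥0} (ht : γ.lifetime ≤ t) :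
    γ.diskCurve t = γ.diskCurve γ.lifetime := by rw [diskCurve, γ.stopped t ht]; rfl

theorem diskCurve_min (γ : StoppedCurve G) (t : ℝ≥0) :
    γ.diskCurve (min t γ.lifetime) = γ.diskCurve t := by
  rcases le_total t γ.lifetime with h | h
  · rw [min_eq_left h]
  · rw [min_eq_right h, γ.diskCurve_stopped h]

theorem arcsWithin_of_capacity {γ γ' : StoppedCurve G} {ε : ℝ}
    (h : distance .capacity γ' γ < ENNReal.ofReal ε) :
    ArcsWithin ε γ.diskCurve γ.lifetime γ'.diskCurve γ'.lifetime := by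
  refine ⟨⟨fun s => min s γ.lifetime, fun s _ t _ hst => min_le_min_right _ hst, fun s hs =>
    ⟨min_le_right _ _, ?_⟩⟩, fun t ht => ⟨min t γ'.lifetime, min_le_right _ _, ?_⟩⟩
  · rw [γ.diskCurve_min]
    exact (norm_diskCurve_sub_lt h s).le
  · rw [γ'.diskCurve_min]
    exact (norm_diskCurve_sub_lt h t).le

theorem unitPath_eq (γ : StoppedCurve G) (s : unitInterval) :
    γ.unitPath s = γ.diskCurve (unitInterval.toNNReal s * γ.lifetime) := rfl

theorem diskCurve_eq_unitPath (γ : StoppedCurve G) {t : ℝ≥0} (ht : t ≤ γ.lifetime) :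
    ∃ h, γ.unitPath ⟨(t / γ.lifetime : ℝ≥0), h⟩ = γ.diskCurve t := by
  have h1 : t / γ.lifetime ≤ 1 := div_le_one_of_le₀ ht zero_le
  refine ⟨⟨NNReal.coe_nonneg _, by exact_mod_cast h1⟩, ?_⟩
  rw [unitPath_eq]
  congr 1
  change t / γ.lifetime * γ.lifetime = t
  rcases eq_or_ne γ.lifetime 0 with h0 | h0
  · rw [h0] at ht ⊢
    rw [mul_zero, le_zero_iff.1 ht]
  · exact div_mul_cancel₀ _ h0

theorem arcsWithin_of_unparameterized {γ γ' : StoppedCurve G} {ε : ℝ}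
    (h : distance .unparameterized γ' γ < ENNReal.ofReal ε) :
    ArcsWithin ε γ.diskCurve γ.lifetime γ'.diskCurve γ'.lifetime := by
  obtain ⟨σ, hσ⟩ := iInf_lt_iff.1 h
  have hσ' : ∀ s, ‖γ'.unitPath s - γ.unitPath (σ s)‖ ≤ ε := fun s => by
    have h1 := (le_iSup (fun s => edist (γ'.unitPath s) (γ.unitPath (σ s))) s).trans_lt hσ
    rw [edist_dist, dist_eq_norm] at h1
    exact ((ENNReal.ofReal_lt_ofReal_iff_of_nonneg (norm_nonneg _)).1 h1).le
  set p : ℝ≥0 → unitInterval := fun t => projIcc (0 : ℝ) 1 zero_le_one (t / γ'.lifetime : ℝ≥0)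
  have hp : Monotone p := fun s t hst => monotone_projIcc _ (by
    have : s / γ'.lifetime ≤ t / γ'.lifetime := by gcongr
    exact_mod_cast this)
  refine ⟨⟨fun t => unitInterval.toNNReal (σ (p t)) * γ.lifetime, fun s _ t _ hst => ?_, fun t ht =>
    ⟨?_, ?_⟩⟩, fun t ht => ?_⟩
  · refine mul_le_mul_left ?_ _
    exact σ.monotone (hp hst)
  · exact mul_le_of_le_one_left zero_le (σ (p t)).2.2
  · obtain ⟨h1, h2⟩ := γ'.diskCurve_eq_unitPath ht
    have h3 : p t = ⟨_, h1⟩ := projIcc_of_mem _ h1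
    rw [← h2, ← unitPath_eq, h3]
    exact hσ' _
  · obtain ⟨h1, h2⟩ := γ.diskCurve_eq_unitPath ht
    set s := σ.symm ⟨_, h1⟩
    have h3 := hσ' s
    rw [σ.apply_symm_apply, h2, unitPath_eq] at h3
    exact ⟨_, mul_le_of_le_one_left zero_le s.2.2, h3⟩

variable {ι : Type*} {l : Filter ι} {γ : StoppedCurve G} {γ' : ι → StoppedCurve G}
  {g f F : ℂ → ℂ} {w : ℂ} {g' f' F' : ι → ℂ → ℂ} {w' : ι → ℂ}

/-- Curves close to `γ` stay away from the target point. -/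
theorem exists_separation_target (hK : G.IsHull γ.trace)
    (hw : ∀ η > 0, ∀ᶠ i in l, ArcsWithin η γ.diskCurve γ.lifetime (γ' i).diskCurve (γ' i).lifetime) :
    ∃ r > 0, (∀ a ∈ G.toDisk '' γ.trace, r ≤ ‖a - G.diskTarget‖) ∧
      ∀ᶠ i in l, ∀ a ∈ G.toDisk '' (γ' i).trace, r ≤ ‖a - G.diskTarget‖ := by
  have hc : IsCompact (G.toDisk '' γ.trace) :=
    hK.isCompact.image_of_continuousOn (G.continuousOn_toDisk.mono hK.subset)
  obtain ⟨r, hr, hball⟩ := Metric.isOpen_iff.1 hc.isClosed.isOpen_compl _ hK.diskTarget_notMem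
  have h1 : ∀ a ∈ G.toDisk '' γ.trace, r ≤ ‖a - G.diskTarget‖ := fun a ha =>
    not_lt.1 fun hlt => hball (mem_ball_iff_norm.2 hlt) ha
  refine ⟨r / 2, by positivity, fun a ha => by linarith [h1 a ha], ?_⟩
  filter_upwards [hw (r / 2) (by positivity)] with i hi a ha
  rw [trace, ← diskCurve_image] at ha
  obtain ⟨s, hs, rfl⟩ := ha
  obtain ⟨⟨φ, -, hφ⟩, -⟩ := hi
  obtain ⟨h2, h3⟩ := hφ s hs.2
  have h4 := h1 (γ.diskCurve (φ s)) (by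
    rw [trace, ← diskCurve_image]
    exact mem_image_of_mem _ ⟨zero_le, h2⟩)
  have h5 := norm_add_le ((γ' i).diskCurve s - G.diskTarget)
    (γ.diskCurve (φ s) - (γ' i).diskCurve s)
  rw [sub_add_sub_comm, add_comm, add_sub_add_comm, sub_self, add_zero] at h5
  rw [norm_sub_rev] at h3
  linarith

/-- Mapping-out functions converge when the curves converge to a simple curve. -/
theorem IsSimple.tendstoUniformlyOn (hγ : γ.IsSimple) (hγ' : ∀ i, (γ' i).IsSimple)
    (h : G.IsDiskModel γ.trace g f F)
    (h' : ∀ i, G.IsDiskModel (γ' i).trace (g' i) (f' i) (F' i))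
    (hw : ∀ η > 0, ∀ᶠ i in l, ArcsWithin η γ.diskCurve γ.lifetime (γ' i).diskCurve (γ' i).lifetime) :
    TendstoUniformlyOn F' F l (Metric.closedBall 0 1) := by
  obtain ⟨r, hr, -, hsep⟩ := exists_separation_target h.isHull hw
  have hbound : G = LoewnerCase.chordal → ∀ᶠ i in l,
      (γ' i).trace ⊆ Metric.closedBall 0 (4 / r + 2) := by
    rintro rfl
    filter_upwards [hsep] with i hi z hz
    have hzc := (h' i).isHull.subset hz
    rw [LoewnerCase.closure_domain_chordal] at hzc
    simpa using LoewnerCase.norm_le_of_toDisk_chordal hzc hr (hi _ (mem_image_of_mem _ hz))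
  have hR : 0 < 4 / r + 2 := by positivity
  have hbase : ∃ z₀ : ℂ, ‖z₀‖ < 1 ∧ ∃ κ > 0, ∀ᶠ i in l,
      ∀ a ∈ Metric.sphere (0 : ℂ) 1 ∪ (γ' i).diskCurve '' Icc 0 (γ' i).lifetime,
        κ ≤ ‖F' i z₀ - a‖ := by
    cases G
    · refine ⟨0, by simp, min 1 r, by positivity, ?_⟩
      filter_upwards [hsep] with i hi a ha
      rw [(h' i).map_zero, zero_sub, norm_neg]
      rcases ha with ha | ha
      · rw [mem_sphere_zero_iff_norm.1 ha]
        exact min_le_left _ _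
      · rw [diskCurve_image] at ha
        have := hi a ha
        rw [LoewnerCase.diskTarget, sub_zero] at this
        exact (min_le_right _ _).trans this
    · obtain ⟨z₀, hz₀, κ, hκ, hall⟩ := LoewnerCase.exists_base_separation hR
      refine ⟨z₀, hz₀, κ, hκ, ?_⟩
      filter_upwards [hbound rfl] with i hi a ha
      rw [diskCurve_image] at ha
      exact hall _ _ _ _ (h' i) hi a ha
  obtain ⟨z₀, hz₀, κ, hκ, hbase⟩ := hbase
  rw [tendstoUniformlyOn_iff_forall_ultrafilter]
  intro u hu
  have htr : γ.diskCurve '' Icc 0 γ.lifetime = G.toDisk '' γ.trace := γ.diskCurve_image _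
  have hpre : IsPreconnected (Metric.ball (0 : ℂ) 1 \ γ.diskCurve '' Icc 0 γ.lifetime) := by
    rw [htr]
    exact h.uniformizer.isPreconnected
  obtain ⟨F₀, hF₀, hF₀c, hF₀u⟩ := hγ.isDiskArc.exists_tendstoUniformlyOn u hpre
    (fun i => (hγ' i).isDiskArc) (fun η hη => hu (hw η hη))
    (fun i => by rw [diskCurve_image]; exact (h' i).uniformizer) (fun i => (h' i).continuousOn)
    hz₀ hκ (hu hbase)
  rw [htr] at hF₀u
  refine hF₀.congr_right (h.eqOn_of_isUniformizer hF₀u hF₀c ?_)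
  have hz : ∀ z ∈ G.domain, Tendsto (fun i => f' i z) u (𝓝 (G.fromDisk (F₀ (G.toDisk z)))) := by
    intro z hz
    have h1 := hF₀.tendsto_at (Metric.ball_subset_closedBall (G.toDisk_mem_ball hz))
    have h2 : ContinuousAt G.fromDisk (F₀ (G.toDisk z)) :=
      (G.differentiableOn_fromDisk.differentiableAt (Metric.isOpen_ball.mem_nhds
        (hF₀u.mapsTo_ball (G.toDisk_mem_ball hz)))).continuousAt
    exact (h2.tendsto.comp h1).congr fun i => ((h' i).eq_fromDisk hz).symm
  cases G
  · have h0 : (0 : ℂ) ∈ Metric.ball (0 : ℂ) 1 := by simp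
    have hF0 : F₀ 0 = 0 := by
      have h1 := hF₀.tendsto_at (Metric.ball_subset_closedBall h0)
      exact tendsto_nhds_unique h1 (tendsto_const_nhds.congr fun i => ((h' i).map_zero).symm)
    obtain ⟨k, -, hkF, -, hkd⟩ := hF₀u.exists_inverse
    have hder := LoewnerCase.IsDiskModel.tendsto_deriv h' hF₀
    choose ρ hρ hρd using fun i => (h' i).isNormalizedInverse.2
    simp only [(h' _).deriv_zero, hρd] at hder
    have hre := (Complex.continuous_re.tendsto _).comp hder
    have him := (Complex.continuous_im.tendsto _).comp hder
    simp only [Function.comp_def, Complex.ofReal_re, Complex.ofReal_im] at hre him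
    have h1 : 0 ≤ (deriv F₀ 0).re := ge_of_tendsto' hre fun i => (hρ i).le
    have h2 : (deriv F₀ 0).im = 0 := (tendsto_nhds_unique him tendsto_const_nhds)
    have h3 : deriv F₀ 0 ≠ 0 := by
      have dF := (hF₀u.differentiableOn.differentiableAt (Metric.isOpen_ball.mem_nhds h0)).hasDerivAt
      have hopen : IsOpen (Metric.ball (0 : ℂ) 1 \
          LoewnerCase.radial.toDisk '' γ.trace) := by
        rw [← htr]
        exact Metric.isOpen_ball.sdiff hγ.isDiskArc.isCompact.isClosed
      have dk := (hkd.differentiableAt (hopen.mem_nhds (hF₀u.bijOn.mapsTo h0))).hasDerivAt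
      have h4 := dk.comp 0 dF
      have h5 : HasDerivAt (k ∘ F₀) 1 0 := (hasDerivAt_id 0).congr_of_eventuallyEq (by
        filter_upwards [Metric.isOpen_ball.mem_nhds h0] with z hz using hkF z hz)
      intro h6
      have h7 := h4.unique h5
      rw [h6, mul_zero] at h7
      exact zero_ne_one h7
    refine ⟨hF0, (deriv F₀ 0).re, lt_of_le_of_ne h1 fun h4 => h3 ?_, ?_⟩
    · exact Complex.ext h4.symm h2
    · exact Complex.ext rfl h2
  · refine ⟨fun k => k * Complex.I, ?_, by simp, ?_⟩
    · filter_upwards [eventually_gt_atTop 0] with k hk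
      simpa using hk
    · have hlim : Tendsto (fun k : ℕ => (4 / r + 2) ^ 2 / (k : ℝ)) atTop (𝓝 0) :=
        tendsto_const_nhds.div_atTop tendsto_natCast_atTop_atTop
      refine squeeze_zero_norm' ?_ hlim
      filter_upwards [eventually_gt_atTop 0] with k hk
      have him : ((k : ℂ) * Complex.I).im = k := by simp
      have hkR : 0 < ((k : ℂ) * Complex.I).im := by
        rw [him]
        exact_mod_cast hk
      have h1 := ((hz _ hkR).sub_const ((k : ℂ) * Complex.I)).norm
      refine le_of_tendsto h1 (hu ?_)
      filter_upwards [hbound rfl] with i hi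
      have := (h' i).norm_sub_le hR hi hkR
      rwa [him] at this

theorem IsTipModel.toDisk_mem_closedBall {γ : StoppedCurve G} (h : γ.IsTipModel g f F w) :
    G.toDisk w ∈ Metric.closedBall (0 : ℂ) 1 :=
  G.diskImage_subset_closedBall (G.toDisk_mem_diskImage (G.mem_boundary_iff.1 h.mem_boundary).1)

/-- The images of the tips converge because the tip of the limit has only one preimage. -/
theorem IsTipModel.tendsto_image_tip (h : γ.IsTipModel g f F w)
    (h' : ∀ i, (γ' i).IsTipModel (g' i) (f' i) (F' i) (w' i))
    (hF : TendstoUniformlyOn F' F l (Metric.closedBall 0 1))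
    (htip : Tendsto (fun i => G.toDisk (γ' i).tip) l (𝓝 (G.toDisk γ.tip))) :
    Tendsto w' l (𝓝 w) := by
  have h1 : Tendsto (fun i => G.toDisk (w' i)) l (𝓝 (G.toDisk w)) := by
    refine (isCompact_closedBall (0 : ℂ) 1).tendsto_nhds_of_unique_mapClusterPt
      (.of_forall fun i => (h' i).toDisk_mem_closedBall) fun y hy hcl => h.eq_of_map y hy ?_
    obtain ⟨u, hu, huy⟩ := mapClusterPt_iff_ultrafilter.1 hcl
    have h2 := (tendstoUniformlyOn_iff_forall_ultrafilter.1 hF u hu).tendsto_apply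
      h.model.continuousOn (.of_forall fun i => (h' i).toDisk_mem_closedBall) hy huy
    refine tendsto_nhds_unique h2 ((htip.mono_left hu).congr fun i => (h' i).map_tip.symm)
  have hwc := fun i => (G.mem_boundary_iff.1 (h' i).mem_boundary).1
  have hwc0 := (G.mem_boundary_iff.1 h.mem_boundary).1
  have h2 := (G.continuousOn_fromDisk _ (G.toDisk_mem_diskImage hwc0)).tendsto.comp
    (tendsto_nhdsWithin_iff.2 ⟨h1, .of_forall fun i => G.toDisk_mem_diskImage (hwc i)⟩)
  rw [G.fromDisk_toDisk hwc0] at h2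
  exact h2.congr fun i => G.fromDisk_toDisk (hwc i)

/-- Inverses of centered mapping-out functions converge uniformly in disk coordinates. -/
theorem IsTipModel.tendstoUniformlyOn_diskMap (h : γ.IsTipModel g f F w)
    (h' : ∀ i, (γ' i).IsTipModel (g' i) (f' i) (F' i) (w' i))
    (hF : TendstoUniformlyOn F' F l (Metric.closedBall 0 1)) (hw : Tendsto w' l (𝓝 w)) :
    TendstoUniformlyOn (fun i u => F' i (G.diskUncenter (w' i) u))
      (fun u => F (G.diskUncenter w u)) l (Metric.closedBall 0 1) := by
  refine tendstoUniformlyOn_of_forall_ultrafilter (isCompact_closedBall _ _)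
    h.continuousOn_diskMap fun u hu x hx a ha hxa => ?_
  refine (tendstoUniformlyOn_iff_forall_ultrafilter.1 hF u hu).tendsto_apply
    h.model.continuousOn (hx.mono fun i hi => G.diskUncenter_mapsTo (h' i).mem_boundary hi)
    (G.diskUncenter_mapsTo h.mem_boundary ha) ?_
  exact (G.continuousOn_diskUncenter (w, a) ⟨h.mem_boundary, ha⟩).tendsto.comp
    (tendsto_nhdsWithin_iff.2 ⟨(hw.mono_left hu).prodMk_nhds hxa,
      hx.mono fun i hi => ⟨(h' i).mem_boundary, hi⟩⟩)

end StoppedCurve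

/-! ### Conformal concatenation of simple curves -/

theorem IsSimplyConnected.of_bijOn {X Y : Type*} [TopologicalSpace X] [TopologicalSpace Y]
    {s : Set X} {t : Set Y} (hs : IsSimplyConnected s) {f : X → Y} {g : Y → X}
    (hf : ContinuousOn f s) (hg : ContinuousOn g t) (hst : MapsTo f s t) (hts : MapsTo g t s)
    (hinv : InvOn g f s t) : IsSimplyConnected t := by
  let e : s ≃ₜ t :=
    { toFun := hst.restrict f s t
      invFun := hts.restrict g t s
      left_inv := fun x => Subtype.ext (hinv.1 x.2)
      right_inv := fun y => Subtype.ext (hinv.2 y.2)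
      continuous_toFun := hf.mapsToRestrict hst
      continuous_invFun := hg.mapsToRestrict hts }
  exact e.toHomotopyEquiv.simplyConnectedSpace_iff.1 hs

namespace StoppedCurve.IsTipModel

variable {G : LoewnerCase} {γ : StoppedCurve G} {g f F : ℂ → ℂ} {w : ℂ}

/-- Boundary points are not taken into the complement of the trace: boundary points of the disk
go to the unit circle or to the trace. -/
theorem centeredInverse_notMem_of_mem_boundary (h : γ.IsTipModel g f F w) {z : ℂ} (hz : z ∈ G.boundary) :
    G.centeredInverse F w z ∉ G.domain \ γ.trace := by
  have hzc := (G.mem_boundary_iff.1 hz).1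
  have h1 := G.uncenter_mem_closure h.mem_boundary hzc
  have hnorm : ‖G.toDisk (G.uncenter w z)‖ = 1 := by
    refine le_antisymm (by simpa using G.diskImage_subset_closedBall (G.toDisk_mem_diskImage h1))
      (not_lt.1 fun hlt => (G.mem_boundary_iff.1 hz).2 ?_)
    have h2 := (G.toDisk_mem_ball_iff h1).1 (mem_ball_zero_iff.2 hlt)
    have h3 := G.center_mem_domain h.mem_boundary h2
    rwa [G.center_uncenter h.mem_boundary] at h3
  intro hmem
  have h2 := (LoewnerCase.bijOn_toDisk_diff h.model.isHull.subset).mapsTo hmem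
  rw [h.toDisk_centeredInverse hzc, G.diskUncenter_toDisk h.mem_boundary hzc] at h2
  rcases h.model.uniformizer.mapsTo_sphere h.model.continuousOn hnorm with h3 | h3
  · have h4 := h2.1
    rw [mem_ball_zero_iff, mem_sphere_zero_iff_norm.1 h3] at h4
    exact lt_irrefl _ h4
  · exact h2.2 h3

theorem centeredInverse_center (h : γ.IsTipModel g f F w) {z : ℂ} (hz : z ∈ G.domain \ γ.trace) :
    G.centeredInverse F w (G.center w (g z)) = z := by
  have h1 := h.model.mappingOut.bijOn.mapsTo hz
  rw [h.centeredInverse_eq (G.center_mem_domain h.mem_boundary h1),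
    G.uncenter_center h.mem_boundary, h.model.right_inv _ hz]

theorem mem_of_centeredInverse_mem (h : γ.IsTipModel g f F w) {z : ℂ} (hz : z ∈ closure G.domain)
    (hmem : G.centeredInverse F w z ∈ G.domain \ γ.trace) : z ∈ G.domain := by
  by_contra hzd
  exact h.centeredInverse_notMem_of_mem_boundary (G.mem_boundary_iff.2 ⟨hz, hzd⟩) hmem

theorem injOn_centeredInverse (h : γ.IsTipModel g f F w) :
    InjOn (G.centeredInverse F w) G.domain := fun x hx y hy hxy => by
  rw [← h.center_centeredInverse hx, hxy, h.center_centeredInverse hy]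

theorem bijOn_center (h : γ.IsTipModel g f F w) {K : Set ℂ} (hK : K ⊆ closure G.domain) :
    BijOn (fun z => G.center w (g z)) (G.domain \ (γ.trace ∪ G.centeredInverse F w '' K))
      (G.domain \ K) := by
  refine ⟨fun z hz => ?_, fun x hx y hy hxy => ?_, fun z hz => ?_⟩
  · have hz' : z ∈ G.domain \ γ.trace := ⟨hz.1, fun h => hz.2 (Or.inl h)⟩
    refine ⟨G.center_mem_domain h.mem_boundary (h.model.mappingOut.bijOn.mapsTo hz'), fun hmem => ?_⟩
    exact hz.2 (Or.inr ⟨_, hmem, h.centeredInverse_center hz'⟩)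
  · rw [← h.centeredInverse_center ⟨hx.1, fun h => hx.2 (Or.inl h)⟩,
      ← h.centeredInverse_center ⟨hy.1, fun h => hy.2 (Or.inl h)⟩]
    exact congrArg _ hxy
  · have h1 := h.centeredInverse_mem hz.1
    refine ⟨G.centeredInverse F w z, ⟨h1.1, ?_⟩, h.center_centeredInverse hz.1⟩
    rintro (h2 | ⟨k, hk, hkz⟩)
    · exact h1.2 h2
    · have h2 := h.mem_of_centeredInverse_mem (hK hk) (hkz ▸ h1)
      exact hz.2 (h.injOn_centeredInverse h2 hz.1 hkz ▸ hk)

/-- The centered inverse takes the complement of `K` onto the complement of the union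
homeomorphically, whence simple connectedness. -/
theorem isHull_union (h : γ.IsTipModel g f F w) {K : Set ℂ} (hK : G.IsHull K) :
    G.IsHull (γ.trace ∪ G.centeredInverse F w '' K) where
  isCompact := h.model.isHull.isCompact.union
    (hK.isCompact.image_of_continuousOn (h.continuousOn_centeredInverse.mono hK.subset))
  subset := union_subset h.model.isHull.subset
    (image_subset_iff.2 fun z hz => h.centeredInverse_mem_closure (hK.subset hz))
  simplyConnected := by
    have hb := h.bijOn_center hK.subset
    have hsub : G.domain \ (γ.trace ∪ G.centeredInverse F w '' K) ⊆ G.domain \ γ.trace :=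
      sdiff_subset_sdiff_right subset_union_left
    have hmaps : MapsTo (G.centeredInverse F w) (G.domain \ K)
        (G.domain \ (γ.trace ∪ G.centeredInverse F w '' K)) := by
      intro z hz
      obtain ⟨y, hy, rfl⟩ := hb.surjOn hz
      simpa only [h.centeredInverse_center (hsub hy)] using hy
    exact hK.simplyConnected.of_bijOn
      (h.continuousOn_centeredInverse.mono (sdiff_subset.trans subset_closure))
      ((G.differentiable_center w).continuous.comp_continuousOn
        (h.model.mappingOut.differentiableOn.continuousOn.mono hsub)) hmaps hb.mapsTo
      ⟨fun z hz => h.center_centeredInverse hz.1, fun z hz => h.centeredInverse_center (hsub hz)⟩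
  start_mem := Or.inl h.model.isHull.start_mem
  avoidsTarget := by
    cases G
    · rintro (h0 | ⟨k, hk, hk0⟩)
      · exact h.model.isHull.avoidsTarget h0
      · have h0 : (0 : ℂ) ∈ LoewnerCase.radial.domain := by simp [LoewnerCase.domain]
        have h1 : (0 : ℂ) ∈ LoewnerCase.radial.domain \ γ.trace := ⟨h0, h.model.isHull.avoidsTarget⟩
        have hkd := h.mem_of_centeredInverse_mem (hK.subset hk) (hk0 ▸ h1)
        have h2 := h.center_centeredInverse hkd
        rw [hk0, h.model.mappingOut.normalized.1] at h2
        have h3 : k = 0 := by simpa [LoewnerCase.center] using h2.symm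
        exact hK.avoidsTarget (h3 ▸ hk)
    · exact (h.model.isHull.isCompact.union (hK.isCompact.image_of_continuousOn
        (h.continuousOn_centeredInverse.mono hK.subset))).isBounded

/-- Composition of mapping-out functions; capacities add up. -/
theorem isHullOfCapacity_union (h : γ.IsTipModel g f F w) {T S : ℝ}
    (hT : G.CapacityExpansion γ.trace g T) {K : Set ℂ} (hK : G.IsHullOfCapacity K S) :
    G.IsHullOfCapacity (γ.trace ∪ G.centeredInverse F w '' K) (T + S) := by
  obtain ⟨hK, k, hk, hS⟩ := hK
  have hH := h.isHull_union hK
  have hb := h.bijOn_center hK.subset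
  have hsub : G.domain \ (γ.trace ∪ G.centeredInverse F w '' K) ⊆ G.domain \ γ.trace :=
    sdiff_subset_sdiff_right subset_union_left
  have hu : BijOn (G.uncenter w) G.domain G.domain :=
    ⟨fun z hz => G.uncenter_mem_domain h.mem_boundary hz, fun x _ y _ hxy => by
      rw [← G.center_uncenter h.mem_boundary (z := x), hxy, G.center_uncenter h.mem_boundary],
      fun z hz => ⟨_, G.center_mem_domain h.mem_boundary hz, G.uncenter_center h.mem_boundary⟩⟩
  have hd : DifferentiableOn ℂ (fun z => G.uncenter w (k (G.center w (g z))))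
      (G.domain \ (γ.trace ∪ G.centeredInverse F w '' K)) :=
    (G.differentiable_uncenter w).comp_differentiableOn (hk.differentiableOn.comp
      ((G.differentiable_center w).comp_differentiableOn
        (h.model.mappingOut.differentiableOn.mono hsub)) hb.mapsTo)
  have hbij : BijOn (fun z => G.uncenter w (k (G.center w (g z))))
      (G.domain \ (γ.trace ∪ G.centeredInverse F w '' K)) G.domain := hu.comp (hk.bijOn.comp hb)
  cases G
  · have hw0 : w ≠ 0 := by
      rintro rfl
      simpa [LoewnerCase.boundary] using h.mem_boundary
    have hg0 := h.model.mappingOut.normalized.1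
    have hk0 := hk.normalized.1
    have h0 : (0 : ℂ) ∈ LoewnerCase.radial.domain := by simp [LoewnerCase.domain]
    have dg : HasDerivAt g (deriv g 0) 0 := (h.model.mappingOut.differentiableOn.differentiableAt
      (h.model.isHull.isOpen_diff.mem_nhds ⟨h0, h.model.isHull.avoidsTarget⟩)).hasDerivAt
    have dc : HasDerivAt (fun z => w⁻¹ * g z) (w⁻¹ * deriv g 0) 0 := dg.const_mul _
    have dk : HasDerivAt k (deriv k 0) (w⁻¹ * g 0) := by
      rw [hg0, mul_zero]
      exact (hk.differentiableOn.differentiableAt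
        (hK.isOpen_diff.mem_nhds ⟨h0, hK.avoidsTarget⟩)).hasDerivAt
    have d := ((dk.comp 0 dc).const_mul w).deriv
    have d' : deriv (fun z => LoewnerCase.radial.uncenter w (k (LoewnerCase.radial.center w (g z)))) 0 =
        deriv k 0 * deriv g 0 := by
      refine d.trans ?_
      field_simp
    obtain ⟨r, hr, hgr⟩ := h.model.mappingOut.normalized.2
    obtain ⟨s, hs, hks⟩ := hk.normalized.2
    refine ⟨hH, _, ⟨hd, hbij, ?_, s * r, by positivity, ?_⟩, ?_⟩
    · simp [LoewnerCase.uncenter, LoewnerCase.center, hg0, hk0]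
    · rw [d', hgr, hks]
      push_cast
      rfl
    · have e1 : (deriv g 0)⁻¹ = (Real.exp (-T) : ℂ) := hT
      have e2 : (deriv k 0)⁻¹ = (Real.exp (-S) : ℂ) := hS
      change (deriv _ 0)⁻¹ = _
      rw [d', mul_inv, e1, e2, ← Complex.ofReal_mul, ← Real.exp_add]
      congr 2
      ring
  · set D := LoewnerCase.chordal.domain \ (γ.trace ∪ LoewnerCase.chordal.centeredInverse F w '' K)
      with hD
    have hle : Bornology.cobounded ℂ ⊓ 𝓟 D ≤
        Bornology.cobounded ℂ ⊓ 𝓟 (LoewnerCase.chordal.domain \ γ.trace) :=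
      inf_le_inf_left _ (principal_mono.2 hsub)
    have hev : ∀ᶠ z in Bornology.cobounded ℂ ⊓ 𝓟 D, z ∈ D := mem_inf_of_right (mem_principal_self _)
    have hg : Tendsto (fun z => g z - z) (Bornology.cobounded ℂ ⊓ 𝓟 D) (𝓝 0) :=
      (show Tendsto _ _ _ from h.model.mappingOut.normalized).mono_left hle
    have hu1 : Tendsto (fun z => g z - w - z) (Bornology.cobounded ℂ ⊓ 𝓟 D) (𝓝 (-w)) := by
      have := hg.sub_const w
      rw [zero_sub] at this
      exact this.congr fun z => by ring
    have hu2 : Tendsto (fun z => g z - w) (Bornology.cobounded ℂ ⊓ 𝓟 D)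
        (Bornology.cobounded ℂ ⊓ 𝓟 (LoewnerCase.chordal.domain \ K)) :=
      tendsto_inf.2 ⟨LoewnerCase.tendsto_cobounded_of_sub (tendsto_id.mono_left inf_le_left) hu1,
        tendsto_principal.2 (hev.mono fun z hz => hb.mapsTo hz)⟩
    have hk1 : Tendsto (fun z => k (g z - w) - (g z - w)) (Bornology.cobounded ℂ ⊓ 𝓟 D) (𝓝 0) :=
      Tendsto.comp (g := fun z : ℂ => k z - z) hk.normalized hu2
    have hk2 : Tendsto (fun z => (g z - w) * (k (g z - w) - (g z - w)))
        (Bornology.cobounded ℂ ⊓ 𝓟 D) (𝓝 ((2 * S : ℝ) : ℂ)) :=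
      Tendsto.comp (g := fun z : ℂ => z * (k z - z)) hS hu2
    have hT' : Tendsto (fun z => z * (g z - z)) (Bornology.cobounded ℂ ⊓ 𝓟 D)
        (𝓝 ((2 * T : ℝ) : ℂ)) := (show Tendsto _ _ _ from hT).mono_left hle
    refine ⟨hH, _, ⟨hd, hbij, ?_⟩, ?_⟩
    · have := hk1.add hg
      rw [add_zero] at this
      refine Tendsto.congr (fun z => ?_) this
      simp only [LoewnerCase.uncenter, LoewnerCase.center]
      ring
    · have := (hk2.sub (hu1.mul hk1)).add hT'
      rw [mul_zero, sub_zero, ← Complex.ofReal_add, ← mul_add, add_comm S] at this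
      refine Tendsto.congr (fun z => ?_) this
      simp only [LoewnerCase.uncenter, LoewnerCase.center]
      ring

end StoppedCurve.IsTipModel

namespace StoppedCurve

variable {G : LoewnerCase} {γ η : StoppedCurve G} {g f F : ℂ → ℂ} {w : ℂ}

theorem ext_toFun {γ η : StoppedCurve G} (hl : γ.lifetime = η.lifetime)
    (h : ∀ t, t ≤ γ.lifetime → γ.toFun t = η.toFun t) : γ = η := by
  have hfun : γ.toFun = η.toFun := by
    funext t
    rcases le_total t γ.lifetime with ht | ht
    · exact h t ht
    · rw [γ.stopped t ht, h _ le_rfl, hl, η.stopped t (hl ▸ ht)]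
  cases γ
  cases η
  cases hl
  cases hfun
  rfl

/-- The conformal concatenation of a simple curve, given by its tip model, and a curve that starts
at the starting point. -/
noncomputable def IsTipModel.concat (h : γ.IsTipModel g f F w) (η : StoppedCurve G)
    (hη : η.toFun 0 = G.start) : StoppedCurve G where
  lifetime := γ.lifetime + η.lifetime
  toFun t := if t ≤ γ.lifetime then γ.toFun t else
    G.centeredInverse F w (η.toFun (t - γ.lifetime))
  continuous_toFun := by
    refine γ.continuous_toFun.if_le ?_ continuous_id continuous_const fun t ht => ?_
    · exact h.continuousOn_centeredInverse.comp_continuous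
        (η.continuous_toFun.comp (continuous_id.sub continuous_const)) fun t => η.mem_closure _
    · rw [ht, tsub_self, hη, h.centeredInverse_start]
      rfl
  mem_closure t := by
    split_ifs
    · exact γ.mem_closure t
    · exact h.centeredInverse_mem_closure (η.mem_closure _)
  stopped t ht := by
    have h1 : η.lifetime ≤ t - γ.lifetime := le_tsub_of_add_le_left ht
    rw [add_tsub_cancel_left, η.stopped _ h1]
    by_cases h2 : γ.lifetime + η.lifetime ≤ γ.lifetime
    · have h3 : η.lifetime = 0 := by simpa using h2
      have h4 : γ.lifetime ≤ t := le_self_add.trans ht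
      rw [h3, add_zero, hη, h.centeredInverse_start, if_pos le_rfl, tip]
      split_ifs
      · exact γ.stopped t h4
      · rfl
    · rw [if_neg h2, if_neg fun h3 => h2 (ht.trans h3)]

theorem IsTipModel.concat_of_le (h : γ.IsTipModel g f F w) (hη : η.toFun 0 = G.start) {t : ℝ≥0}
    (ht : t ≤ γ.lifetime) : (h.concat η hη).toFun t = γ.toFun t := if_pos ht

theorem IsTipModel.concat_of_ge (h : γ.IsTipModel g f F w) (hη : η.toFun 0 = G.start) {t : ℝ≥0}
    (ht : γ.lifetime ≤ t) :
    (h.concat η hη).toFun t = G.centeredInverse F w (η.toFun (t - γ.lifetime)) := by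
  rcases ht.eq_or_lt with rfl | ht
  · rw [h.concat_of_le hη le_rfl, tsub_self, hη, h.centeredInverse_start]
    rfl
  · exact if_neg (not_le.2 ht)

/-- The concatenation exists and does not depend on the choice of the boundary extension, which is
unique on the closed domain. -/
theorem IsTipModel.isConcatenation_iff (h : γ.IsTipModel g f F w) (hη : η.toFun 0 = G.start)
    {ζ : StoppedCurve G} : IsConcatenation γ η ζ ↔ ζ = h.concat η hη := by
  constructor
  · rintro ⟨f', hf', hl, h1, h2⟩
    refine ext_toFun hl fun t ht => ?_
    rw [hl] at ht
    rcases le_or_gt t γ.lifetime with h3 | h3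
    · rw [h1 t h3, h.concat_of_le hη h3]
    · rw [h2 t h3 ht, h.concat_of_ge hη h3.le, h.eqOn_centeredInverse hf' (η.mem_closure _)]
  · rintro rfl
    exact ⟨_, h.isCenteredInverse, rfl, fun t ht => h.concat_of_le hη ht, fun t ht _ =>
      h.concat_of_ge hη ht.le⟩

/-- In disk coordinates the concatenation is a sum of three terms that are defined at all times. -/
theorem IsTipModel.diskCurve_concat (h : γ.IsTipModel g f F w) (hη : η.toFun 0 = G.start) (t : ℝ≥0) :
    (h.concat η hη).diskCurve t = γ.diskCurve t +
      F (G.diskUncenter w (η.diskCurve (t - γ.lifetime))) - γ.diskCurve γ.lifetime := by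
  have hstart : F (G.diskUncenter w (η.diskCurve 0)) = γ.diskCurve γ.lifetime := by
    rw [diskCurve, hη, ← h.toDisk_centeredInverse G.start_mem_closure, h.centeredInverse_start]
    rfl
  rcases le_total t γ.lifetime with ht | ht
  · rw [diskCurve, h.concat_of_le hη ht, tsub_eq_zero_of_le ht, hstart, add_sub_cancel_right]
    rfl
  · rw [γ.diskCurve_stopped ht, add_sub_cancel_left, diskCurve, h.concat_of_ge hη ht,
      h.toDisk_centeredInverse (η.mem_closure _)]
    rfl

theorem IsTipModel.segment_concat_of_le (h : γ.IsTipModel g f F w) (hη : η.toFun 0 = G.start)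
    {t : ℝ≥0} (ht : t ≤ γ.lifetime) : (h.concat η hη).segment t = γ.segment t :=
  image_congr fun _ hs => h.concat_of_le hη (hs.2.trans ht)

theorem IsTipModel.segment_concat_of_ge (h : γ.IsTipModel g f F w) (hη : η.toFun 0 = G.start)
    {t : ℝ≥0} (ht : γ.lifetime ≤ t) : (h.concat η hη).segment t =
      γ.trace ∪ G.centeredInverse F w '' η.segment (t - γ.lifetime) := by
  ext z
  constructor
  · rintro ⟨s, hs, rfl⟩
    rcases le_total s γ.lifetime with h1 | h1
    · rw [h.concat_of_le hη h1]
      exact Or.inl ⟨s, ⟨hs.1, h1⟩, rfl⟩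
    · rw [h.concat_of_ge hη h1]
      exact Or.inr ⟨_, ⟨_, ⟨zero_le, tsub_le_tsub_right hs.2 _⟩, rfl⟩, rfl⟩
  · rintro (⟨s, hs, rfl⟩ | ⟨_, ⟨s, hs, rfl⟩, rfl⟩)
    · exact ⟨s, ⟨hs.1, hs.2.trans ht⟩, h.concat_of_le hη hs.2⟩
    · refine ⟨γ.lifetime + s, ⟨zero_le, ?_⟩, ?_⟩
      · exact (add_le_add_right hs.2 _).trans_eq (add_tsub_cancel_of_le ht)
      · rw [h.concat_of_ge hη le_self_add, add_tsub_cancel_left]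

/-- The second piece lies in the image of the open domain, which is disjoint from the trace of the
first piece. -/
theorem IsTipModel.isSimple_concat (h : γ.IsTipModel g f F w) (hγ : γ.IsSimple)
    (hT : G.CapacityExpansion γ.trace g γ.lifetime) (hη : η.IsSimple) :
    (h.concat η hη.start_eq).IsSimple where
  start_eq := by rw [h.concat_of_le _ zero_le, hγ.start_eq]
  injOn := by
    have hdom : ∀ t, γ.lifetime < t → t ≤ γ.lifetime + η.lifetime →
        η.toFun (t - γ.lifetime) ∈ G.domain := fun t h1 h2 =>
      hη.mem_domain _ (tsub_pos_of_lt h1) (tsub_le_iff_left.2 h2)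
    have hmix : ∀ s t, s ≤ γ.lifetime → γ.lifetime < t → t ≤ γ.lifetime + η.lifetime →
        (h.concat η hη.start_eq).toFun s ≠ (h.concat η hη.start_eq).toFun t := by
      intro s t h1 h2 h3 heq
      rw [h.concat_of_le _ h1, h.concat_of_ge _ h2.le] at heq
      exact (h.centeredInverse_mem (hdom t h2 h3)).2 (heq ▸ ⟨s, ⟨zero_le, h1⟩, rfl⟩)
    intro s hs t ht heq
    rcases le_or_gt s γ.lifetime with h1 | h1 <;> rcases le_or_gt t γ.lifetime with h2 | h2
    · rw [h.concat_of_le _ h1, h.concat_of_le _ h2] at heq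
      exact hγ.injOn ⟨zero_le, h1⟩ ⟨zero_le, h2⟩ heq
    · exact absurd heq (hmix s t h1 h2 ht.2)
    · exact absurd heq.symm (hmix t s h2 h1 hs.2)
    · rw [h.concat_of_ge _ h1.le, h.concat_of_ge _ h2.le] at heq
      have h3 := h.injOn_centeredInverse (hdom s h1 hs.2) (hdom t h2 ht.2) heq
      have h4 := hη.injOn ⟨zero_le, tsub_le_iff_left.2 hs.2⟩ ⟨zero_le, tsub_le_iff_left.2 ht.2⟩ h3
      rw [← add_tsub_cancel_of_le h1.le, h4, add_tsub_cancel_of_le h2.le]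
  mem_domain t h0 ht := by
    rcases le_or_gt t γ.lifetime with h1 | h1
    · rw [h.concat_of_le _ h1]
      exact hγ.mem_domain t h0 h1
    · rw [h.concat_of_ge _ h1.le]
      exact (h.centeredInverse_mem (hη.mem_domain _ (tsub_pos_of_lt h1) (tsub_le_iff_left.2 ht))).1
  capacity_eq t ht := by
    rcases le_total t γ.lifetime with h1 | h1
    · rw [h.segment_concat_of_le _ h1]
      exact hγ.capacity_eq t h1
    · rw [h.segment_concat_of_ge _ h1]
      have h2 := h.isHullOfCapacity_union hT
        (hη.capacity_eq (t - γ.lifetime) (tsub_le_iff_left.2 ht))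
      rwa [← NNReal.coe_add, add_tsub_cancel_of_le h1] at h2

end StoppedCurve

/-! ### Convergence in the three metrics -/

theorem ENNReal.tendsto_zero_iff_ofReal {ι : Type*} {l : Filter ι} {u : ι → ℝ≥0∞} :
    Tendsto u l (𝓝 0) ↔ ∀ ε : ℝ, 0 < ε → ∀ᶠ i in l, u i ≤ ENNReal.ofReal ε := by
  rw [ENNReal.tendsto_nhds_zero]
  refine ⟨fun h ε hε => h _ (ENNReal.ofReal_pos.2 hε), fun h ε hε => ?_⟩
  obtain ⟨r, hr0, hr⟩ := ENNReal.lt_iff_exists_nnreal_btwn.1 hε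
  filter_upwards [h r (by exact_mod_cast hr0)] with i hi
  rw [ENNReal.ofReal_coe_nnreal] at hi
  exact hi.trans hr.le

theorem edist_le_ofReal_iff {a b : ℂ} {ε : ℝ} (hε : 0 ≤ ε) :
    edist a b ≤ ENNReal.ofReal ε ↔ ‖a - b‖ ≤ ε := by
  rw [edist_dist, ENNReal.ofReal_le_ofReal_iff hε, dist_eq_norm]

namespace StoppedCurve

variable {G : LoewnerCase} {ι : Type*} {l : Filter ι} {γ η : StoppedCurve G}
  {γ' η' : ι → StoppedCurve G}

theorem tendsto_capacity_iff : Tendsto (fun i => distance .capacity (γ' i) γ) l (𝓝 0) ↔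
    ∀ ε : ℝ, 0 < ε → ∀ᶠ i in l, ∀ t, ‖(γ' i).diskCurve t - γ.diskCurve t‖ ≤ ε := by
  rw [ENNReal.tendsto_zero_iff_ofReal]
  refine forall₂_congr fun ε hε => eventually_congr (.of_forall fun i => ?_)
  simp only [distance, iSup_le_iff, edist_le_ofReal_iff hε.le]
  rfl

theorem tendsto_euclidean_iff : Tendsto (fun i => distance .euclidean (γ' i) γ) l (𝓝 0) ↔
    ∀ ε : ℝ, 0 < ε → ∀ᶠ i in l, ∀ t, ‖(γ' i).toFun t - γ.toFun t‖ ≤ ε := by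
  rw [ENNReal.tendsto_zero_iff_ofReal]
  refine forall₂_congr fun ε hε => eventually_congr (.of_forall fun i => ?_)
  simp only [distance, iSup_le_iff, edist_le_ofReal_iff hε.le]

theorem tendsto_unparameterized_iff :
    Tendsto (fun i => distance .unparameterized (γ' i) γ) l (𝓝 0) ↔
      ∀ ε : ℝ, 0 < ε → ∀ᶠ i in l, ∃ σ : unitInterval ≃o unitInterval,
        ∀ s, ‖(γ' i).unitPath s - γ.unitPath (σ s)‖ ≤ ε := by
  rw [ENNReal.tendsto_zero_iff_ofReal]
  constructor
  · intro h ε hε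
    filter_upwards [h (ε / 2) (by positivity)] with i hi
    have h1 : distance .unparameterized (γ' i) γ < ENNReal.ofReal ε :=
      hi.trans_lt ((ENNReal.ofReal_lt_ofReal_iff hε).2 (by linarith))
    obtain ⟨σ, hσ⟩ := iInf_lt_iff.1 h1
    refine ⟨σ, fun s => (edist_le_ofReal_iff hε.le).1 ?_⟩
    exact (le_iSup (fun s => edist ((γ' i).unitPath s) (γ.unitPath (σ s))) s).trans hσ.le
  · intro h ε hε
    filter_upwards [h ε hε] with i ⟨σ, hσ⟩
    exact iInf_le_of_le σ (iSup_le fun s => (edist_le_ofReal_iff hε.le).2 (hσ s))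

theorem isCompact_range (γ : StoppedCurve G) : IsCompact (range γ.toFun) := by
  have : range γ.toFun = γ.toFun '' Icc 0 γ.lifetime := by
    refine Subset.antisymm ?_ (image_subset_range _ _)
    rintro _ ⟨t, rfl⟩
    rcases le_total t γ.lifetime with h | h
    · exact ⟨t, ⟨zero_le, h⟩, rfl⟩
    · exact ⟨γ.lifetime, ⟨zero_le, le_rfl⟩, (γ.stopped t h).symm⟩
  rw [this]
  exact isCompact_Icc.image γ.continuous_toFun

theorem _root_.IsCompact.exists_uniform_continuousAt {K : Set ℂ} (hK : IsCompact K) {f : ℂ → ℂ}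
    (hf : ∀ a ∈ K, ContinuousAt f a) {ε : ℝ} (hε : 0 < ε) :
    ∃ δ > 0, ∀ a ∈ K, ∀ b, ‖b - a‖ ≤ δ → ‖f b - f a‖ ≤ ε := by
  obtain ⟨δ, hδ, h⟩ := Metric.mem_uniformity_dist.1
    (hK.uniformContinuousAt_of_continuousAt f hf (Metric.dist_mem_uniformity hε))
  refine ⟨δ / 2, by positivity, fun a ha b hab => ?_⟩
  have h1 : dist a b < δ := by
    rw [dist_comm, dist_eq_norm]
    linarith
  have h2 : dist (f a) (f b) < ε := h h1 ha
  rw [dist_comm, dist_eq_norm] at h2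
  exact h2.le

theorem _root_.LoewnerCase.continuousAt_toDisk (G : LoewnerCase) {z : ℂ}
    (hz : z ∈ closure G.domain) : ContinuousAt G.toDisk z := by
  cases G
  · exact continuousAt_id
  · rw [LoewnerCase.closure_domain_chordal] at hz
    exact ContinuousAt.div (by fun_prop) (by fun_prop) (LoewnerCase.two_I_add_ne_zero hz)

theorem _root_.LoewnerCase.continuousAt_fromDisk (G : LoewnerCase) {u : ℂ}
    (hu : u ∈ G.diskImage) : ContinuousAt G.fromDisk u := by
  cases G
  · exact continuousAt_id
  · exact ContinuousAt.div (by fun_prop) (by fun_prop) (LoewnerCase.one_add_ne_zero hu.2)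

/-- The capacity-parameterized and the Euclidean metric have the same convergence, because the
limit has a compact trace. -/
theorem tendsto_euclidean_iff_capacity :
    Tendsto (fun i => distance .euclidean (γ' i) γ) l (𝓝 0) ↔
      Tendsto (fun i => distance .capacity (γ' i) γ) l (𝓝 0) := by
  rw [tendsto_euclidean_iff, tendsto_capacity_iff]
  constructor
  · intro h ε hε
    obtain ⟨δ, hδ, hu⟩ := γ.isCompact_range.exists_uniform_continuousAt (f := G.toDisk)
      (by rintro _ ⟨t, rfl⟩; exact G.continuousAt_toDisk (γ.mem_closure t)) hε
    filter_upwards [h δ hδ] with i hi t using hu _ ⟨t, rfl⟩ _ (hi t)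
  · intro h ε hε
    have hc : IsCompact (G.toDisk '' range γ.toFun) :=
      γ.isCompact_range.image_of_continuousOn (G.continuousOn_toDisk.mono (by
        rintro _ ⟨t, rfl⟩; exact γ.mem_closure t))
    obtain ⟨δ, hδ, hu⟩ := hc.exists_uniform_continuousAt (f := G.fromDisk)
      (by rintro _ ⟨_, ⟨t, rfl⟩, rfl⟩
          exact G.continuousAt_fromDisk (G.toDisk_mem_diskImage (γ.mem_closure t))) hε
    filter_upwards [h δ hδ] with i hi t
    have := hu _ ⟨_, ⟨t, rfl⟩, rfl⟩ _ (hi t)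
    rwa [diskCurve, G.fromDisk_toDisk ((γ' i).mem_closure t), G.fromDisk_toDisk (γ.mem_closure t)]
      at this

theorem unitPath_one (γ : StoppedCurve G) : γ.unitPath 1 = γ.diskCurve γ.lifetime := by
  rw [unitPath_eq]
  congr 1
  exact one_mul _

theorem unitPath_mem_closedBall (γ : StoppedCurve G) (s : unitInterval) :
    γ.unitPath s ∈ Metric.closedBall (0 : ℂ) 1 :=
  G.diskImage_subset_closedBall (G.toDisk_mem_diskImage (γ.mem_closure _))

theorem diskCurve_mem_closedBall (γ : StoppedCurve G) (t : ℝ≥0) :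
    γ.diskCurve t ∈ Metric.closedBall (0 : ℂ) 1 :=
  G.diskImage_subset_closedBall (G.toDisk_mem_diskImage (γ.mem_closure _))

theorem uniformContinuous_diskCurve (γ : StoppedCurve G) : UniformContinuous γ.diskCurve := by
  refine γ.continuous_diskCurve.uniformContinuous_of_tendsto_cocompact
    (x := γ.diskCurve γ.lifetime) (tendsto_const_nhds.congr' ?_)
  filter_upwards [(isCompact_Icc (a := 0) (b := γ.lifetime)).compl_mem_cocompact] with t ht
  refine (γ.diskCurve_stopped (not_lt.1 fun h => ht ⟨zero_le, h.le⟩)).symm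

/-- Convergence in the capacity-parameterized metric implies convergence of the tips. -/
theorem tendsto_tip_of_capacity (h : Tendsto (fun i => distance .capacity (γ' i) γ) l (𝓝 0)) :
    Tendsto (fun i => G.toDisk (γ' i).tip) l (𝓝 (G.toDisk γ.tip)) := by
  rw [tendsto_capacity_iff] at h
  rw [Metric.tendsto_nhds]
  intro ε hε
  filter_upwards [h (ε / 2) (by positivity)] with i hi
  have h1 := hi (max γ.lifetime (γ' i).lifetime)
  rw [diskCurve_stopped _ (le_max_right _ _), diskCurve_stopped _ (le_max_left _ _)] at h1
  rw [dist_eq_norm]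
  exact h1.trans_lt (by linarith)

theorem tendsto_tip_of_unparameterized
    (h : Tendsto (fun i => distance .unparameterized (γ' i) γ) l (𝓝 0)) :
    Tendsto (fun i => G.toDisk (γ' i).tip) l (𝓝 (G.toDisk γ.tip)) := by
  rw [tendsto_unparameterized_iff] at h
  rw [Metric.tendsto_nhds]
  intro ε hε
  filter_upwards [h (ε / 2) (by positivity)] with i ⟨σ, hσ⟩
  have h1 := hσ 1
  have h2 : σ 1 = 1 := σ.map_top
  rw [h2, unitPath_one, unitPath_one] at h1
  rw [dist_eq_norm]
  exact h1.trans_lt (by linarith)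

theorem eventually_arcsWithin_of_capacity
    (h : Tendsto (fun i => distance .capacity (γ' i) γ) l (𝓝 0)) (ε : ℝ) (hε : 0 < ε) :
    ∀ᶠ i in l, ArcsWithin ε γ.diskCurve γ.lifetime (γ' i).diskCurve (γ' i).lifetime :=
  (h.eventually (gt_mem_nhds (ENNReal.ofReal_pos.2 hε))).mono fun _ hi => arcsWithin_of_capacity hi

theorem eventually_arcsWithin_of_unparameterized
    (h : Tendsto (fun i => distance .unparameterized (γ' i) γ) l (𝓝 0)) (ε : ℝ) (hε : 0 < ε) :
    ∀ᶠ i in l, ArcsWithin ε γ.diskCurve γ.lifetime (γ' i).diskCurve (γ' i).lifetime :=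
  (h.eventually (gt_mem_nhds (ENNReal.ofReal_pos.2 hε))).mono fun _ hi =>
    arcsWithin_of_unparameterized hi

/-! ### Continuity of the concatenation -/

variable {g f F : ℂ → ℂ} {w : ℂ} {g' f' F' : ι → ℂ → ℂ} {w' : ι → ℂ}

/-- In disk coordinates the concatenation is a sum whose terms converge uniformly: the lifetimes
converge because capacities do, so the time shift is absorbed by the uniform continuity of the
limit. -/
theorem IsTipModel.tendsto_concat_capacity (h : γ.IsTipModel g f F w)
    (hcap : G.CapacityExpansion γ.trace g γ.lifetime) (hγ : γ.IsSimple)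
    (h' : ∀ i, (γ' i).IsTipModel (g' i) (f' i) (F' i) (w' i))
    (hcap' : ∀ i, G.CapacityExpansion (γ' i).trace (g' i) (γ' i).lifetime)
    (hγ' : ∀ i, (γ' i).IsSimple) (hη : η.toFun 0 = G.start) (hη' : ∀ i, (η' i).toFun 0 = G.start)
    (hlim : Tendsto (fun i => distance .capacity (γ' i) γ) l (𝓝 0))
    (hlimη : Tendsto (fun i => distance .capacity (η' i) η) l (𝓝 0)) :
    Tendsto (fun i => distance .capacity ((h' i).concat (η' i) (hη' i)) (h.concat η hη)) l
      (𝓝 0) := by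
  have hw := eventually_arcsWithin_of_capacity hlim
  have htip := tendsto_tip_of_capacity hlim
  have hF := hγ.tendstoUniformlyOn hγ' h.model (fun i => (h' i).model) hw
  have hhat := h.tendstoUniformlyOn_diskMap h' hF (h.tendsto_image_tip h' hF htip)
  obtain ⟨r, hr, hr1, hr2⟩ := exists_separation_target h.model.isHull hw
  have hT : Tendsto (fun i => ((γ' i).lifetime : ℝ)) l (𝓝 γ.lifetime) :=
    LoewnerCase.IsDiskModel.tendsto_capacity (fun i => (h' i).model) h.model hF hr hr2 hr1 hcap' hcap
  rw [tendsto_capacity_iff] at hlim hlimη ⊢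
  intro ε hε
  have hε4 : 0 < ε / 4 := by positivity
  obtain ⟨δ, hδ, hmod⟩ := Metric.uniformContinuousOn_iff.1
    ((isCompact_closedBall (0 : ℂ) 1).uniformContinuousOn_of_continuous h.continuousOn_diskMap)
    (ε / 4) hε4
  obtain ⟨ρ, hρ, hηmod⟩ := Metric.uniformContinuous_iff.1 η.uniformContinuous_diskCurve (δ / 2)
    (by positivity)
  filter_upwards [hlim _ hε4, hlimη (δ / 3) (by positivity), Metric.tendsto_nhds.1 htip _ hε4,
    Metric.tendsto_nhds.1 hT _ hρ, Metric.tendstoUniformlyOn_iff.1 hhat _ hε4]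
    with i h1 h2 h3 h4 h5 t
  rw [h.diskCurve_concat, (h' i).diskCurve_concat]
  set a := (η' i).diskCurve (t - (γ' i).lifetime)
  set b := η.diskCurve (t - γ.lifetime)
  have ha : a ∈ Metric.closedBall (0 : ℂ) 1 := diskCurve_mem_closedBall _ _
  have hb : b ∈ Metric.closedBall (0 : ℂ) 1 := diskCurve_mem_closedBall _ _
  have hab : dist a b < δ := by
    have h6 : dist (t - (γ' i).lifetime) (t - γ.lifetime) < ρ := by
      refine lt_of_le_of_lt ?_ h4
      rw [NNReal.dist_eq, NNReal.coe_sub_def, NNReal.coe_sub_def, Real.dist_eq]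
      refine (abs_max_sub_max_le_abs _ _ _).trans_eq ?_
      rw [sub_sub_sub_cancel_left, abs_sub_comm]
    have h7 := hηmod h6
    have h8 := h2 (t - (γ' i).lifetime)
    rw [← dist_eq_norm] at h8
    have := dist_triangle a (η.diskCurve (t - (γ' i).lifetime)) b
    linarith
  have h6 := hmod a ha b hb hab
  have h7 := h5 a ha
  rw [dist_comm] at h7
  rw [dist_eq_norm] at h3 h6 h7
  have h8 := h1 t
  have e : (γ' i).diskCurve t + F' i (G.diskUncenter (w' i) a) - (γ' i).diskCurve (γ' i).lifetime -
      (γ.diskCurve t + F (G.diskUncenter w b) - γ.diskCurve γ.lifetime) =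
      ((γ' i).diskCurve t - γ.diskCurve t) +
      ((F' i (G.diskUncenter (w' i) a) - F (G.diskUncenter w a)) +
      (F (G.diskUncenter w a) - F (G.diskUncenter w b))) -
      (G.toDisk (γ' i).tip - G.toDisk γ.tip) := by
    simp only [diskCurve, tip]
    ring
  rw [e]
  refine (norm_sub_le _ _).trans ?_
  have h9 := norm_add_le ((γ' i).diskCurve t - γ.diskCurve t)
    ((F' i (G.diskUncenter (w' i) a) - F (G.diskUncenter w a)) +
      (F (G.diskUncenter w a) - F (G.diskUncenter w b)))
  have h10 := norm_add_le (F' i (G.diskUncenter (w' i) a) - F (G.diskUncenter w a))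
    (F (G.diskUncenter w a) - F (G.diskUncenter w b))
  linarith

/-- A monotone continuous surjection of the unit interval is a uniform limit of increasing
homeomorphisms. -/
theorem exists_orderIso_near {φ : unitInterval → unitInterval} (hc : Continuous φ)
    (hm : Monotone φ) (h0 : φ 0 = 0) (h1 : φ 1 = 1) {κ : ℝ} (hκ : 0 < κ) :
    ∃ e : unitInterval ≃o unitInterval, ∀ u, dist (e u) (φ u) ≤ κ := by
  obtain ⟨k, hk0, hk1, hkκ⟩ : ∃ k : ℝ, 0 < k ∧ k ≤ 1 ∧ k ≤ κ :=
    ⟨min 1 κ, by positivity, min_le_left _ _, min_le_right _ _⟩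
  have hmem : ∀ u : unitInterval, (1 - k) * (φ u : ℝ) + k * u ∈ Icc (0 : ℝ) 1 := by
    intro u
    have h2 := (φ u).2
    have h3 := u.2
    have h4 : 0 ≤ 1 - k := by linarith
    constructor
    · exact add_nonneg (mul_nonneg h4 h2.1) (mul_nonneg hk0.le h3.1)
    · nlinarith [mul_le_mul_of_nonneg_left h2.2 h4, mul_le_mul_of_nonneg_left h3.2 hk0.le]
  set e : unitInterval → unitInterval := fun u => ⟨_, hmem u⟩ with he
  have hs : StrictMono e := by
    intro u v huv
    have h2 : (φ u : ℝ) ≤ φ v := hm huv.le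
    have h3 : (u : ℝ) < v := huv
    have h4 : 0 ≤ 1 - k := by linarith
    change (1 - k) * (φ u : ℝ) + k * u < (1 - k) * (φ v : ℝ) + k * v
    exact add_lt_add_of_le_of_lt (mul_le_mul_of_nonneg_left h2 h4) (mul_lt_mul_of_pos_left h3 hk0)
  have hec : Continuous e := Continuous.subtype_mk (by fun_prop) _
  have hsurj : Function.Surjective e := fun c => by
    refine mem_range_of_exists_le_of_exists_ge hec ⟨0, ?_⟩ ⟨1, ?_⟩
    · refine le_trans (le_of_eq (Subtype.ext ?_)) (show (0 : unitInterval) ≤ c from c.2.1)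
      simp [he, h0]
    · refine le_trans (show c ≤ (1 : unitInterval) from c.2.2) (le_of_eq (Subtype.ext ?_))
      simp [he, h1]
  refine ⟨hs.orderIsoOfSurjective e hsurj, fun u => ?_⟩
  rw [Subtype.dist_eq, Real.dist_eq]
  change |(1 - k) * (φ u : ℝ) + k * u - φ u| ≤ κ
  have h2 : (1 - k) * (φ u : ℝ) + k * u - φ u = k * (u - φ u) := by ring
  have h3 : |(u : ℝ) - φ u| ≤ 1 :=
    abs_le.2 ⟨by linarith [u.2.1, (φ u).2.2], by linarith [u.2.2, (φ u).2.1]⟩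
  rw [h2, abs_mul, abs_of_pos hk0]
  nlinarith

/-- Monotone continuous surjections may be used in place of increasing homeomorphisms to compare
unparameterized paths. -/
theorem exists_orderIso_of_monotone {A B : unitInterval → ℂ} (hA : Continuous A)
    (hB : Continuous B) {φ ψ : unitInterval → unitInterval} (hφ : Continuous φ) (hφm : Monotone φ)
    (hφ0 : φ 0 = 0) (hφ1 : φ 1 = 1) (hψ : Continuous ψ) (hψm : Monotone ψ) (hψ0 : ψ 0 = 0)
    (hψ1 : ψ 1 = 1) {ε δ : ℝ} (hδ : 0 < δ) (h : ∀ u, ‖A (φ u) - B (ψ u)‖ ≤ ε) :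
    ∃ σ : unitInterval ≃o unitInterval, ∀ s, ‖A s - B (σ s)‖ ≤ ε + δ := by
  obtain ⟨a, ha, hAu⟩ := Metric.uniformContinuous_iff.1
    (CompactSpace.uniformContinuous_of_continuous hA) (δ / 2) (by positivity)
  obtain ⟨b, hb, hBu⟩ := Metric.uniformContinuous_iff.1
    (CompactSpace.uniformContinuous_of_continuous hB) (δ / 2) (by positivity)
  obtain ⟨e, he⟩ := exists_orderIso_near hφ hφm hφ0 hφ1 (half_pos ha)
  obtain ⟨e', he'⟩ := exists_orderIso_near hψ hψm hψ0 hψ1 (half_pos hb)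
  refine ⟨e.symm.trans e', fun s => ?_⟩
  set u := e.symm s
  have hs : s = e u := (e.apply_symm_apply s).symm
  change ‖A s - B (e' u)‖ ≤ _
  rw [hs, ← dist_eq_norm]
  have h1 := hAu ((he u).trans_lt (half_lt_self ha))
  have h2 := hBu ((he' u).trans_lt (half_lt_self hb))
  have h3 := h u
  rw [← dist_eq_norm] at h3
  have h4 := dist_triangle4 (A (e u)) (A (φ u)) (B (ψ u)) (B (e' u))
  rw [dist_comm (B (ψ u))] at h4
  linarith

/-- The lifetimes `T` and `S` of two pieces that are run through according to `α` and `β` are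
combined into a parameterization of `[0, T + S]`. -/
theorem exists_combined_parameter (T S : ℝ≥0) {α β : unitInterval → unitInterval}
    (hα : Continuous α) (hαm : Monotone α) (hα0 : α 0 = 0) (hα1 : α 1 = 1) (hβ : Continuous β)
    (hβm : Monotone β) (hβ0 : β 0 = 0) (hβ1 : β 1 = 1) :
    ∃ φ : unitInterval → unitInterval, Continuous φ ∧ Monotone φ ∧ φ 0 = 0 ∧ φ 1 = 1 ∧
      ∀ u, unitInterval.toNNReal (φ u) * (T + S) =
        unitInterval.toNNReal (α u) * T + unitInterval.toNNReal (β u) * S := by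
  rcases eq_or_ne (T + S) 0 with h0 | h0
  · obtain ⟨hT, hS⟩ := add_eq_zero.1 h0
    exact ⟨id, continuous_id, monotone_id, rfl, rfl, fun u => by rw [hT, hS]; simp⟩
  have hpos : (0 : ℝ) < T + S := by exact_mod_cast pos_iff_ne_zero.2 h0
  have hmem : ∀ u, ((α u : ℝ) * T + β u * S) / (T + S) ∈ Icc (0 : ℝ) 1 := by
    intro u
    have h1 := mul_le_mul_of_nonneg_right (α u).2.2 T.2
    have h2 := mul_le_mul_of_nonneg_right (β u).2.2 S.2
    have h3 := mul_nonneg (α u).2.1 T.2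
    have h4 := mul_nonneg (β u).2.1 S.2
    refine ⟨div_nonneg (add_nonneg h3 h4) hpos.le, (div_le_one hpos).2 ?_⟩
    rw [one_mul] at h1 h2
    exact add_le_add h1 h2
  refine ⟨fun u => ⟨_, hmem u⟩, Continuous.subtype_mk (by fun_prop) _, fun u v huv => ?_, ?_, ?_,
    fun u => ?_⟩
  · have h1 : (α u : ℝ) ≤ α v := hαm huv
    have h2 : (β u : ℝ) ≤ β v := hβm huv
    change ((α u : ℝ) * T + β u * S) / (T + S) ≤ ((α v : ℝ) * T + β v * S) / (T + S)
    gcongr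
  · exact Subtype.ext (by simp [hα0, hβ0])
  · exact Subtype.ext (by simp [hα1, hβ1, hpos.ne'])
  · refine NNReal.coe_injective ?_
    change ((α u : ℝ) * T + β u * S) / (T + S) * (T + S) = (α u : ℝ) * T + β u * S
    field_simp

/-- The formula for the concatenation when the two pieces are run through one after the other. -/
theorem IsTipModel.diskCurve_concat_add (h : γ.IsTipModel g f F w) (hη : η.toFun 0 = G.start)
    {a b : unitInterval} (hab : a = 1 ∨ b = 0) :
    (h.concat η hη).diskCurve (unitInterval.toNNReal a * γ.lifetime + unitInterval.toNNReal b * η.lifetime) =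
      γ.unitPath a + F (G.diskUncenter w (η.unitPath b)) - γ.unitPath 1 := by
  rw [h.diskCurve_concat, unitPath_one]
  rcases hab with rfl | rfl
  · have e1 : unitInterval.toNNReal 1 = 1 := rfl
    rw [unitPath_one, e1, one_mul, add_tsub_cancel_left, γ.diskCurve_stopped le_self_add]
    rfl
  · have e0 : unitInterval.toNNReal 0 = 0 := rfl
    have h1 : unitInterval.toNNReal a * γ.lifetime ≤ γ.lifetime :=
      mul_le_of_le_one_left zero_le (show unitInterval.toNNReal a ≤ 1 from a.2.2)
    rw [unitPath_eq, unitPath_eq, e0, zero_mul, add_zero, tsub_eq_zero_of_le h1]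

/-- Reparameterizations of the two pieces are combined into one of the concatenation. Capacities play
no role, since each piece keeps its own share of the parameter interval. -/
theorem IsTipModel.tendsto_concat_unparameterized (h : γ.IsTipModel g f F w) (hγ : γ.IsSimple)
    (h' : ∀ i, (γ' i).IsTipModel (g' i) (f' i) (F' i) (w' i))
    (hγ' : ∀ i, (γ' i).IsSimple) (hη : η.toFun 0 = G.start) (hη' : ∀ i, (η' i).toFun 0 = G.start)
    (hlim : Tendsto (fun i => distance .unparameterized (γ' i) γ) l (𝓝 0))
    (hlimη : Tendsto (fun i => distance .unparameterized (η' i) η) l (𝓝 0)) :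
    Tendsto (fun i => distance .unparameterized ((h' i).concat (η' i) (hη' i)) (h.concat η hη)) l
      (𝓝 0) := by
  have hw := eventually_arcsWithin_of_unparameterized hlim
  have htip := tendsto_tip_of_unparameterized hlim
  have hF := hγ.tendstoUniformlyOn hγ' h.model (fun i => (h' i).model) hw
  have hhat := h.tendstoUniformlyOn_diskMap h' hF (h.tendsto_image_tip h' hF htip)
  rw [tendsto_unparameterized_iff] at hlim hlimη ⊢
  intro ε hε
  have hε5 : 0 < ε / 5 := by positivity
  obtain ⟨δ, hδ, hmod⟩ := Metric.uniformContinuousOn_iff.1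
    ((isCompact_closedBall (0 : ℂ) 1).uniformContinuousOn_of_continuous h.continuousOn_diskMap)
    (ε / 5) hε5
  -- the two pieces are run through on the two halves of the unit interval
  set u₁ : unitInterval → unitInterval := fun u => projIcc 0 1 zero_le_one (2 * (u : ℝ)) with hu₁
  set u₂ : unitInterval → unitInterval := fun u => projIcc 0 1 zero_le_one (2 * (u : ℝ) - 1) with hu₂
  have c₁ : Continuous u₁ := continuous_projIcc.comp (by fun_prop)
  have c₂ : Continuous u₂ := continuous_projIcc.comp (by fun_prop)
  have m₁ : Monotone u₁ := fun u v huv => monotone_projIcc _ (by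
    have : (u : ℝ) ≤ v := huv
    linarith)
  have m₂ : Monotone u₂ := fun u v huv => monotone_projIcc _ (by
    have : (u : ℝ) ≤ v := huv
    linarith)
  have z₁ : u₁ 0 = 0 := projIcc_of_le_left _ (by simp)
  have z₂ : u₂ 0 = 0 := projIcc_of_le_left _ (by simp)
  have o₁ : u₁ 1 = 1 := projIcc_of_right_le _ (by simp)
  have o₂ : u₂ 1 = 1 := projIcc_of_right_le _ (by norm_num)
  have halt : ∀ u, u₁ u = 1 ∨ u₂ u = 0 := fun u => by
    rcases le_total (1 / 2 : ℝ) u with h1 | h1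
    · exact Or.inl (projIcc_of_right_le _ (by linarith))
    · exact Or.inr (projIcc_of_le_left _ (by linarith))
  filter_upwards [hlim _ hε5, hlimη (δ / 2) (by positivity), Metric.tendsto_nhds.1 htip _ hε5,
    Metric.tendstoUniformlyOn_iff.1 hhat _ hε5] with i ⟨σ, hσ⟩ ⟨τ, hτ⟩ h3 h5
  obtain ⟨φ, φc, φm, φ0, φ1, hφ⟩ := exists_combined_parameter (γ' i).lifetime (η' i).lifetime
    c₁ m₁ z₁ o₁ c₂ m₂ z₂ o₂
  have σ0 : σ 0 = 0 := σ.map_bot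
  have σ1 : σ 1 = 1 := σ.map_top
  have τ0 : τ 0 = 0 := τ.map_bot
  have τ1 : τ 1 = 1 := τ.map_top
  obtain ⟨ψ, ψc, ψm, ψ0, ψ1, hψ⟩ := exists_combined_parameter γ.lifetime η.lifetime
    (α := fun u => σ (u₁ u)) (β := fun u => τ (u₂ u)) (σ.continuous.comp c₁)
    (σ.monotone.comp m₁) (by rw [z₁, σ0]) (by rw [o₁, σ1]) (τ.continuous.comp c₂)
    (τ.monotone.comp m₂) (by rw [z₂, τ0]) (by rw [o₂, τ1])
  suffices hclose : ∀ u, ‖((h' i).concat (η' i) (hη' i)).unitPath (φ u) -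
      (h.concat η hη).unitPath (ψ u)‖ ≤ 4 * (ε / 5) by
    obtain ⟨ρ, hρ⟩ := exists_orderIso_of_monotone
      ((h' i).concat (η' i) (hη' i)).continuous_unitPath (h.concat η hη).continuous_unitPath
      φc φm φ0 φ1 ψc ψm ψ0 ψ1 hε5 hclose
    exact ⟨ρ, fun s => (hρ s).trans (by linarith)⟩
  intro u
  have e1 : ((h' i).concat (η' i) (hη' i)).unitPath (φ u) = (γ' i).unitPath (u₁ u) +
      F' i (G.diskUncenter (w' i) ((η' i).unitPath (u₂ u))) - (γ' i).unitPath 1 := by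
    rw [← (h' i).diskCurve_concat_add (hη' i) (halt u), ← hφ u]
    rfl
  have e2 : (h.concat η hη).unitPath (ψ u) = γ.unitPath (σ (u₁ u)) +
      F (G.diskUncenter w (η.unitPath (τ (u₂ u)))) - γ.unitPath 1 := by
    rw [← h.diskCurve_concat_add hη ((halt u).imp (fun h1 => by rw [h1, σ1])
      (fun h1 => by rw [h1, τ0])), ← hψ u]
    rfl
  rw [e1, e2]
  set a := (η' i).unitPath (u₂ u)
  set b := η.unitPath (τ (u₂ u))
  have ha : a ∈ Metric.closedBall (0 : ℂ) 1 := unitPath_mem_closedBall _ _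
  have hb : b ∈ Metric.closedBall (0 : ℂ) 1 := unitPath_mem_closedBall _ _
  have hab : dist a b < δ := by
    rw [dist_eq_norm]
    exact (hτ (u₂ u)).trans_lt (by linarith)
  have h6 := hmod a ha b hb hab
  have h7 := h5 a ha
  rw [dist_comm] at h7
  rw [dist_eq_norm] at h3 h6 h7
  have h8 := hσ (u₁ u)
  have e : (γ' i).unitPath (u₁ u) + F' i (G.diskUncenter (w' i) a) - (γ' i).unitPath 1 -
      (γ.unitPath (σ (u₁ u)) + F (G.diskUncenter w b) - γ.unitPath 1) =
      ((γ' i).unitPath (u₁ u) - γ.unitPath (σ (u₁ u))) +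
      ((F' i (G.diskUncenter (w' i) a) - F (G.diskUncenter w a)) +
      (F (G.diskUncenter w a) - F (G.diskUncenter w b))) -
      (G.toDisk (γ' i).tip - G.toDisk γ.tip) := by
    rw [unitPath_one, unitPath_one]
    simp only [diskCurve, tip]
    ring
  rw [e]
  refine (norm_sub_le _ _).trans ?_
  have h9 := norm_add_le ((γ' i).unitPath (u₁ u) - γ.unitPath (σ (u₁ u)))
    ((F' i (G.diskUncenter (w' i) a) - F (G.diskUncenter w a)) +
      (F (G.diskUncenter w a) - F (G.diskUncenter w b)))
  have h10 := norm_add_le (F' i (G.diskUncenter (w' i) a) - F (G.diskUncenter w a))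
    (F (G.diskUncenter w a) - F (G.diskUncenter w b))
  linarith

/-- Concatenation is continuous with respect to each of the three metrics. -/
theorem IsTipModel.tendsto_concat (m : CurveMetric) (h : γ.IsTipModel g f F w)
    (hcap : G.CapacityExpansion γ.trace g γ.lifetime) (hγ : γ.IsSimple)
    (h' : ∀ i, (γ' i).IsTipModel (g' i) (f' i) (F' i) (w' i))
    (hcap' : ∀ i, G.CapacityExpansion (γ' i).trace (g' i) (γ' i).lifetime)
    (hγ' : ∀ i, (γ' i).IsSimple) (hη : η.toFun 0 = G.start) (hη' : ∀ i, (η' i).toFun 0 = G.start)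
    (hlim : Tendsto (fun i => distance m (γ' i) γ) l (𝓝 0))
    (hlimη : Tendsto (fun i => distance m (η' i) η) l (𝓝 0)) :
    Tendsto (fun i => distance m ((h' i).concat (η' i) (hη' i)) (h.concat η hη)) l (𝓝 0) := by
  cases m
  · exact h.tendsto_concat_capacity hcap hγ h' hcap' hγ' hη hη' hlim hlimη
  · rw [tendsto_euclidean_iff_capacity] at *
    exact h.tendsto_concat_capacity hcap hγ h' hcap' hγ' hη hη' hlim hlimη
  · exact h.tendsto_concat_unparameterized hγ h' hγ' hη hη' hlim hlimη

/-- Curves in the closure still start at the starting point, so that the concatenation is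
continuous. -/
theorem start_eq_of_mem_closure {T : ℝ≥0} (h : η ∈ closureOfCapacity G T) :
    η.toFun 0 = G.start := by
  let := metricStructure G .capacity
  have h1 : ∀ ε : ℝ, 0 < ε → ‖G.toDisk (η.toFun 0) - 1‖ ≤ ε := by
    intro ε hε
    obtain ⟨γ, hγ, hd⟩ := EMetric.mem_closure_iff.1 h.2 _ (ENNReal.ofReal_pos.2 hε)
    have h2 := norm_diskCurve_sub_lt (γ := η) (η := γ) hd 0
    rw [hγ.1.isDiskArc.start_eq] at h2
    exact h2.le
  have h2 : G.toDisk (η.toFun 0) = G.toDisk G.start := by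
    rw [G.toDisk_start, ← sub_eq_zero, ← norm_le_zero_iff]
    exact le_of_forall_pos_le_add fun ε hε => by simpa using h1 ε hε
  exact G.toDisk_injOn (η.mem_closure 0) G.start_mem_closure h2

/-- The second curve is a limit of simple curves, and concatenations of simple curves are simple. -/
theorem IsTipModel.concat_mem_closure (h : γ.IsTipModel g f F w)
    (hcap : G.CapacityExpansion γ.trace g γ.lifetime) (hγ : γ.IsSimple) {S : ℝ≥0}
    (hη : η ∈ closureOfCapacity G S) :
    h.concat η (start_eq_of_mem_closure hη) ∈ closureOfCapacity G (γ.lifetime + S) := by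
  refine ⟨congrArg (γ.lifetime + ·) hη.1, ?_⟩
  let := metricStructure G .capacity
  have hne := mem_closure_iff_comap_neBot.1 hη.2
  have hlim : Tendsto (fun i : simpleOfCapacity G S => distance .capacity (i : StoppedCurve G) η)
      (comap (fun i : simpleOfCapacity G S => (i : StoppedCurve G)) (𝓝 η)) (𝓝 0) :=
    tendsto_iff_edist_tendsto_0.1 tendsto_comap
  have hconv := h.tendsto_concat .capacity hcap hγ (γ' := fun _ => γ) (fun _ => h) (fun _ => hcap)
    (fun _ => hγ) (start_eq_of_mem_closure hη) (fun i => i.2.1.start_eq)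
    (by simpa only [distance_self] using tendsto_const_nhds) hlim
  refine mem_closure_of_tendsto (tendsto_iff_edist_tendsto_0.2 hconv) (.of_forall fun i => ?_)
  exact ⟨h.isSimple_concat hγ hcap i.2.1, congrArg (γ.lifetime + ·) i.2.2⟩

end StoppedCurve

/-! ### The concatenation map -/

theorem SimpleFinite.isSimple {G : LoewnerCase} (γ : SimpleFinite G) : γ.curve.IsSimple := by
  obtain ⟨T, hT⟩ := mem_iUnion.1 γ.2
  exact hT.1

theorem ClosureFinite.mem_closureOfCapacity {G : LoewnerCase} (η : ClosureFinite G) :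
    η.curve ∈ StoppedCurve.closureOfCapacity G η.curve.lifetime := by
  obtain ⟨T, hT⟩ := mem_iUnion.1 η.2
  have h1 : η.curve.lifetime = T := hT.1
  rw [h1]
  exact hT

theorem mainTheorem11 (G : LoewnerCase) :
    ∃ concat : SimpleFinite G × ClosureFinite G → ClosureFinite G,
      (∀ (γ : SimpleFinite G) (η : ClosureFinite G) (ζ : StoppedCurve G),
        StoppedCurve.IsConcatenation γ.curve η.curve ζ ↔ ζ = (concat (γ, η)).curve) ∧
      ∀ m : CurveMetric,
        @Continuous (SimpleFinite G × ClosureFinite G) (ClosureFinite G)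
          (@instTopologicalSpaceProd _ _ (SimpleFinite.topology G m) (ClosureFinite.topology G m))
          (ClosureFinite.topology G m) concat := by
  choose g f F w h hcap using fun γ : SimpleFinite G => γ.isSimple.exists_isTipModel
  have hstart : ∀ η : ClosureFinite G, η.curve.toFun 0 = G.start := fun η =>
    StoppedCurve.start_eq_of_mem_closure η.mem_closureOfCapacity
  have hmem : ∀ (γ : SimpleFinite G) (η : ClosureFinite G), (h γ).concat η.curve (hstart η) ∈
      ⋃ T : ℝ≥0, StoppedCurve.closureOfCapacity G T := fun γ η => mem_iUnion.2
    ⟨_, (h γ).concat_mem_closure (hcap γ) γ.isSimple η.mem_closureOfCapacity⟩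
  refine ⟨fun p => ⟨_, hmem p.1 p.2⟩, fun γ η ζ => (h γ).isConcatenation_iff (hstart η), fun m => ?_⟩
  let := StoppedCurve.metricStructure G m
  let := SimpleFinite.topology G m
  let := ClosureFinite.topology G m
  have h1 : ∀ p, Tendsto (fun q : SimpleFinite G × ClosureFinite G => q.1.curve) (𝓝 p)
      (𝓝 p.1.curve) := (continuous_induced_dom.comp continuous_fst).tendsto
  have h2 : ∀ p, Tendsto (fun q : SimpleFinite G × ClosureFinite G => q.2.curve) (𝓝 p)
      (𝓝 p.2.curve) := (continuous_induced_dom.comp continuous_snd).tendsto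
  refine continuous_induced_rng.2 (continuous_iff_continuousAt.2 fun p => ?_)
  have h3 := (h p.1).tendsto_concat m (hcap p.1) p.1.isSimple
    (fun q : SimpleFinite G × ClosureFinite G => h q.1) (fun q => hcap q.1) (fun q => q.1.isSimple)
    (hstart p.2) (fun q => hstart q.2)
    (tendsto_iff_edist_tendsto_0.1 (h1 p)) (tendsto_iff_edist_tendsto_0.1 (h2 p))
  exact tendsto_iff_edist_tendsto_0.2 h3
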